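/- Let $\mathrm{Nil}_3$ be $\mathbb R^3$ with the Riemannian metric $dx_1^2+dx_2^2+\bigl(dx_3+\tfrac12(x_2dx_1-x_1dx_2)\bigr)^2$ and the orthonormal frame $E_1=\partial_{x_1}-\frac{x_2}2\partial_{x_3}$, $E_2=\partial_{x_2}+\frac{x_1}2\partial_{x_3}$, $E_3=\partial_{x_3}$. The Gauss map of an immersed surface is its unit normal, expressed in this frame, followed by the stereographic projection from the south pole onto $\mathbb C\cup\{\infty\}$. Let $\alpha>0$. For $\theta\in\mathbb R$ put $C=\frac{\sin 2\theta}{2\alpha}$, $P(x)=\alpha^2+\cos(2\theta)x^2-C^2x^4$, and let $\theta^+_\alpha=\frac\pi2$ if $\alpha>1$, $\theta^+_\alpha=\frac12\arccos(1-2\alpha^2)$ if $\alpha\le1$. There is a unique $\theta=\tilde\theta_\alpha\in(0,\theta^+_\alpha)\cap(0,\frac\pi4)$ such that $$\int_{-1}^1\frac{2\alpha C^2x^2-\alpha\cos(2\theta)+C^2x^2\sqrt{P(x)}}{\sqrt{(1-x^2)P(x)}\,\bigl(\alpha+\sqrt{P(x)}\bigr)}\,dx=0 .$$ Fix this $\theta$.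 There is a unique differentiable $\varphi:\mathbb R\to\mathbb R$ with $\varphi'^2=P(\cos\varphi)$, $\varphi(0)=0$, $\varphi'(0)\le0$. Define $\beta,G$ by $\beta'=C\cos^2\varphi$, $G'=\frac{C^2\cos^2\varphi-\cos2\theta}{\alpha-\varphi'}$, $\beta(0)=G(0)=0$, put $A=\alpha v+\beta(u)$ for $z=u+iv\in\mathbb C$, and let $g:\mathbb C\to\mathbb C\cup\{\infty\}$ and $X=(F,h):\mathbb C\to\mathbb C\times\mathbb R=\mathrm{Nil}_3$, $F=x_1+ix_2$, $h=x_3$, be $$g=\frac{\sin\varphi+i\sinh A}{\cos\varphi+\cosh A}=\frac{\cosh A-\cos\varphi}{\sin\varphi-i\sinh A},\qquad F=\frac{G'}{\alpha}\cos\varphi\sinh A-\frac C\alpha\sin\varphi\cosh A+i(Cv-G),$$ $$h=-\frac1\alpha\Bigl(G'\sin\varphi+\frac{C^2}\alpha\sin\varphi+\frac{(Cv-G)G'}2\cos\varphi\Bigr)\sinh A+\frac1\alpha\Bigl(-C\cos\varphi+\frac{CG'}\alpha\cos\varphi+\frac{C(Cv-G)}2\sin\varphi\Bigr)\cosh A .$$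 The horizontal catenoid of parameter $\alpha$ is $\mathcal C_\alpha=X(\mathbb C)$. The following hold. 0. The map $g$ satisfies $(1-|g|^2)g_{z\bar z}+2\bar g g_zg_{\bar z}=0$ (in the coordinate $1/g$ where $g=\infty$; the equation has the same form there). The map $X$ is a smooth conformal minimal immersion with Gauss map $g$, and wherever $g\ne\infty$ and $|g|\neq1$ it satisfies the Weierstrass equations $F_z=\frac{-4ig_z}{(1-|g|^2)^2}$, $F_{\bar z}=\frac{-4ig^2\bar g_{\bar z}}{(1-|g|^2)^2}$, $h_z=\frac{4i\bar gg_z}{(1-|g|^2)^2}-\frac i4(\bar FF_z-F\bar F_z)$. 1. For every $c\in\mathbb R$ the intersection of $\mathcal C_\alpha$ with the plane $x_2=c$ is a non-empty closed embedded convex curve: in the Euclidean coordinates $(x_1,\,x_3+\frac12x_1x_2)$ of this plane it is a smooth regular simple closed curve that is the boundary of its convex hull. 2. $\mathcal C_\alpha$ is a properly embedded minimal annulus, conformally equivalent to $\mathbb C\setminus\{0\}$: there are $Z\in\mathbb C\setminus\{0\}$ and a smooth conformal minimal immersion $Y:\mathbb C\setminus\{0\}\to\mathrm{Nil}_3$ that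 is injective and proper (a closed embedding), has image $\mathcal C_\alpha$, and satisfies $X(z)=Y(e^{2\pi iz/Z})$ for all $z\in\mathbb C$. 3. $\mathcal C_\alpha$ is invariant under the rotations of angle $\pi$ around the $x_1$-, $x_2$- and $x_3$-axes, that is, $(x_1,-x_2,-x_3)$, $(-x_1,x_2,-x_3)$ and $(-x_1,-x_2,x_3)$. The $x_2$-axis is contained in the interior of $\mathcal C_\alpha$: for every $c$ the point $(0,c,0)$ lies in the bounded region enclosed by the curve $\mathcal C_\alpha\cap\{x_2=c\}$ in the plane $x_2=c$. 4. $\mathcal C_\alpha$ is not invariant under any (non-trivial) one-parameter group of isometries of $\mathrm{Nil}_3$. -/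

import Mathlib

open scoped ContDiff Matrix ComplexConjugate

noncomputable section

namespace NilCatenoid

/-! ## The Heisenberg group `Nil₃`: `ℝ³` with the metric
`dx₁² + dx₂² + (dx₃ + (x₂ dx₁ - x₁ dx₂)/2)²`
(the coordinates `x₁, x₂, x₃` are the components `0, 1, 2`). -/

/-- The underlying manifold of `Nil₃`. -/
abbrev Nil : Type := Fin 3 → ℝ

/-- The components of a tangent vector `v` at `p` in the left-invariant orthonormal frame
`E₁ = ∂₁ - (x₂/2) ∂₃`, `E₂ = ∂₂ + (x₁/2) ∂₃`, `E₃ = ∂₃`. -/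
def frameCoord (p v : Nil) : Fin 3 → ℝ :=
  ![v 0, v 1, v 2 + (p 1 * v 0 - p 0 * v 1) / 2]

/-- The Riemannian metric of `Nil₃` at `p`. -/
def nilInner (p v w : Nil) : ℝ := frameCoord p v ⬝ᵥ frameCoord p w

/-- The matrix `(g_ij(p))` of the metric in the coordinates `x₁, x₂, x₃`. -/
def nilMetric (p : Nil) : Matrix (Fin 3) (Fin 3) ℝ :=
  fun i j => nilInner p (Pi.single i 1) (Pi.single j 1)

/-- The partial derivative `∂_i g_jl` at `p`. -/
def nilMetricDeriv (p : Nil) (i j l : Fin 3) : ℝ :=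
  fderiv ℝ (fun q : Nil => nilMetric q j l) p (Pi.single i 1)

/-- The Christoffel symbols `Γ^k_ij` of the Levi-Civita connection of `Nil₃`. -/
def christoffel (p : Nil) (i j k : Fin 3) : ℝ :=
  (1 / 2) * ∑ l, (nilMetric p)⁻¹ k l *
    (nilMetricDeriv p i j l + nilMetricDeriv p j i l - nilMetricDeriv p l i j)

/-- A (Riemannian) isometry of `Nil₃`: a smooth bijection preserving the metric tensor. -/
def IsNilIsometry (T : Nil → Nil) : Prop :=
  Function.Bijective T ∧ ContDiff ℝ ∞ T ∧
    ∀ p v w, nilInner (T p) (fderiv ℝ T p v) (fderiv ℝ T p w) = nilInner p v w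

/-- A one-parameter group of isometries of `Nil₃` (not reduced to the identity). -/
structure IsOneParameterGroup (Φ : ℝ → Nil → Nil) : Prop where
  isometry : ∀ t, IsNilIsometry (Φ t)
  map_zero : Φ 0 = id
  map_add : ∀ s t, Φ (s + t) = Φ s ∘ Φ t
  continuous : ∀ p, Continuous fun t => Φ t p
  nontrivial : ∃ t, Φ t ≠ id

/-- The rotation of angle `π` around the `x₁`-axis. -/
def rotX1 (p : Nil) : Nil := ![p 0, -p 1, -p 2]

/-- The rotation of angle `π` around the `x₂`-axis. -/
def rotX2 (p : Nil) : Nil := ![-p 0, p 1, -p 2]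

/-- The rotation of angle `π` around the `x₃`-axis. -/
def rotX3 (p : Nil) : Nil := ![-p 0, -p 1, p 2]

/-! ## Parametrized surfaces in `Nil₃`

A surface is parametrized by the variable `z = u + i v` in an open subset of `ℂ`; the directions
`1` and `Complex.I` correspond to `∂/∂u` and `∂/∂v`. -/

/-- The derivative of `f` at `z` in the direction `a`. -/
def pd {E : Type*} [NormedAddCommGroup E] [NormedSpace ℝ E] (a : ℂ) (f : ℂ → E) (z : ℂ) : E :=
  fderiv ℝ f z a

/-- The first fundamental form of `f`. -/
def firstForm (f : ℂ → Nil) (z a b : ℂ) : ℝ := nilInner (f z) (pd a f z) (pd b f z)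

/-- The vector product `f_u × f_v`, in the frame `(E₁, E₂, E₃)`. -/
def normalVector (f : ℂ → Nil) (z : ℂ) : Fin 3 → ℝ :=
  crossProduct (frameCoord (f z) (pd 1 f z)) (frameCoord (f z) (pd Complex.I f z))

/-- The unit normal vector `N` of `f`, in the frame `(E₁, E₂, E₃)`. -/
def unitNormal (f : ℂ → Nil) (z : ℂ) : Fin 3 → ℝ :=
  (Real.sqrt (normalVector f z ⬝ᵥ normalVector f z))⁻¹ • normalVector f z

/-- The covariant derivative `∇_a ∂_b f` along `f`, in the coordinates of `Nil₃`. -/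
def covDeriv (f : ℂ → Nil) (z a b : ℂ) : Nil := fun k =>
  pd a (pd b f) z k + ∑ i, ∑ j, christoffel (f z) i j k * pd a f z i * pd b f z j

/-- The second fundamental form of `f`. -/
def secondForm (f : ℂ → Nil) (z a b : ℂ) : ℝ :=
  frameCoord (f z) (covDeriv f z a b) ⬝ᵥ unitNormal f z

/-- The mean curvature of `f`: half the trace of the second fundamental form with respect to the
first one. -/
def meanCurvature (f : ℂ → Nil) (z : ℂ) : ℝ :=
  (secondForm f z 1 1 * firstForm f z Complex.I Complex.I
      - 2 * secondForm f z 1 Complex.I * firstForm f z 1 Complex.I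
      + secondForm f z Complex.I Complex.I * firstForm f z 1 1) /
    (2 * (firstForm f z 1 1 * firstForm f z Complex.I Complex.I
      - firstForm f z 1 Complex.I ^ 2))

/-- `f` is a smooth conformal minimal immersion of the open set `U ⊆ ℂ` into `Nil₃`. -/
structure IsConformalMinimalImmersionOn (f : ℂ → Nil) (U : Set ℂ) : Prop where
  smooth : ContDiffOn ℝ ∞ f U
  immersion : ∀ z ∈ U, Function.Injective (fderiv ℝ f z)
  conformal : ∀ z ∈ U, firstForm f z 1 1 = firstForm f z Complex.I Complex.I ∧
    firstForm f z 1 Complex.I = 0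
  minimal : ∀ z ∈ U, meanCurvature f z = 0

/-- The Gauss map of `f`, with values in `ℂ ∪ {∞}`: the unit normal followed by the stereographic
projection from the south pole. -/
def gaussMap (f : ℂ → Nil) (z : ℂ) : OnePoint ℂ :=
  if unitNormal f z 2 = -1 then OnePoint.infty
  else ((((unitNormal f z 0 : ℂ) + Complex.I * (unitNormal f z 1 : ℂ)) /
    (1 + (unitNormal f z 2 : ℂ)) : ℂ) : OnePoint ℂ)

/-! ## Harmonic maps and the Weierstrass representation -/

/-- The Wirtinger derivative `∂f/∂z`. -/
def dz (f : ℂ → ℂ) (z : ℂ) : ℂ := (pd 1 f z - Complex.I * pd Complex.I f z) / 2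

/-- The Wirtinger derivative `∂f/∂z̄`. -/
def dzbar (f : ℂ → ℂ) (z : ℂ) : ℂ := (pd 1 f z + Complex.I * pd Complex.I f z) / 2

/-- The coordinate `w` of the Riemann sphere (with value `0` at `∞`, where it is not used). -/
def coordZero : OnePoint ℂ → ℂ := fun w => w.elim 0 id

/-- The coordinate `1/w` of the Riemann sphere (not used at the point `w = 0`). -/
def coordInfty : OnePoint ℂ → ℂ := fun w => w.elim 0 (fun x => x⁻¹)

/-- `f` is smooth near `z` and satisfies the harmonic map equation
`(1 - |f|²) f_{z z̄} + 2 f̄ f_z f_{z̄} = 0` at `z`. -/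
def HarmonicEquationAt (f : ℂ → ℂ) (z : ℂ) : Prop :=
  ContDiffAt ℝ ∞ f z ∧
    (1 - (‖f z‖ : ℂ) ^ 2) * dz (dzbar f) z + 2 * conj (f z) * dz f z * dzbar f z = 0

/-- The harmonic map equation for a map into the Riemann sphere, in each of the two standard
coordinates of the sphere (the equation is invariant under `w ↦ 1/w`). -/
def IsHarmonicGauss (g : ℂ → OnePoint ℂ) : Prop :=
  ∀ z, (g z ≠ OnePoint.infty → HarmonicEquationAt (fun w => coordZero (g w)) z) ∧
    (g z ≠ ((0 : ℂ) : OnePoint ℂ) → HarmonicEquationAt (fun w => coordInfty (g w)) z)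

/-- The horizontal projection `F = x₁ + i x₂` of `f`. -/
def horProj (f : ℂ → Nil) (z : ℂ) : ℂ := (f z 0 : ℂ) + Complex.I * (f z 1 : ℂ)

/-- The height `h = x₃` of `f`, as a complex-valued function. -/
def height (f : ℂ → Nil) (z : ℂ) : ℂ := (f z 2 : ℂ)

/-- The equations of the Weierstrass representation in `Nil₃`, expressing the derivatives of
`f = (F, h)` through its Gauss map `g`, at the points where `g ≠ ∞` and `|g| ≠ 1`. -/
def WeierstrassEquations (g : ℂ → OnePoint ℂ) (f : ℂ → Nil) : Prop :=
  ∀ z, g z ≠ OnePoint.infty → ‖coordZero (g z)‖ ≠ 1 →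
    let γ : ℂ → ℂ := fun w => coordZero (g w)
    let F : ℂ → ℂ := horProj f
    let Fbar : ℂ → ℂ := fun w => conj (F w)
    let γbar : ℂ → ℂ := fun w => conj (γ w)
    dz F z = -4 * Complex.I * dz γ z / (1 - (‖γ z‖ : ℂ) ^ 2) ^ 2 ∧
    dzbar F z = -4 * Complex.I * γ z ^ 2 * dzbar γbar z / (1 - (‖γ z‖ : ℂ) ^ 2) ^ 2 ∧
    dz (height f) z = 4 * Complex.I * conj (γ z) * dz γ z / (1 - (‖γ z‖ : ℂ) ^ 2) ^ 2
      - Complex.I / 4 * (conj (F z) * dz F z - F z * dz Fbar z)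

/-! ## The family of harmonic maps and the horizontal catenoids -/

/-- The constant `C = sin(2θ)/(2α)`. -/
def Cst (α θ : ℝ) : ℝ := Real.sin (2 * θ) / (2 * α)

/-- The polynomial `P(x) = α² + cos(2θ) x² - C² x⁴`. -/
def Pol (α θ x : ℝ) : ℝ := α ^ 2 + Real.cos (2 * θ) * x ^ 2 - Cst α θ ^ 2 * x ^ 4

/-- The upper bound `θ⁺` for the parameter `θ`. -/
def thetaPlus (α : ℝ) : ℝ :=
  if 1 < α then Real.pi / 2 else Real.arccos (1 - 2 * α ^ 2) / 2

/-- The period integral `L(α, θ)`. -/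
def periodIntegral (α θ : ℝ) : ℝ :=
  ∫ x in (-1 : ℝ)..1,
    (2 * α * Cst α θ ^ 2 * x ^ 2 - α * Real.cos (2 * θ)
        + Cst α θ ^ 2 * x ^ 2 * Real.sqrt (Pol α θ x)) /
      (Real.sqrt ((1 - x ^ 2) * Pol α θ x) * (α + Real.sqrt (Pol α θ x)))

/-- `θ` is the parameter closing the period: `θ ∈ (0, θ⁺) ∩ (0, π/4)` and `L(α, θ) = 0`. -/
def IsCatenoidAngle (α θ : ℝ) : Prop :=
  θ ∈ Set.Ioo 0 (thetaPlus α) ∩ Set.Ioo 0 (Real.pi / 4) ∧ periodIntegral α θ = 0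

/-- `φ` is the global solution of `φ'² = P(cos φ)` with `φ(0) = 0` and `φ'(0) ≤ 0`. -/
def IsPhase (α θ : ℝ) (φ : ℝ → ℝ) : Prop :=
  Differentiable ℝ φ ∧ (∀ u, deriv φ u ^ 2 = Pol α θ (Real.cos (φ u))) ∧
    φ 0 = 0 ∧ deriv φ 0 ≤ 0

/-- The function `β` with `β' = C cos² φ`, `β(0) = 0`. -/
def betaFun (α θ : ℝ) (φ : ℝ → ℝ) (u : ℝ) : ℝ :=
  ∫ t in (0 : ℝ)..u, Cst α θ * Real.cos (φ t) ^ 2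

/-- The function `G' = (C² cos² φ - cos(2θ)) / (α - φ')`. -/
def GDeriv (α θ : ℝ) (φ : ℝ → ℝ) (u : ℝ) : ℝ :=
  (Cst α θ ^ 2 * Real.cos (φ u) ^ 2 - Real.cos (2 * θ)) / (α - deriv φ u)

/-- The primitive `G` of `G'` with `G(0) = 0`. -/
def GFun (α θ : ℝ) (φ : ℝ → ℝ) (u : ℝ) : ℝ := ∫ t in (0 : ℝ)..u, GDeriv α θ φ t

/-- The function `A(u + i v) = α v + β(u)`. -/
def AFun (α θ : ℝ) (φ : ℝ → ℝ) (z : ℂ) : ℝ := α * z.im + betaFun α θ φ z.re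

/-- The map `g = (sin φ + i sinh A) / (cos φ + cosh A)` into `ℂ ∪ {∞}`; where the denominator
vanishes, the numerator vanishes too and the value is `∞`, as is seen from the other expression
`g = (cosh A - cos φ) / (sin φ - i sinh A)`. -/
def catenoidGauss (α θ : ℝ) (φ : ℝ → ℝ) (z : ℂ) : OnePoint ℂ :=
  if Real.cos (φ z.re) + Real.cosh (AFun α θ φ z) = 0 then OnePoint.infty
  else ((((Real.sin (φ z.re) : ℂ) + Complex.I * (Real.sinh (AFun α θ φ z) : ℂ)) /
    ((Real.cos (φ z.re) : ℂ) + (Real.cosh (AFun α θ φ z) : ℂ)) : ℂ) : OnePoint ℂ)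

/-- The immersion `X = (F, h) : ℂ → Nil₃` with Gauss map `catenoidGauss`. -/
def catenoidImmersion (α θ : ℝ) (φ : ℝ → ℝ) (z : ℂ) : Nil :=
  let C := Cst α θ
  let c := Real.cos (φ z.re)
  let s := Real.sin (φ z.re)
  let G' := GDeriv α θ φ z.re
  let A := AFun α θ φ z
  let y := C * z.im - GFun α θ φ z.re
  ![G' / α * c * Real.sinh A - C / α * s * Real.cosh A,
    y,
    -(1 / α) * (G' * s + C ^ 2 / α * s + y * G' / 2 * c) * Real.sinh A
      + 1 / α * (-C * c + C * G' / α * c + C * y / 2 * s) * Real.cosh A]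

/-- The horizontal catenoid, as a subset of `Nil₃`. -/
def horizontalCatenoid (α θ : ℝ) (φ : ℝ → ℝ) : Set Nil := Set.range (catenoidImmersion α θ φ)

/-! ## Intersections with the vertical planes `x₂ = c` -/

/-- The pair `(y₁, y₃) = (x₁, x₃ + x₁ x₂ / 2)`; on each plane `x₂ = c` these are Euclidean
coordinates for the metric induced by `Nil₃`. -/
def sliceCoord (p : Nil) : ℝ × ℝ := (p 0, p 2 + p 0 * p 1 / 2)

/-- The intersection of `S` with the plane `x₂ = c`, read in the coordinates `(y₁, y₃)`. -/
def slice (S : Set Nil) (c : ℝ) : Set (ℝ × ℝ) := sliceCoord '' (S ∩ {p | p 1 = c})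

/-- A closed embedded convex curve in the plane: the trace of a smooth regular simple closed
curve, which is the boundary of its convex hull. -/
def IsClosedEmbeddedConvexCurve (s : Set (ℝ × ℝ)) : Prop :=
  (∃ (γ : ℝ → ℝ × ℝ) (T : ℝ), 0 < T ∧ ContDiff ℝ ∞ γ ∧ (∀ t, deriv γ t ≠ 0) ∧
    Function.Periodic γ T ∧ Set.InjOn γ (Set.Ico 0 T) ∧ Set.range γ = s) ∧
  frontier (convexHull ℝ s) = s

/-- The interior of a surface `S` that meets each plane `x₂ = c` in a closed curve: the points
which, in their plane `x₂ = c`, lie in a bounded component of the complement of that curve. -/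
def enclosedRegion (S : Set Nil) : Set Nil :=
  {p | sliceCoord p ∉ slice S (p 1) ∧
    Bornology.IsBounded (connectedComponentIn (slice S (p 1))ᶜ (sliceCoord p))}

end NilCatenoid

end

/-!
The horizontal catenoids of `Nil₃`.

Write `Q = √P(cos φ)`, `D = φ' = -Q` and `p = G'`.

*Angle and phase.* After the substitution `x = cos t` the period integral becomes
`∫ (C² x² / Q - α / x² + α² / (x² Q))`, whose integrand is strictly increasing in `θ`; it is negative
for small `θ` and positive near the upper end of the interval, where for small `α` it diverges
logarithmically. This gives `existsUnique_isCatenoidAngle`. Since `P > 0` on `[-1, 1]`, the phase is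
the inverse of the function `τ ↦ -∫₀^τ dt / √P(cos t)` (`existsUnique_isPhase`); it is odd, smooth,
strictly decreasing and satisfies `φ(u + U) = φ(u) - π` for the half period `U`.

*Geometry of the immersion.* In the left-invariant frame the derivatives `X_u`, `X_v` are explicit
combinations of `sin φ`, `cos φ`, `sinh A`, `cosh A`: they are orthogonal of the same length, the
sum of the covariant second derivatives vanishes (`isConformalHarmonicAt`), and the unit normal is
`(sin φ, sinh A, cos φ) / cosh A` (`gaussMap_eq`). Moreover `g = tan ((φ + i A) / 2)`, so that the
harmonic map equation and the Weierstrass equations reduce to the first order relations satisfied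
by `φ`, `β` and `G`.

*Annulus.* The vanishing of the period integral is equivalent to `α G(U) + C β(U) = 0`, which says
that `X` has the period `Z = 2 (U - i β(U) / α)`; half of it induces the rotation around the
`x₂`-axis, and `z ↦ -z` the rotation around the `x₃`-axis. The map `Y w = X (Z log w / (2πi))` is
proper because a strip `|x₂| ≤ R` corresponds, modulo the period, to a compact set of parameters.

*Slices.* On the plane `x₂ = c` the parameter is `u`, and in the coordinates
`(x₁, x₃ + x₁ x₂ / 2)` the velocity of the slice is a positive multiple of `(cos φ, -sin φ)`. So its
tangent turns monotonically and exactly once per period, which makes it a simple closed convex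
curve (`IsTurningCurve.isClosedEmbeddedConvexCurve`); in particular `X` is injective modulo `Z`. The
origin lies on the inner side of all tangents (`zero_mem_inside`), so the axis is enclosed.

*No continuous symmetries.* The frame matrix of an isometry of determinant `1` is constant and fixes
`E₃` up to sign (`frameMatrix_const`), so that the fourth power of an isometry, hence every member
of a one-parameter group, covers a direct rigid motion of the `(x₁, x₂)`-plane. Translations are
excluded by the compactness of the slices, the symmetries and the unboundedness of `x₁`; rotations
by the compactness of a slice alone (`not_invariant`).
-/

namespace NilCatenoid

/-! ### The period integral as a function of the angle -/

lemma Cst_eq (α θ : ℝ) : Cst α θ = Real.sin θ * Real.cos θ / α := by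
  rw [Cst, Real.sin_two_mul]; ring

lemma Cst_pos {α θ : ℝ} (hα : 0 < α) (h0 : 0 < θ) (h1 : θ < Real.pi / 4) : 0 < Cst α θ := by
  have := Real.pi_pos
  exact div_pos (Real.sin_pos_of_pos_of_lt_pi (by linarith) (by linarith)) (by linarith)

/-- The factorization of `P` that exhibits its roots. -/
lemma Pol_factor {α : ℝ} (hα : 0 < α) (θ x : ℝ) :
    Pol α θ x = (α ^ 2 - Real.sin θ ^ 2 * x ^ 2) * (α ^ 2 + Real.cos θ ^ 2 * x ^ 2) / α ^ 2 := by
  rw [Pol, Cst_eq, Real.cos_two_mul']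
  field_simp
  ring

lemma Pol_ge {α θ x : ℝ} (hα : 0 < α) (hs : Real.sin θ ^ 2 ≤ α ^ 2) (hx : x ^ 2 ≤ 1) :
    α ^ 2 - Real.sin θ ^ 2 ≤ Pol α θ x := by
  rw [Pol_factor hα, le_div_iff₀ (by positivity)]
  have h1 : α ^ 2 - Real.sin θ ^ 2 ≤ α ^ 2 - Real.sin θ ^ 2 * x ^ 2 := by
    nlinarith [sq_nonneg (Real.sin θ)]
  have h2 : α ^ 2 ≤ α ^ 2 + Real.cos θ ^ 2 * x ^ 2 := by nlinarith [sq_nonneg (Real.cos θ * x)]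
  exact mul_le_mul h1 h2 (by positivity) (by linarith)

lemma Pol_pos {α θ x : ℝ} (hα : 0 < α) (hs : Real.sin θ ^ 2 < α ^ 2) (hx : x ^ 2 ≤ 1) :
    0 < Pol α θ x := by
  linarith [Pol_ge hα hs.le hx]

/-- The integrand of the period integral after the substitution `x = cos t`. -/
noncomputable def periodDensity (α θ x : ℝ) : ℝ :=
  (2 * α * Cst α θ ^ 2 * x ^ 2 - α * Real.cos (2 * θ)
        + Cst α θ ^ 2 * x ^ 2 * Real.sqrt (Pol α θ x)) /
      (Real.sqrt (Pol α θ x) * (α + Real.sqrt (Pol α θ x)))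

lemma periodIntegral_eq (α θ : ℝ) :
    periodIntegral α θ = ∫ t in (0 : ℝ)..Real.pi, periodDensity α θ (Real.cos t) := by
  rw [← Polynomial.Chebyshev.integral_measureT_eq_integral_cos (f := periodDensity α θ),
    Polynomial.Chebyshev.integral_measureT, periodIntegral]
  refine intervalIntegral.integral_congr fun x hx => ?_
  rw [Set.uIcc_of_le (by norm_num)] at hx
  have h1 : 0 ≤ 1 - x ^ 2 := by nlinarith [hx.1, hx.2]
  simp only [periodDensity]
  rw [Real.sqrt_mul h1, Real.sqrt_inv]
  simp only [div_eq_mul_inv, mul_inv]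
  ring

/-- A form of the density in which each summand is visibly increasing in the angle. -/
lemma periodDensity_eq {α θ x : ℝ} (hα : 0 < α) (hP : 0 < Pol α θ x) (hx : x ≠ 0) :
    periodDensity α θ x = Cst α θ ^ 2 * x ^ 2 / Real.sqrt (Pol α θ x)
      + (α ^ 2 / Real.sqrt (Pol α θ x) - α) / x ^ 2 := by
  have hQ := Real.sqrt_pos.2 hP
  have hQ2 := Real.sq_sqrt hP.le
  rw [periodDensity]
  set Q := Real.sqrt (Pol α θ x)
  rw [Pol] at hQ2
  field_simp
  linear_combination (α) * hQ2

lemma periodDensity_zero {α : ℝ} (hα : 0 < α) (θ : ℝ) :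
    periodDensity α θ 0 = - Real.cos (2 * θ) / (2 * α) := by
  have : Real.sqrt (Pol α θ 0) = α := by
    rw [Pol]; simp [Real.sqrt_sq hα.le]
  rw [periodDensity, this]
  field_simp
  ring

lemma sin_sq_lt_sin_sq {a b : ℝ} (h0 : 0 ≤ a) (hab : a < b) (hb : b ≤ Real.pi / 4) :
    Real.sin a ^ 2 < Real.sin b ^ 2 := by
  have := Real.pi_pos
  have h1 : Real.sin a < Real.sin b :=
    Real.sin_lt_sin_of_lt_of_le_pi_div_two (by linarith) (by linarith) hab
  have h2 : 0 ≤ Real.sin a := Real.sin_nonneg_of_nonneg_of_le_pi h0 (by linarith)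
  nlinarith

lemma cos_two_mul_eq_sin_sq (θ : ℝ) : Real.cos (2 * θ) = 1 - 2 * Real.sin θ ^ 2 := by
  rw [Real.cos_two_mul']; linarith [Real.sin_sq_add_cos_sq θ]

lemma sin_sq_le_half {θ : ℝ} (h0 : 0 ≤ θ) (h1 : θ ≤ Real.pi / 4) : Real.sin θ ^ 2 ≤ 1 / 2 := by
  have := Real.pi_pos
  have : 0 ≤ Real.cos (2 * θ) :=
    Real.cos_nonneg_of_neg_pi_div_two_le_of_le (by linarith) (by linarith)
  rw [cos_two_mul_eq_sin_sq] at this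
  linarith

lemma Cst_sq_eq {α : ℝ} (θ : ℝ) :
    Cst α θ ^ 2 = Real.sin θ ^ 2 * (1 - Real.sin θ ^ 2) / α ^ 2 := by
  rw [Cst_eq, ← Real.cos_sq']; ring

/-- The density is strictly increasing in the angle. -/
lemma periodDensity_lt {α a b x : ℝ} (hα : 0 < α) (h0 : 0 ≤ a) (hab : a < b)
    (hb : b ≤ Real.pi / 4) (hs : Real.sin b ^ 2 < α ^ 2) (hx : x ^ 2 ≤ 1) :
    periodDensity α a x < periodDensity α b x := by
  have hsin := sin_sq_lt_sin_sq h0 hab hb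
  have hb2 := sin_sq_le_half (h0.trans hab.le) hb
  rcases eq_or_ne x 0 with rfl | hx0
  · rw [periodDensity_zero hα, periodDensity_zero hα]
    apply div_lt_div_of_pos_right _ (by linarith)
    rw [cos_two_mul_eq_sin_sq, cos_two_mul_eq_sin_sq]
    linarith
  have hPa : 0 < Pol α a x := Pol_pos hα (hsin.trans hs) hx
  have hPb : 0 < Pol α b x := Pol_pos hα hs hx
  have hy : 0 < x ^ 2 := by positivity
  have hC : Cst α a ^ 2 ≤ Cst α b ^ 2 := by
    rw [Cst_sq_eq, Cst_sq_eq]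
    apply div_le_div_of_nonneg_right _ (by positivity)
    nlinarith
  have hP : Pol α b x < Pol α a x := by
    rw [Pol, Pol, cos_two_mul_eq_sin_sq, cos_two_mul_eq_sin_sq]
    have := mul_le_mul_of_nonneg_right hC (show 0 ≤ x ^ 4 by positivity)
    nlinarith
  have hQ := Real.sqrt_lt_sqrt hPb.le hP
  have hQb := Real.sqrt_pos.2 hPb
  rw [periodDensity_eq hα hPa hx0, periodDensity_eq hα hPb hx0]
  have h1 : Cst α a ^ 2 * x ^ 2 / Real.sqrt (Pol α a x)
      ≤ Cst α b ^ 2 * x ^ 2 / Real.sqrt (Pol α b x) :=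
    div_le_div₀ (by positivity) (mul_le_mul_of_nonneg_right hC hy.le) hQb hQ.le
  have h2 : α ^ 2 / Real.sqrt (Pol α a x) < α ^ 2 / Real.sqrt (Pol α b x) :=
    div_lt_div_of_pos_left (by positivity) hQb hQ
  have h3 := div_lt_div_of_pos_right (sub_lt_sub_right h2 α) hy
  linarith

lemma continuous_Pol (α : ℝ) : Continuous fun p : ℝ × ℝ => Pol α p.1 p.2 := by
  unfold Pol Cst; fun_prop

lemma continuous_periodDensity_cos {α θ : ℝ} (hα : 0 < α) (hs : Real.sin θ ^ 2 < α ^ 2) :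
    Continuous fun t => periodDensity α θ (Real.cos t) := by
  have hP : Continuous fun t => Real.sqrt (Pol α θ (Real.cos t)) := by
    unfold Pol; fun_prop
  unfold periodDensity
  refine Continuous.div (by fun_prop) (by fun_prop) fun t => ?_
  have := Real.sqrt_pos.2 (Pol_pos hα hs (Real.cos_sq_le_one t))
  positivity

/-- The period integral is continuous in the angle as long as `P` stays positive: `P` is bounded
below there by some `δ > 0`, so that it may be replaced by `max P δ`. -/
lemma continuousOn_periodIntegral {α b : ℝ} (hα : 0 < α) (hb : b ≤ Real.pi / 4)
    (hs : Real.sin b ^ 2 < α ^ 2) : ContinuousOn (periodIntegral α) (Set.Icc 0 b) := by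
  set δ := α ^ 2 - Real.sin b ^ 2 with hδ
  have hδ0 : 0 < δ := by linarith
  let q : ℝ → ℝ → ℝ := fun θ t => Real.sqrt (max (Pol α θ (Real.cos t)) δ)
  let f : ℝ → ℝ → ℝ := fun θ t => (2 * α * Cst α θ ^ 2 * Real.cos t ^ 2 - α * Real.cos (2 * θ)
        + Cst α θ ^ 2 * Real.cos t ^ 2 * q θ t) / (q θ t * (α + q θ t))
  have hq : Continuous fun p : ℝ × ℝ => q p.1 p.2 := by
    have := (continuous_Pol α).comp (continuous_fst.prodMk (Real.continuous_cos.comp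
      (continuous_snd (X := ℝ) (Y := ℝ))))
    exact (this.max continuous_const).sqrt
  have hf : Continuous f.uncurry := by
    refine Continuous.div ?_ ?_ fun p => ?_
    · have : Continuous fun p : ℝ × ℝ => Cst α p.1 := by unfold Cst; fun_prop
      fun_prop
    · fun_prop
    · have : 0 < q p.1 p.2 := Real.sqrt_pos.2 (lt_max_of_lt_right hδ0)
      positivity
  have hc := intervalIntegral.continuous_parametric_intervalIntegral_of_continuous'
    (μ := MeasureTheory.volume) hf 0 Real.pi
  refine hc.continuousOn.congr fun θ hθ => ?_
  rw [periodIntegral_eq]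
  refine intervalIntegral.integral_congr fun t _ => ?_
  have h1 : Real.sin θ ^ 2 ≤ Real.sin b ^ 2 := by
    rcases hθ.2.eq_or_lt with h | h
    · rw [h]
    · exact (sin_sq_lt_sin_sq hθ.1 h hb).le
  have h2 : max (Pol α θ (Real.cos t)) δ = Pol α θ (Real.cos t) :=
    max_eq_left (by linarith [Pol_ge hα (h1.trans hs.le) (Real.cos_sq_le_one t)])
  simp only [f, q, h2, periodDensity]

lemma periodIntegral_lt {α a b : ℝ} (hα : 0 < α) (h0 : 0 ≤ a) (hab : a < b)
    (hb : b ≤ Real.pi / 4) (hs : Real.sin b ^ 2 < α ^ 2) :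
    periodIntegral α a < periodIntegral α b := by
  rw [periodIntegral_eq, periodIntegral_eq]
  have h (t : ℝ) := periodDensity_lt hα h0 hab hb hs (Real.cos_sq_le_one t)
  exact intervalIntegral.integral_lt_integral_of_continuousOn_of_le_of_exists_lt Real.pi_pos
    (continuous_periodDensity_cos hα ((sin_sq_lt_sin_sq h0 hab hb).trans hs)).continuousOn
    (continuous_periodDensity_cos hα hs).continuousOn (fun t _ => (h t).le)
    ⟨0, ⟨le_rfl, Real.pi_pos.le⟩, h 0⟩

lemma periodIntegral_zero_neg {α : ℝ} (hα : 0 < α) : periodIntegral α 0 < 0 := by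
  have hs : Real.sin 0 ^ 2 < α ^ 2 := by simp; positivity
  rw [periodIntegral_eq, ← neg_pos, ← intervalIntegral.integral_neg]
  refine intervalIntegral.intervalIntegral_pos_of_pos
    ((continuous_periodDensity_cos hα hs).neg.intervalIntegrable _ _) (fun t => ?_) Real.pi_pos
  have hQ := Real.sqrt_pos.2 (Pol_pos hα hs (Real.cos_sq_le_one t))
  rw [periodDensity, ← neg_div]
  apply div_pos _ (by positivity)
  simp [Cst, hα]

lemma periodIntegral_pi_div_four_pos {α : ℝ} (hα : 0 < α) (h : 1 / 2 < α ^ 2) :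
    0 < periodIntegral α (Real.pi / 4) := by
  have hpi := Real.pi_pos
  have hs : Real.sin (Real.pi / 4) ^ 2 < α ^ 2 :=
    (sin_sq_le_half (by positivity) le_rfl).trans_lt h
  have h0 : Real.cos (2 * (Real.pi / 4)) = 0 := by
    rw [show 2 * (Real.pi / 4) = Real.pi / 2 by ring, Real.cos_pi_div_two]
  have hC : Cst α (Real.pi / 4) ≠ 0 := by
    rw [Cst, show 2 * (Real.pi / 4) = Real.pi / 2 by ring, Real.sin_pi_div_two]
    positivity
  have hQ (t : ℝ) := Real.sqrt_pos.2 (Pol_pos hα hs (Real.cos_sq_le_one t))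
  rw [periodIntegral_eq]
  refine intervalIntegral.integral_pos hpi (continuous_periodDensity_cos hα hs).continuousOn
    (fun t _ => ?_) ⟨0, ⟨le_rfl, hpi.le⟩, ?_⟩
  · have := hQ t
    rw [periodDensity, h0]
    apply div_nonneg _ (by positivity)
    rw [mul_zero, sub_zero]
    positivity
  · have := hQ 0
    rw [periodDensity, h0]
    apply div_pos _ (by positivity)
    rw [mul_zero, sub_zero, Real.cos_zero]
    positivity

lemma periodDensity_ge {α θ x : ℝ} (hα : 0 < α) (hP : 0 < Pol α θ x) :
    Cst α θ ^ 2 * x ^ 2 / Real.sqrt (Pol α θ x) - 1 / (2 * α) ≤ periodDensity α θ x := by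
  have hQ := Real.sqrt_pos.2 hP
  have hQ2 := Real.sq_sqrt hP.le
  rw [periodDensity]
  set Q := Real.sqrt (Pol α θ x)
  rw [Pol] at hQ2
  have e : (2 * α * Cst α θ ^ 2 * x ^ 2 - α * Real.cos (2 * θ) + Cst α θ ^ 2 * x ^ 2 * Q) /
      (Q * (α + Q)) = Cst α θ ^ 2 * x ^ 2 / Q
        + α * (Cst α θ ^ 2 * x ^ 2 - Real.cos (2 * θ)) / (Q * (α + Q)) := by
    field_simp; ring
  have : -(1 / (2 * α)) ≤ α * (Cst α θ ^ 2 * x ^ 2 - Real.cos (2 * θ)) / (Q * (α + Q)) := by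
    rw [← neg_div, div_le_div_iff₀ (by positivity) (by positivity)]
    have hk := Real.cos_le_one (2 * θ)
    rcases le_total 0 (Cst α θ ^ 2 * x ^ 2 - Real.cos (2 * θ)) with h | h
    · have : 0 ≤ α * (Cst α θ ^ 2 * x ^ 2 - Real.cos (2 * θ)) * (2 * α) := by positivity
      nlinarith [mul_pos hQ (add_pos hα hQ)]
    · -- here `Q ≥ α`, and `k - C² x² ≤ 1`
      have hQα : α ≤ Q := by
        apply le_of_sq_le_sq _ hQ.le
        nlinarith [mul_nonneg (sq_nonneg x) (sub_nonneg.2 (sub_nonpos.1 h))]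
      have h2 : 0 ≤ 1 - Real.cos (2 * θ) + Cst α θ ^ 2 * x ^ 2 := by
        have : 0 ≤ Cst α θ ^ 2 * x ^ 2 := by positivity
        linarith
      nlinarith [mul_nonneg (sq_nonneg α) h2, mul_nonneg (sub_nonneg.2 hQα) hα.le,
        mul_nonneg (sub_nonneg.2 hQα) hQ.le]
  rw [e]; linarith

/-- When `α² ≤ 1/2`, the period integral diverges logarithmically as `sin θ → α`, because a root
of `P` approaches the endpoint of the interval of integration. -/
lemma exists_periodIntegral_pos_of_le {α : ℝ} (hα : 0 < α) (h : α ^ 2 ≤ 1 / 2) :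
    ∃ b, 0 < b ∧ b ≤ Real.pi / 4 ∧ Real.sin b ^ 2 < α ^ 2 ∧ 0 < periodIntegral α b := by
  have hpi := Real.pi_pos
  -- the angle `b` with `sin² b = α² - ε²`; the density is at least `(α/32) / (ε + t) - 1/(2α)` on
  -- `[0, 1]` and at least `-1/(2α)` elsewhere, so that `ε` is chosen to make the logarithm win
  obtain ⟨ε, hε0, hε1, hε2⟩ : ∃ ε, 0 < ε ∧ ε ≤ α / 2 ∧
      (32 / α) * (Real.pi / (2 * α)) < Real.log ((ε + 1) / ε) := by
    refine ⟨min (α / 2) (Real.exp (-((32 / α) * (Real.pi / (2 * α))))), by positivity,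
      min_le_left _ _, ?_⟩
    set ε := min (α / 2) (Real.exp (-((32 / α) * (Real.pi / (2 * α))))) with hε
    have hε0 : 0 < ε := by positivity
    rw [Real.lt_log_iff_exp_lt (by positivity), lt_div_iff₀ hε0]
    have : Real.exp ((32 / α) * (Real.pi / (2 * α))) * ε ≤ 1 := by
      calc _ ≤ Real.exp ((32 / α) * (Real.pi / (2 * α)))
            * Real.exp (-((32 / α) * (Real.pi / (2 * α)))) := by
            gcongr; exact min_le_right _ _
        _ = 1 := by rw [← Real.exp_add, add_neg_cancel, Real.exp_zero]
    linarith
  have hεα : ε ^ 2 ≤ α ^ 2 / 4 := by nlinarith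
  set s := Real.sqrt (α ^ 2 - ε ^ 2) with hs
  have hs2 : s ^ 2 = α ^ 2 - ε ^ 2 := Real.sq_sqrt (by nlinarith)
  have hs0 : 0 < s := Real.sqrt_pos.2 (by nlinarith)
  have hs1 : s ≤ Real.sqrt 2 / 2 := by
    apply le_of_sq_le_sq _ (by positivity)
    rw [hs2, div_pow, Real.sq_sqrt (by norm_num)]
    nlinarith
  have hsb : Real.sin (Real.arcsin s) = s := by
    apply Real.sin_arcsin (by linarith)
    nlinarith
  have hb : Real.arcsin s ≤ Real.pi / 4 := by
    rw [Real.arcsin_le_iff_le_sin' ⟨by linarith, by linarith⟩, Real.sin_pi_div_four]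
    exact hs1
  have hsin : Real.sin (Real.arcsin s) ^ 2 < α ^ 2 := by rw [hsb, hs2]; nlinarith
  refine ⟨Real.arcsin s, Real.arcsin_pos.2 hs0, hb, hsin, ?_⟩
  set b := Real.arcsin s
  have hC : 1 / 4 ≤ Cst α b ^ 2 := by
    rw [Cst_sq_eq, hsb, le_div_iff₀ (by positivity)]
    nlinarith [sq_nonneg ε, sq_nonneg α]
  have hcont := continuous_periodDensity_cos hα hsin
  have hint (u v : ℝ) := hcont.intervalIntegrable (μ := MeasureTheory.volume) u v
  have hlow (t : ℝ) : - (1 / (2 * α)) ≤ periodDensity α b (Real.cos t) := by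
    have hP := Pol_pos hα hsin (Real.cos_sq_le_one t)
    have := periodDensity_ge hα hP
    have h0 : 0 ≤ Cst α b ^ 2 * Real.cos t ^ 2 / Real.sqrt (Pol α b (Real.cos t)) := by positivity
    linarith
  have hlow1 (t : ℝ) (ht : t ∈ Set.Icc (0 : ℝ) 1) :
      (α / 32) * (1 / (ε + t)) - 1 / (2 * α) ≤ periodDensity α b (Real.cos t) := by
    have hP := Pol_pos hα hsin (Real.cos_sq_le_one t)
    have hQ := Real.sqrt_pos.2 hP
    have hge := periodDensity_ge hα hP
    have hεt : 0 < ε + t := by linarith [ht.1]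
    have hcos : 1 / 2 ≤ Real.cos t := by
      have h3 := Real.pi_gt_three
      rw [← Real.cos_pi_div_three]
      exact Real.cos_le_cos_of_nonneg_of_le_pi ht.1 (by linarith) (by linarith [ht.2])
    have hQle : Real.sqrt (Pol α b (Real.cos t)) ≤ 2 / α * (ε + t) := by
      apply Real.sqrt_le_iff.2 ⟨by positivity, ?_⟩
      rw [Pol_factor hα, hsb, hs2, mul_pow, div_pow, div_mul_eq_mul_div]
      apply div_le_div_of_nonneg_right _ (by positivity)
      have hst : Real.sin t ^ 2 ≤ t ^ 2 := by
        apply pow_le_pow_left₀ (Real.sin_nonneg_of_nonneg_of_le_pi ht.1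
          (by linarith [ht.2, Real.pi_gt_three])) (Real.sin_le ht.1)
      have e1 : α ^ 2 - (α ^ 2 - ε ^ 2) * Real.cos t ^ 2 ≤ (ε + t) ^ 2 := by
        have := Real.sin_sq_add_cos_sq t
        have hc : Real.cos t ^ 2 = 1 - Real.sin t ^ 2 := by linarith
        rw [hc]
        nlinarith [ht.1, sq_nonneg ε, sq_nonneg (Real.sin t), mul_nonneg hε0.le ht.1,
          mul_nonneg (sub_nonneg.2 h) (sq_nonneg (Real.sin t)),
          mul_nonneg (sq_nonneg ε) (sq_nonneg (Real.sin t))]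
      have e2 : α ^ 2 + Real.cos b ^ 2 * Real.cos t ^ 2 ≤ 2 ^ 2 := by
        have := Real.cos_sq_le_one b
        have := Real.cos_sq_le_one t
        nlinarith [sq_nonneg (Real.cos b), sq_nonneg (Real.cos t)]
      have e0 : 0 ≤ α ^ 2 + Real.cos b ^ 2 * Real.cos t ^ 2 := by positivity
      calc _ ≤ (ε + t) ^ 2 * 2 ^ 2 := mul_le_mul e1 e2 e0 (by positivity)
        _ = _ := by ring
    have : (α / 32) * (1 / (ε + t))
        ≤ Cst α b ^ 2 * Real.cos t ^ 2 / Real.sqrt (Pol α b (Real.cos t)) := by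
      calc (α / 32) * (1 / (ε + t)) = (1 / 4 * (1 / 2) ^ 2) / (2 / α * (ε + t)) := by
            field_simp; norm_num
        _ ≤ _ := by
            apply div_le_div₀ (by positivity) _ hQ hQle
            apply mul_le_mul hC (pow_le_pow_left₀ (by norm_num) hcos 2) (by positivity)
              (by positivity)
    linarith
  have hlog : ∫ t in (0 : ℝ)..1, ((α / 32) * (1 / (ε + t)) - 1 / (2 * α))
      = (α / 32) * Real.log ((ε + 1) / ε) - 1 / (2 * α) := by
    have hc : ContinuousOn (fun t => (α / 32) * (1 / (ε + t))) (Set.uIcc 0 1) := by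
      refine ContinuousOn.mul continuousOn_const (ContinuousOn.div continuousOn_const
        (by fun_prop) fun t ht => ?_)
      rw [Set.uIcc_of_le zero_le_one] at ht
      linarith [ht.1]
    rw [intervalIntegral.integral_sub hc.intervalIntegrable (by simp),
      intervalIntegral.integral_const_mul,
      intervalIntegral.integral_comp_add_left (fun t => 1 / t) ε, integral_one_div_of_pos
        (by linarith) (by linarith)]
    simp
  have i1 : ∫ t in (0 : ℝ)..1, ((α / 32) * (1 / (ε + t)) - 1 / (2 * α))
      ≤ ∫ t in (0 : ℝ)..1, periodDensity α b (Real.cos t) := by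
    refine intervalIntegral.integral_mono_on zero_le_one ?_ (hint _ _) hlow1
    refine ContinuousOn.intervalIntegrable (ContinuousOn.sub (ContinuousOn.mul continuousOn_const
      (ContinuousOn.div continuousOn_const (by fun_prop) fun t ht => ?_)) continuousOn_const)
    rw [Set.uIcc_of_le zero_le_one] at ht
    linarith [ht.1]
  have i2 : ∫ t in (1 : ℝ)..Real.pi, (- (1 / (2 * α)))
      ≤ ∫ t in (1 : ℝ)..Real.pi, periodDensity α b (Real.cos t) :=
    intervalIntegral.integral_mono_on (by linarith [Real.pi_gt_three]) (by simp) (hint _ _)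
      fun t _ => hlow t
  rw [periodIntegral_eq, ← intervalIntegral.integral_add_adjacent_intervals (hint 0 1) (hint 1 _)]
  rw [hlog] at i1
  rw [intervalIntegral.integral_const, smul_eq_mul] at i2
  have h3 : Real.pi / (2 * α) < (α / 32) * Real.log ((ε + 1) / ε) := by
    have := mul_lt_mul_of_pos_left hε2 (show 0 < α / 32 by positivity)
    calc Real.pi / (2 * α) = (α / 32) * ((32 / α) * (Real.pi / (2 * α))) := by field_simp
      _ < _ := this
  have h4 : (Real.pi - 1) * -(1 / (2 * α)) = -(Real.pi / (2 * α)) + 1 / (2 * α) := by ring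
  linarith

lemma mem_angle_interval_iff {α θ : ℝ} (hα : 0 < α) :
    θ ∈ Set.Ioo 0 (thetaPlus α) ∩ Set.Ioo 0 (Real.pi / 4) ↔
      0 < θ ∧ θ < Real.pi / 4 ∧ Real.sin θ ^ 2 < α ^ 2 := by
  have hpi := Real.pi_pos
  suffices h : 0 < θ → θ < Real.pi / 4 → (θ < thetaPlus α ↔ Real.sin θ ^ 2 < α ^ 2) by
    simp only [Set.mem_inter_iff, Set.mem_Ioo]
    constructor
    · rintro ⟨⟨h0, h1⟩, -, h2⟩
      exact ⟨h0, h2, (h h0 h2).1 h1⟩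
    · rintro ⟨h0, h2, h1⟩
      exact ⟨⟨h0, (h h0 h2).2 h1⟩, h0, h2⟩
  intro h0 h1
  have h2 := sin_sq_le_half h0.le h1.le
  rw [thetaPlus]
  split_ifs with h
  · exact ⟨fun _ => by nlinarith, fun _ => by linarith⟩
  · have h3 : α ^ 2 ≤ 1 := by nlinarith
    rw [lt_div_iff₀ two_pos, ← Real.arccos_cos (x := θ * 2) (by linarith) (by linarith),
      Real.strictAntiOn_arccos.lt_iff_gt ⟨Real.neg_one_le_cos _, Real.cos_le_one _⟩
        ⟨by nlinarith, by nlinarith⟩, mul_comm θ 2, cos_two_mul_eq_sin_sq]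
    constructor <;> intro <;> linarith

theorem existsUnique_isCatenoidAngle {α : ℝ} (hα : 0 < α) : ∃! θ, IsCatenoidAngle α θ := by
  have hpi := Real.pi_pos
  obtain ⟨b, hb0, hb, hs, hpos⟩ : ∃ b, 0 < b ∧ b ≤ Real.pi / 4 ∧ Real.sin b ^ 2 < α ^ 2 ∧
      0 < periodIntegral α b := by
    rcases le_or_gt (α ^ 2) (1 / 2) with h | h
    · exact exists_periodIntegral_pos_of_le hα h
    · exact ⟨Real.pi / 4, by positivity, le_rfl,
        (sin_sq_le_half (by positivity) le_rfl).trans_lt h, periodIntegral_pi_div_four_pos hα h⟩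
  obtain ⟨θ, hθ, hL⟩ := intermediate_value_Icc hb0.le (continuousOn_periodIntegral hα hb hs)
    ⟨(periodIntegral_zero_neg hα).le, hpos.le⟩
  have hθ0 : 0 < θ := by
    refine lt_of_le_of_ne hθ.1 fun h => ?_
    rw [← h] at hL
    linarith [periodIntegral_zero_neg hα]
  have hθb : θ < b := by
    refine lt_of_le_of_ne hθ.2 fun h => ?_
    rw [h] at hL
    linarith
  refine ⟨θ, ⟨(mem_angle_interval_iff hα).2 ⟨hθ0, hθb.trans_le hb,
    (sin_sq_lt_sin_sq hθ0.le hθb hb).trans hs⟩, hL⟩, fun θ' ⟨hθ', hL'⟩ => ?_⟩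
  obtain ⟨h0, h1, h2⟩ := (mem_angle_interval_iff hα).1 hθ'
  rcases lt_trichotomy θ' θ with h | h | h
  · have := periodIntegral_lt hα h0.le h (hθb.le.trans hb)
      ((sin_sq_lt_sin_sq hθ0.le hθb hb).trans hs)
    linarith
  · exact h
  · have := periodIntegral_lt hα hθ0.le h h1.le h2
    linarith

/-! ### The phase -/

/-- The time `∫₀^τ ds / √P(cos s)` that the flow of `φ' = √P(cos φ)` needs to reach the angle `τ`
from `0`. The phase is the inverse function, run backwards. -/
noncomputable def phaseTime (α θ τ : ℝ) : ℝ :=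
  ∫ s in (0 : ℝ)..τ, (Real.sqrt (Pol α θ (Real.cos s)))⁻¹

section PhaseTime

variable {α θ : ℝ}

lemma sqrt_Pol_cos_pos (hα : 0 < α) (hs : Real.sin θ ^ 2 < α ^ 2) (τ : ℝ) :
    0 < Real.sqrt (Pol α θ (Real.cos τ)) :=
  Real.sqrt_pos.2 (Pol_pos hα hs (Real.cos_sq_le_one τ))

lemma continuous_phaseDensity (hα : 0 < α) (hs : Real.sin θ ^ 2 < α ^ 2) :
    Continuous fun s => (Real.sqrt (Pol α θ (Real.cos s)))⁻¹ := by
  refine Continuous.inv₀ ?_ fun t => (sqrt_Pol_cos_pos hα hs t).ne'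
  unfold Pol; fun_prop

lemma hasDerivAt_phaseTime (hα : 0 < α) (hs : Real.sin θ ^ 2 < α ^ 2) (τ : ℝ) :
    HasDerivAt (phaseTime α θ) (Real.sqrt (Pol α θ (Real.cos τ)))⁻¹ τ :=
  (continuous_phaseDensity hα hs).integral_hasStrictDerivAt 0 τ |>.hasDerivAt

lemma phaseTime_zero : phaseTime α θ 0 = 0 := by simp [phaseTime]

lemma strictMono_phaseTime (hα : 0 < α) (hs : Real.sin θ ^ 2 < α ^ 2) :
    StrictMono (phaseTime α θ) :=
  strictMono_of_hasDerivAt_pos (hasDerivAt_phaseTime hα hs)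
    fun τ => inv_pos.2 (sqrt_Pol_cos_pos hα hs τ)

lemma phaseTime_neg (τ : ℝ) : phaseTime α θ (-τ) = -phaseTime α θ τ := by
  have := intervalIntegral.integral_comp_neg (a := 0) (b := τ)
    (fun s => (Real.sqrt (Pol α θ (Real.cos s)))⁻¹)
  simp only [Real.cos_neg, neg_zero] at this
  rw [phaseTime, phaseTime, this, intervalIntegral.integral_symm]

lemma phaseTime_add_pi (hα : 0 < α) (hs : Real.sin θ ^ 2 < α ^ 2) (τ : ℝ) :
    phaseTime α θ (τ + Real.pi) = phaseTime α θ τ + phaseTime α θ Real.pi := by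
  have hint (u v : ℝ) := (continuous_phaseDensity hα hs).intervalIntegrable
    (μ := MeasureTheory.volume) u v
  have := intervalIntegral.integral_comp_add_right (a := 0) (b := τ)
    (fun s => (Real.sqrt (Pol α θ (Real.cos s)))⁻¹) Real.pi
  have e (x : ℝ) : Pol α θ (Real.cos (x + Real.pi)) = Pol α θ (Real.cos x) := by
    rw [Real.cos_add_pi, Pol, Pol]; ring
  simp only [e, zero_add] at this
  rw [phaseTime, phaseTime, phaseTime, this, add_comm (∫ _ in Real.pi.._, _),
    intervalIntegral.integral_add_adjacent_intervals (hint _ _) (hint _ _)]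

lemma surjective_phaseTime (hα : 0 < α) (hs : Real.sin θ ^ 2 < α ^ 2) :
    Function.Surjective (phaseTime α θ) := by
  have hlin : ∀ τ, 0 ≤ τ → (α + 1)⁻¹ * τ ≤ phaseTime α θ τ := by
    intro τ hτ
    have hm (s : ℝ) : (α + 1)⁻¹ ≤ (Real.sqrt (Pol α θ (Real.cos s)))⁻¹ := by
      apply inv_anti₀ (sqrt_Pol_cos_pos hα hs s)
      apply Real.sqrt_le_iff.2 ⟨by positivity, ?_⟩
      have h1 := Real.cos_sq_le_one s
      have h2 := Real.cos_le_one (2 * θ)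
      have h3 : 0 ≤ Cst α θ ^ 2 * Real.cos s ^ 4 := by positivity
      rw [Pol]
      nlinarith [mul_nonneg (sub_nonneg.2 h2) (sq_nonneg (Real.cos s))]
    have := intervalIntegral.integral_mono_on (μ := MeasureTheory.volume) hτ
      (f := fun _ => (α + 1)⁻¹) (by simp)
      ((continuous_phaseDensity hα hs).intervalIntegrable _ _) fun s _ => hm s
    rw [intervalIntegral.integral_const] at this
    simpa [phaseTime, mul_comm] using this
  have hcont : Continuous (phaseTime α θ) :=
    continuous_iff_continuousAt.2 fun τ => (hasDerivAt_phaseTime hα hs τ).continuousAt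
  have htop : Filter.Tendsto (phaseTime α θ) Filter.atTop Filter.atTop := by
    refine Filter.tendsto_atTop_mono' _ ?_
      (Filter.tendsto_id.const_mul_atTop (show 0 < (α + 1)⁻¹ by positivity))
    filter_upwards [Filter.eventually_ge_atTop 0] with τ hτ using hlin τ hτ
  refine hcont.surjective htop ?_
  have := Filter.tendsto_neg_atTop_atBot.comp (htop.comp Filter.tendsto_neg_atBot_atTop)
  refine this.congr fun τ => ?_
  simp [phaseTime_neg]

/-- The derivative of a phase is nowhere zero, so it has a constant sign (Darboux). -/
lemma IsPhase.deriv_eq {φ : ℝ → ℝ} (h : IsPhase α θ φ) (hα : 0 < α)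
    (hs : Real.sin θ ^ 2 < α ^ 2) (u : ℝ) :
    deriv φ u = -Real.sqrt (Pol α θ (Real.cos (φ u))) := by
  have hne (u : ℝ) : deriv φ u ≠ 0 := by
    intro h0
    have h1 := h.2.1 u
    rw [h0] at h1
    have := Pol_pos hα hs (Real.cos_sq_le_one (φ u))
    simp at h1
    linarith
  have hneg : deriv φ u < 0 := by
    rcases hasDerivWithinAt_forall_lt_or_forall_gt_of_forall_ne (s := Set.univ) (f := φ)
      (f' := deriv φ) (m := 0) convex_univ
      (fun x _ => (h.1 x).hasDerivAt.hasDerivWithinAt) (fun x _ => hne x) with h1 | h1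
    · exact h1 u trivial
    · exact absurd (h1 0 trivial) (not_lt.2 h.2.2.2)
  rw [← h.2.1 u, Real.sqrt_sq_eq_abs, abs_of_neg hneg, neg_neg]

lemma IsPhase.phaseTime_apply {φ : ℝ → ℝ} (h : IsPhase α θ φ) (hα : 0 < α)
    (hs : Real.sin θ ^ 2 < α ^ 2) (u : ℝ) : phaseTime α θ (φ u) = -u := by
  have hd (x : ℝ) : HasDerivAt (fun x => phaseTime α θ (φ x) + x) 0 x := by
    have h1 := ((hasDerivAt_phaseTime hα hs (φ x)).comp x (h.1 x).hasDerivAt).add (hasDerivAt_id x)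
    refine h1.congr_deriv ?_
    rw [h.deriv_eq hα hs x]
    have := (sqrt_Pol_cos_pos hα hs (φ x)).ne'
    field_simp
    ring
  have := is_const_of_deriv_eq_zero (fun x => (hd x).differentiableAt) (fun x => (hd x).deriv) u 0
  rw [h.2.2.1, phaseTime_zero] at this
  linarith

theorem existsUnique_isPhase (hα : 0 < α) (hs : Real.sin θ ^ 2 < α ^ 2) :
    ∃! φ, IsPhase α θ φ := by
  let e : ℝ ≃o ℝ := (strictMono_phaseTime hα hs).orderIsoOfSurjective _ (surjective_phaseTime hα hs)
  have he (τ : ℝ) : e τ = phaseTime α θ τ := rfl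
  have hd (u : ℝ) : HasDerivAt e.symm (Real.sqrt (Pol α θ (Real.cos (e.symm u)))) u := by
    have := HasDerivAt.of_local_left_inverse (f := phaseTime α θ) (g := e.symm) (a := u)
      e.symm.continuous.continuousAt (hasDerivAt_phaseTime hα hs _)
      (inv_ne_zero (sqrt_Pol_cos_pos hα hs _).ne')
      (Filter.Eventually.of_forall fun y => e.apply_symm_apply y)
    rwa [inv_inv] at this
  have hd' (u : ℝ) : HasDerivAt (fun u => e.symm (-u))
      (-Real.sqrt (Pol α θ (Real.cos (e.symm (-u))))) u := by
    have := (hd (-u)).comp u (hasDerivAt_neg u)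
    simpa using! this
  refine ⟨fun u => e.symm (-u), ⟨fun u => (hd' u).differentiableAt, fun u => ?_, ?_, ?_⟩,
    fun ψ hψ => ?_⟩
  · rw [(hd' u).deriv, neg_sq, Real.sq_sqrt (Pol_pos hα hs (Real.cos_sq_le_one _)).le]
  · simp only [neg_zero]
    rw [OrderIso.symm_apply_eq, he, phaseTime_zero]
  · rw [(hd' 0).deriv]
    exact neg_nonpos.2 (Real.sqrt_nonneg _)
  · funext u
    rw [eq_comm, OrderIso.symm_apply_eq, he, hψ.phaseTime_apply hα hs]

end PhaseTime

/-- The parameters of a horizontal catenoid: an angle that closes the period, and its phase. -/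
structure IsCatenoidDatum (α θ : ℝ) (φ : ℝ → ℝ) : Prop where
  alpha_pos : 0 < α
  angle_pos : 0 < θ
  angle_lt : θ < Real.pi / 4
  sin_sq_lt : Real.sin θ ^ 2 < α ^ 2
  period : periodIntegral α θ = 0
  phase : IsPhase α θ φ

/-- The half period of the phase: `φ(u + U) = φ(u) - π`. -/
noncomputable def halfPeriod (α θ : ℝ) : ℝ := phaseTime α θ Real.pi

namespace IsCatenoidDatum

variable {α θ : ℝ} {φ : ℝ → ℝ}

lemma Cst_pos (h : IsCatenoidDatum α θ φ) : 0 < Cst α θ :=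
  NilCatenoid.Cst_pos h.alpha_pos h.angle_pos h.angle_lt

lemma phase_zero (h : IsCatenoidDatum α θ φ) : φ 0 = 0 := h.phase.2.2.1

lemma hasDerivAt_phase (h : IsCatenoidDatum α θ φ) (u : ℝ) : HasDerivAt φ (deriv φ u) u :=
  (h.phase.1 u).hasDerivAt

lemma deriv_eq (h : IsCatenoidDatum α θ φ) (u : ℝ) :
    deriv φ u = -Real.sqrt (Pol α θ (Real.cos (φ u))) :=
  h.phase.deriv_eq h.alpha_pos h.sin_sq_lt u

lemma deriv_neg (h : IsCatenoidDatum α θ φ) (u : ℝ) : deriv φ u < 0 := by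
  rw [h.deriv_eq]
  exact neg_lt_zero.2 (sqrt_Pol_cos_pos h.alpha_pos h.sin_sq_lt _)

lemma deriv_sq (h : IsCatenoidDatum α θ φ) (u : ℝ) :
    deriv φ u ^ 2 = α ^ 2 + Real.cos (2 * θ) * Real.cos (φ u) ^ 2
      - Cst α θ ^ 2 * Real.cos (φ u) ^ 4 := h.phase.2.1 u

lemma hasDerivAt_deriv (h : IsCatenoidDatum α θ φ) (u : ℝ) :
    HasDerivAt (deriv φ) (-(Real.cos (2 * θ) * Real.cos (φ u)
      - 2 * Cst α θ ^ 2 * Real.cos (φ u) ^ 3) * Real.sin (φ u)) u := by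
  have hc : HasDerivAt (fun u => Real.cos (φ u)) (-Real.sin (φ u) * deriv φ u) u :=
    (h.hasDerivAt_phase u).cos
  have hP : HasDerivAt (fun u => Pol α θ (Real.cos (φ u))) (Real.cos (2 * θ) * (2 * Real.cos (φ u)
      * (-Real.sin (φ u) * deriv φ u)) - Cst α θ ^ 2 * (4 * Real.cos (φ u) ^ 3
      * (-Real.sin (φ u) * deriv φ u))) u := by
    have := (((hc.pow 2).const_mul (Real.cos (2 * θ))).const_add (α ^ 2)).sub
      ((hc.pow 4).const_mul (Cst α θ ^ 2))
    refine this.congr_deriv ?_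
    norm_num
  have hQ := sqrt_Pol_cos_pos h.alpha_pos h.sin_sq_lt (φ u)
  have := (hP.sqrt (Real.sqrt_pos.1 hQ).ne').neg
  rw [funext h.deriv_eq]
  refine this.congr_deriv ?_
  rw [h.deriv_eq u]
  field_simp
  ring

lemma alpha_sub_deriv_pos (h : IsCatenoidDatum α θ φ) (u : ℝ) : 0 < α - deriv φ u := by
  linarith [h.deriv_neg u, h.alpha_pos]

lemma GDeriv_mul_sub (h : IsCatenoidDatum α θ φ) (u : ℝ) :
    GDeriv α θ φ u * (α - deriv φ u)
      = Cst α θ ^ 2 * Real.cos (φ u) ^ 2 - Real.cos (2 * θ) :=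
  div_mul_cancel₀ _ (h.alpha_sub_deriv_pos u).ne'

/-- `G' cos² φ = α + φ'`: the factorization of `φ'² = P(cos φ)` as
`(α - φ') (α + φ') = (C² cos² φ - cos 2θ) cos² φ`. -/
lemma GDeriv_mul_cos_sq (h : IsCatenoidDatum α θ φ) (u : ℝ) :
    GDeriv α θ φ u * Real.cos (φ u) ^ 2 = α + deriv φ u := by
  apply mul_right_cancel₀ (h.alpha_sub_deriv_pos u).ne'
  linear_combination (Real.cos (φ u) ^ 2) * h.GDeriv_mul_sub u + h.deriv_sq u

lemma hasDerivAt_GDeriv (h : IsCatenoidDatum α θ φ) (u : ℝ) :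
    HasDerivAt (GDeriv α θ φ) (Real.cos (φ u) * Real.sin (φ u)
      * (GDeriv α θ φ u ^ 2 + Cst α θ ^ 2)) u := by
  have hc : HasDerivAt (fun u => Real.cos (φ u)) (-Real.sin (φ u) * deriv φ u) u :=
    (h.hasDerivAt_phase u).cos
  have hne := (h.alpha_sub_deriv_pos u).ne'
  have := (((hc.pow 2).const_mul (Cst α θ ^ 2)).sub_const (Real.cos (2 * θ))).div
    ((h.hasDerivAt_deriv u).const_sub α) hne
  refine this.congr_deriv ?_
  rw [div_eq_iff (pow_ne_zero 2 hne)]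
  have e1 := h.GDeriv_mul_sub u
  have e2 := h.GDeriv_mul_cos_sq u
  simp only [Pi.pow_apply]
  rw [← e1]
  have hk : Real.cos (2 * θ)
      = Cst α θ ^ 2 * Real.cos (φ u) ^ 2 - GDeriv α θ φ u * (α - deriv φ u) := by linarith
  rw [hk]
  norm_num
  linear_combination (Real.sin (φ u) * Real.cos (φ u) * (α - deriv φ u) * Cst α θ ^ 2) * e2

lemma continuous_phase (h : IsCatenoidDatum α θ φ) : Continuous φ :=
  h.phase.1.continuous

lemma continuous_GDeriv (h : IsCatenoidDatum α θ φ) : Continuous (GDeriv α θ φ) :=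
  continuous_iff_continuousAt.2 fun u => (h.hasDerivAt_GDeriv u).continuousAt

lemma hasDerivAt_GFun (h : IsCatenoidDatum α θ φ) (u : ℝ) :
    HasDerivAt (GFun α θ φ) (GDeriv α θ φ u) u :=
  (h.continuous_GDeriv.integral_hasStrictDerivAt 0 u).hasDerivAt

lemma hasDerivAt_betaFun (h : IsCatenoidDatum α θ φ) (u : ℝ) :
    HasDerivAt (betaFun α θ φ) (Cst α θ * Real.cos (φ u) ^ 2) u := by
  have : Continuous fun u => Cst α θ * Real.cos (φ u) ^ 2 :=
    continuous_const.mul ((Real.continuous_cos.comp h.continuous_phase).pow 2)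
  exact (this.integral_hasStrictDerivAt 0 u).hasDerivAt

lemma contDiff_phase (h : IsCatenoidDatum α θ φ) : ContDiff ℝ ∞ φ := by
  rw [contDiff_infty]
  intro n
  -- bootstrap from `φ' = -√P(cos φ)`
  induction n with
  | zero => exact contDiff_zero.2 h.continuous_phase
  | succ n ih =>
    push_cast
    refine contDiff_succ_iff_deriv.2 ⟨h.phase.1, by simp, ?_⟩
    rw [funext h.deriv_eq]
    refine (ContDiff.sqrt ?_ fun u => (Pol_pos h.alpha_pos h.sin_sq_lt
      (Real.cos_sq_le_one (φ u))).ne').neg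
    unfold Pol
    have := Real.contDiff_cos.comp ih
    exact (contDiff_const.add (contDiff_const.mul (this.pow 2))).sub
      (contDiff_const.mul (this.pow 4))

lemma contDiff_deriv (h : IsCatenoidDatum α θ φ) : ContDiff ℝ ∞ (deriv φ) :=
  (contDiff_infty_iff_deriv.1 h.contDiff_phase).2

lemma contDiff_cos (h : IsCatenoidDatum α θ φ) : ContDiff ℝ ∞ fun u => Real.cos (φ u) :=
  Real.contDiff_cos.comp h.contDiff_phase

lemma contDiff_sin (h : IsCatenoidDatum α θ φ) : ContDiff ℝ ∞ fun u => Real.sin (φ u) :=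
  Real.contDiff_sin.comp h.contDiff_phase

lemma contDiff_GDeriv (h : IsCatenoidDatum α θ φ) : ContDiff ℝ ∞ (GDeriv α θ φ) :=
  ((contDiff_const.mul (h.contDiff_cos.pow 2)).sub contDiff_const).div
    (contDiff_const.sub h.contDiff_deriv) fun u => (h.alpha_sub_deriv_pos u).ne'

lemma contDiff_GFun (h : IsCatenoidDatum α θ φ) : ContDiff ℝ ∞ (GFun α θ φ) := by
  refine contDiff_infty_iff_deriv.2 ⟨fun u => (h.hasDerivAt_GFun u).differentiableAt, ?_⟩
  rw [funext fun u => (h.hasDerivAt_GFun u).deriv]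
  exact h.contDiff_GDeriv

lemma contDiff_betaFun (h : IsCatenoidDatum α θ φ) : ContDiff ℝ ∞ (betaFun α θ φ) := by
  refine contDiff_infty_iff_deriv.2 ⟨fun u => (h.hasDerivAt_betaFun u).differentiableAt, ?_⟩
  rw [funext fun u => (h.hasDerivAt_betaFun u).deriv]
  exact contDiff_const.mul (h.contDiff_cos.pow 2)

/-! ### Symmetries of the phase and closing of the period -/

lemma phaseTime_apply (h : IsCatenoidDatum α θ φ) (u : ℝ) : phaseTime α θ (φ u) = -u :=
  h.phase.phaseTime_apply h.alpha_pos h.sin_sq_lt u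

lemma strictAnti_phase (h : IsCatenoidDatum α θ φ) : StrictAnti φ :=
  strictAnti_of_deriv_neg h.deriv_neg

lemma surjective_phase (h : IsCatenoidDatum α θ φ) : Function.Surjective φ := fun τ =>
  ⟨-phaseTime α θ τ, (strictMono_phaseTime h.alpha_pos h.sin_sq_lt).injective
    (by rw [h.phaseTime_apply, neg_neg])⟩

lemma halfPeriod_pos (h : IsCatenoidDatum α θ φ) : 0 < halfPeriod α θ := by
  have := strictMono_phaseTime h.alpha_pos h.sin_sq_lt Real.pi_pos
  rwa [phaseTime_zero] at this

lemma phase_neg (h : IsCatenoidDatum α θ φ) (u : ℝ) : φ (-u) = -φ u := by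
  apply (strictMono_phaseTime h.alpha_pos h.sin_sq_lt).injective
  rw [phaseTime_neg, h.phaseTime_apply, h.phaseTime_apply]

lemma phase_add (h : IsCatenoidDatum α θ φ) (u : ℝ) :
    φ (u + halfPeriod α θ) = φ u - Real.pi := by
  apply (strictMono_phaseTime h.alpha_pos h.sin_sq_lt).injective
  have := phaseTime_add_pi h.alpha_pos h.sin_sq_lt (φ u - Real.pi)
  rw [sub_add_cancel, h.phaseTime_apply] at this
  rw [h.phaseTime_apply, halfPeriod]
  linarith

lemma phase_halfPeriod (h : IsCatenoidDatum α θ φ) : φ (halfPeriod α θ) = -Real.pi := by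
  have := h.phase_add 0
  rwa [zero_add, h.phase_zero, zero_sub] at this

lemma deriv_phase_neg (h : IsCatenoidDatum α θ φ) (u : ℝ) : deriv φ (-u) = deriv φ u := by
  rw [h.deriv_eq, h.deriv_eq, h.phase_neg, Real.cos_neg]

lemma deriv_phase_add (h : IsCatenoidDatum α θ φ) (u : ℝ) :
    deriv φ (u + halfPeriod α θ) = deriv φ u := by
  rw [h.deriv_eq, h.deriv_eq, h.phase_add, Real.cos_sub_pi, Pol, Pol]
  ring_nf

lemma GDeriv_neg (h : IsCatenoidDatum α θ φ) (u : ℝ) : GDeriv α θ φ (-u) = GDeriv α θ φ u := by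
  rw [GDeriv, GDeriv, h.phase_neg, Real.cos_neg, h.deriv_phase_neg]

lemma GDeriv_add (h : IsCatenoidDatum α θ φ) (u : ℝ) :
    GDeriv α θ φ (u + halfPeriod α θ) = GDeriv α θ φ u := by
  rw [GDeriv, GDeriv, h.phase_add, Real.cos_sub_pi, h.deriv_phase_add, neg_sq]

lemma GFun_zero : GFun α θ φ 0 = 0 := by simp [GFun]

lemma betaFun_zero : betaFun α θ φ 0 = 0 := by simp [betaFun]

lemma GFun_neg (h : IsCatenoidDatum α θ φ) (u : ℝ) : GFun α θ φ (-u) = -GFun α θ φ u := by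
  have := intervalIntegral.integral_comp_neg (a := 0) (b := u) (GDeriv α θ φ)
  simp only [h.GDeriv_neg, neg_zero] at this
  rw [GFun, GFun, this, intervalIntegral.integral_symm]

lemma betaFun_neg (h : IsCatenoidDatum α θ φ) (u : ℝ) :
    betaFun α θ φ (-u) = -betaFun α θ φ u := by
  have := intervalIntegral.integral_comp_neg (a := 0) (b := u)
    (fun t => Cst α θ * Real.cos (φ t) ^ 2)
  simp only [h.phase_neg, Real.cos_neg, neg_zero] at this
  rw [betaFun, betaFun, this, intervalIntegral.integral_symm]

lemma GFun_add (h : IsCatenoidDatum α θ φ) (u : ℝ) :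
    GFun α θ φ (u + halfPeriod α θ) = GFun α θ φ u + GFun α θ φ (halfPeriod α θ) := by
  have hd (u : ℝ) : HasDerivAt (fun u => GFun α θ φ (u + halfPeriod α θ) - GFun α θ φ u) 0 u := by
    have := ((h.hasDerivAt_GFun (u + halfPeriod α θ)).comp_add_const u (halfPeriod α θ)).sub
      (h.hasDerivAt_GFun u)
    refine this.congr_deriv ?_
    rw [h.GDeriv_add, sub_self]
  have := is_const_of_deriv_eq_zero (fun x => (hd x).differentiableAt) (fun x => (hd x).deriv) u 0
  rw [zero_add, GFun_zero] at this
  linarith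

lemma betaFun_add (h : IsCatenoidDatum α θ φ) (u : ℝ) :
    betaFun α θ φ (u + halfPeriod α θ) = betaFun α θ φ u + betaFun α θ φ (halfPeriod α θ) := by
  have hd (u : ℝ) :
      HasDerivAt (fun u => betaFun α θ φ (u + halfPeriod α θ) - betaFun α θ φ u) 0 u := by
    have := ((h.hasDerivAt_betaFun (u + halfPeriod α θ)).comp_add_const u (halfPeriod α θ)).sub
      (h.hasDerivAt_betaFun u)
    refine this.congr_deriv ?_
    rw [h.phase_add, Real.cos_sub_pi, neg_sq, sub_self]
  have := is_const_of_deriv_eq_zero (fun x => (hd x).differentiableAt) (fun x => (hd x).deriv) u 0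
  rw [zero_add, betaFun_zero] at this
  linarith

/-- The vanishing of the period integral, in terms of the increments of `G` and `β` over half a
period: substitute `t = φ(u)` in the integral. -/
lemma period_closes (h : IsCatenoidDatum α θ φ) :
    α * GFun α θ φ (halfPeriod α θ) + Cst α θ * betaFun α θ φ (halfPeriod α θ) = 0 := by
  have hcos : Continuous fun t => Cst α θ * Real.cos (φ t) ^ 2 :=
    continuous_const.mul ((Real.continuous_cos.comp h.continuous_phase).pow 2)
  have h1 : α * GFun α θ φ (halfPeriod α θ) + Cst α θ * betaFun α θ φ (halfPeriod α θ)
      = ∫ u in (0 : ℝ)..halfPeriod α θ, -(periodDensity α θ (Real.cos (φ u)) * deriv φ u) := by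
    have i1 : Continuous fun t => α * GDeriv α θ φ t := continuous_const.mul h.continuous_GDeriv
    have i2 : Continuous fun t => Cst α θ * (Cst α θ * Real.cos (φ t) ^ 2) :=
      continuous_const.mul hcos
    rw [GFun, betaFun, ← intervalIntegral.integral_const_mul,
      ← intervalIntegral.integral_const_mul, ← intervalIntegral.integral_add
        (i1.intervalIntegrable _ _) (i2.intervalIntegrable _ _)]
    refine intervalIntegral.integral_congr fun u _ => ?_
    have hQ := sqrt_Pol_cos_pos h.alpha_pos h.sin_sq_lt (φ u)
    have := h.alpha_pos
    simp only [GDeriv, periodDensity, h.deriv_eq u]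
    rw [sub_neg_eq_add]
    field_simp
    ring
  have h2 := intervalIntegral.integral_comp_mul_deriv (a := 0) (b := halfPeriod α θ) (f := φ)
    (f' := deriv φ) (g := fun t => periodDensity α θ (Real.cos t))
    (fun u _ => h.hasDerivAt_phase u) h.contDiff_deriv.continuous.continuousOn
    (continuous_periodDensity_cos h.alpha_pos h.sin_sq_lt)
  have h3 := intervalIntegral.integral_comp_neg (a := 0) (b := Real.pi)
    (fun t => periodDensity α θ (Real.cos t))
  simp only [Real.cos_neg, neg_zero] at h3
  simp only [Function.comp_apply] at h2
  rw [h1, intervalIntegral.integral_neg, h2, h.phase_zero, h.phase_halfPeriod,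
    ← intervalIntegral.integral_symm, ← h3, ← periodIntegral_eq, h.period]

end IsCatenoidDatum

/-! ### The Levi-Civita connection of `Nil₃` -/

lemma nilInner_eq (p v w : Nil) : nilInner p v w = v 0 * w 0 + v 1 * w 1
    + (v 2 + (p 1 * v 0 - p 0 * v 1) / 2) * (w 2 + (p 1 * w 0 - p 0 * w 1) / 2) := by
  simp [nilInner, frameCoord, dotProduct, Fin.sum_univ_three]

lemma fderiv_nilInner (p u v w : Nil) : fderiv ℝ (fun q : Nil => nilInner q v w) p u
    = (u 1 * v 0 - u 0 * v 1) / 2 * (w 2 + (p 1 * w 0 - p 0 * w 1) / 2)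
      + (v 2 + (p 1 * v 0 - p 0 * v 1) / 2) * ((u 1 * w 0 - u 0 * w 1) / 2) := by
  have hp (i : Fin 3) : HasFDerivAt (fun q : Nil => q i)
      (ContinuousLinearMap.proj (R := ℝ) (φ := fun _ : Fin 3 => ℝ) i) p :=
    (ContinuousLinearMap.proj (R := ℝ) (φ := fun _ : Fin 3 => ℝ) i).hasFDerivAt
  have hl (v : Nil) : HasFDerivAt (fun q : Nil => v 2 + (q 1 * v 0 - q 0 * v 1) * (1 / 2)) _ p :=
    ((((hp 1).mul_const (v 0)).sub ((hp 0).mul_const (v 1))).mul_const (1 / 2 : ℝ)).const_add (v 2)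
  have := ((hl v).mul (hl w)).const_add (v 0 * w 0 + v 1 * w 1)
  have e : (fun q : Nil => nilInner q v w) = fun q => v 0 * w 0 + v 1 * w 1
    + (v 2 + (q 1 * v 0 - q 0 * v 1) * (1 / 2)) * (w 2 + (q 1 * w 0 - q 0 * w 1) * (1 / 2)) := by
    funext q; rw [nilInner_eq]; ring
  rw [e]
  refine (DFunLike.congr_fun (HasFDerivAt.fderiv this) u).trans ?_
  simp
  ring

lemma nilMetric_inv (p : Nil) : (nilMetric p)⁻¹ = !![1, 0, -p 1 / 2; 0, 1, p 0 / 2;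
    -p 1 / 2, p 0 / 2, 1 + (p 0 ^ 2 + p 1 ^ 2) / 4] := by
  apply Matrix.inv_eq_right_inv
  ext i j
  fin_cases i <;> fin_cases j <;>
    simp [Matrix.mul_apply, Fin.sum_univ_three, nilMetric, nilInner_eq] <;> ring

/-- The quadratic form `v ↦ Γ(v, v)` of the connection. -/
lemma sum_christoffel (p v : Nil) (k : Fin 3) :
    ∑ i, ∑ j, christoffel p i j k * v i * v j
      = ![v 1 * (v 2 + (p 1 * v 0 - p 0 * v 1) / 2), -v 0 * (v 2 + (p 1 * v 0 - p 0 * v 1) / 2),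
        -(p 0 * v 0 + p 1 * v 1) / 2 * (v 2 + (p 1 * v 0 - p 0 * v 1) / 2)] k := by
  have hd (i j l : Fin 3) : nilMetricDeriv p i j l = _ :=
    fderiv_nilInner p (Pi.single i 1) (Pi.single j 1) (Pi.single l 1)
  fin_cases k <;>
    simp [Fin.sum_univ_three, christoffel, nilMetric_inv, hd] <;> ring

/-! ### Partial derivatives of maps defined on `ℂ` -/

section PartialDerivatives

variable {E : Type*} [NormedAddCommGroup E] [NormedSpace ℝ E]

/-- `f` is differentiable at `z` with partial derivatives `∂f/∂u = a` and `∂f/∂v = b`. -/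
def HasPD (f : ℂ → E) (a b : E) (z : ℂ) : Prop :=
  HasFDerivAt f (Complex.reCLM.smulRight a + Complex.imCLM.smulRight b) z

lemma HasPD.pd_eq {f : ℂ → E} {a b : E} {z : ℂ} (h : HasPD f a b z) (m : ℂ) :
    pd m f z = m.re • a + m.im • b := by
  rw [pd, HasFDerivAt.fderiv h]; simp

lemma HasPD.pd_one {f : ℂ → E} {a b : E} {z : ℂ} (h : HasPD f a b z) : pd 1 f z = a := by
  simp [h.pd_eq]

lemma HasPD.pd_I {f : ℂ → E} {a b : E} {z : ℂ} (h : HasPD f a b z) :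
    pd Complex.I f z = b := by
  simp [h.pd_eq]

lemma HasPD.congr {f : ℂ → E} {a b a' b' : E} {z : ℂ} (h : HasPD f a b z) (ha : a' = a)
    (hb : b' = b) : HasPD f a' b' z := by rwa [ha, hb]

lemma fderiv_eq_smul (L : ℂ →L[ℝ] E) (m : ℂ) : L m = m.re • L 1 + m.im • L Complex.I := by
  conv_lhs => rw [show m = m.re • (1 : ℂ) + m.im • Complex.I by simp [Complex.re_add_im]]
  rw [map_add, map_smul, map_smul]

lemma hasPD_of_hasFDerivAt {f : ℂ → E} {L : ℂ →L[ℝ] E} {z : ℂ} (h : HasFDerivAt f L z) :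
    HasPD f (L 1) (L Complex.I) z := by
  have : L = Complex.reCLM.smulRight (L 1) + Complex.imCLM.smulRight (L Complex.I) := by
    ext x
    simpa using fderiv_eq_smul L x
  rwa [HasPD, ← this]

lemma HasPD.const (c : E) (z : ℂ) : HasPD (fun _ => c) 0 0 z := by
  have : HasFDerivAt (fun _ : ℂ => c) (0 : ℂ →L[ℝ] E) z := hasFDerivAt_const c z
  simpa using hasPD_of_hasFDerivAt this

lemma HasPD.add {f g : ℂ → E} {a b a' b' : E} {z : ℂ} (hf : HasPD f a b z)
    (hg : HasPD g a' b' z) : HasPD (fun z => f z + g z) (a + a') (b + b') z := by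
  have := hasPD_of_hasFDerivAt ((HasFDerivAt.add hf hg))
  simpa using! this

lemma HasPD.sub {f g : ℂ → E} {a b a' b' : E} {z : ℂ} (hf : HasPD f a b z)
    (hg : HasPD g a' b' z) : HasPD (fun z => f z - g z) (a - a') (b - b') z := by
  have := hasPD_of_hasFDerivAt ((HasFDerivAt.sub hf hg))
  simpa using! this

lemma HasPD.neg {f : ℂ → E} {a b : E} {z : ℂ} (hf : HasPD f a b z) :
    HasPD (fun z => -f z) (-a) (-b) z := by
  have := hasPD_of_hasFDerivAt ((HasFDerivAt.neg hf))
  simpa using! this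

lemma HasPD.mul {𝔸 : Type*} [NormedCommRing 𝔸] [NormedAlgebra ℝ 𝔸] {f g : ℂ → 𝔸}
    {a b a' b' : 𝔸} {z : ℂ} (hf : HasPD f a b z) (hg : HasPD g a' b' z) :
    HasPD (fun z => f z * g z) (a * g z + f z * a') (b * g z + f z * b') z := by
  have := hasPD_of_hasFDerivAt ((HasFDerivAt.mul hf hg))
  refine HasPD.congr this ?_ ?_ <;> simp <;> ring

lemma HasPD.const_mul {𝔸 : Type*} [NormedCommRing 𝔸] [NormedAlgebra ℝ 𝔸] (c : 𝔸) {f : ℂ → 𝔸}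
    {a b : 𝔸} {z : ℂ} (hf : HasPD f a b z) : HasPD (fun z => c * f z) (c * a) (c * b) z := by
  simpa using (HasPD.const c z).mul hf

lemma HasPD.comp_re {f : ℝ → E} {f' : E} {z : ℂ} (hf : HasDerivAt f f' z.re) :
    HasPD (fun z => f z.re) f' 0 z := by
  have := hasPD_of_hasFDerivAt (((hasDerivAt_iff_hasFDerivAt.1 hf).comp z Complex.reCLM.hasFDerivAt))
  simpa using! this

lemma HasPD.im (z : ℂ) : HasPD (fun z => z.im) 0 1 z := by
  have := hasPD_of_hasFDerivAt ((Complex.imCLM.hasFDerivAt (x := z)))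
  simpa using! this

lemma HasPD.comp_real {f : ℂ → ℝ} {a b : ℝ} {z : ℂ} (hf : HasPD f a b z) {g : ℝ → ℝ} {g' : ℝ}
    (hg : HasDerivAt g g' (f z)) : HasPD (fun z => g (f z)) (g' * a) (g' * b) z := by
  have := hasPD_of_hasFDerivAt (((hasDerivAt_iff_hasFDerivAt.1 hg).comp z hf))
  refine HasPD.congr this ?_ ?_ <;> simp [mul_comm]

lemma HasPD.ofReal {f : ℂ → ℝ} {a b : ℝ} {z : ℂ} (hf : HasPD f a b z) :
    HasPD (fun z => (f z : ℂ)) (a : ℂ) (b : ℂ) z := by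
  have := hasPD_of_hasFDerivAt ((Complex.ofRealCLM.hasFDerivAt.comp z hf))
  simpa using! this

lemma HasPD.conj {f : ℂ → ℂ} {a b : ℂ} {z : ℂ} (hf : HasPD f a b z) :
    HasPD (fun z => conj (f z)) (conj a) (conj b) z := by
  have := hasPD_of_hasFDerivAt (((Complex.conjCLE : ℂ →L[ℝ] ℂ).hasFDerivAt.comp z hf))
  simpa using! this

lemma HasPD.comp_holomorphic {f : ℂ → ℂ} {a b : ℂ} {z : ℂ} (hf : HasPD f a b z) {g : ℂ → ℂ}
    {g' : ℂ} (hg : HasDerivAt g g' (f z)) : HasPD (fun z => g (f z)) (g' * a) (g' * b) z := by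
  have := hasPD_of_hasFDerivAt (((hasDerivAt_iff_hasFDerivAt.1 hg).restrictScalars ℝ |>.comp z hf))
  refine HasPD.congr this ?_ ?_ <;> simp [mul_comm]

lemma HasPD.pi {f : ℂ → Nil} {a b : Nil} {z : ℂ}
    (hf : ∀ i, HasPD (fun z => f z i) (a i) (b i) z) : HasPD f a b z := by
  rw [HasPD, hasFDerivAt_pi']
  intro i
  refine HasFDerivAt.congr_fderiv (hf i) ?_
  ext; simp

lemma HasPD.apply {f : ℂ → Nil} {a b : Nil} {z : ℂ} (hf : HasPD f a b z) (i : Fin 3) :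
    HasPD (fun z => f z i) (a i) (b i) z := by
  rw [HasPD, hasFDerivAt_pi'] at hf
  refine HasFDerivAt.congr_fderiv (hf i) ?_
  ext; simp

lemma HasPD.dz_eq {f : ℂ → ℂ} {a b : ℂ} {z : ℂ} (h : HasPD f a b z) :
    dz f z = (a - Complex.I * b) / 2 := by rw [dz, h.pd_one, h.pd_I]

lemma HasPD.dzbar_eq {f : ℂ → ℂ} {a b : ℂ} {z : ℂ} (h : HasPD f a b z) :
    dzbar f z = (a + Complex.I * b) / 2 := by rw [dzbar, h.pd_one, h.pd_I]

end PartialDerivatives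

/-! ### Conformal harmonic immersions and holomorphic changes of parameter -/

/-- The tension field of `f` in the coordinates of `Nil₃`: a conformal immersion is minimal when
it vanishes. -/
noncomputable def tension (f : ℂ → Nil) (z : ℂ) : Nil :=
  covDeriv f z 1 1 + covDeriv f z Complex.I Complex.I

/-- `f` is near `z` a smooth map whose differential at `z` is conformal and injective, and whose
tension vanishes at `z`. -/
structure IsConformalHarmonicAt (f : ℂ → Nil) (z : ℂ) : Prop where
  smooth : ContDiffAt ℝ ∞ f z
  norm_eq : firstForm f z 1 1 = firstForm f z Complex.I Complex.I
  orthogonal : firstForm f z 1 Complex.I = 0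
  norm_ne_zero : firstForm f z 1 1 ≠ 0
  tension_eq : tension f z = 0

lemma frameCoord_add (p v w : Nil) : frameCoord p (v + w) = frameCoord p v + frameCoord p w := by
  ext i; fin_cases i <;> simp [frameCoord]; ring

lemma frameCoord_zero (p : Nil) : frameCoord p 0 = 0 := by
  ext i; fin_cases i <;> simp [frameCoord]

lemma IsConformalHarmonicAt.meanCurvature_eq {f : ℂ → Nil} {z : ℂ}
    (h : IsConformalHarmonicAt f z) : meanCurvature f z = 0 := by
  have : secondForm f z 1 1 + secondForm f z Complex.I Complex.I = 0 := by
    rw [secondForm, secondForm, ← add_dotProduct, ← frameCoord_add, ← tension, h.tension_eq,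
      frameCoord_zero, zero_dotProduct]
  rw [meanCurvature, ← h.norm_eq, h.orthogonal, mul_zero, sub_zero, ← add_mul, this, zero_mul,
    zero_div]

lemma IsConformalHarmonicAt.injective_fderiv {f : ℂ → Nil} {z : ℂ}
    (h : IsConformalHarmonicAt f z) : Function.Injective (fderiv ℝ f z) := by
  rw [injective_iff_map_eq_zero]
  intro m hm
  rw [fderiv_eq_smul] at hm
  have h1 := h.norm_eq
  have h2 := h.orthogonal
  have h3 := h.norm_ne_zero
  simp only [firstForm, pd] at h1 h2 h3
  set a := fderiv ℝ f z 1
  set b := fderiv ℝ f z Complex.I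
  have key : nilInner (f z) (m.re • a + m.im • b) (m.re • a + m.im • b)
      = (m.re ^ 2 + m.im ^ 2) * nilInner (f z) a a := by
    have : nilInner (f z) (m.re • a + m.im • b) (m.re • a + m.im • b)
      = m.re ^ 2 * nilInner (f z) a a + 2 * m.re * m.im * nilInner (f z) a b
        + m.im ^ 2 * nilInner (f z) b b := by
      simp only [nilInner_eq, Pi.add_apply, Pi.smul_apply, smul_eq_mul]; ring
    rw [this, h2, ← h1]; ring
  rw [hm] at key
  have h0 : nilInner (f z) 0 0 = 0 := by simp [nilInner_eq]
  rw [h0] at key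
  have := (mul_eq_zero.1 key.symm).resolve_right h3
  apply Complex.ext <;> simp <;> nlinarith [sq_nonneg m.re, sq_nonneg m.im]

lemma isConformalMinimalImmersionOn_of {f : ℂ → Nil} {U : Set ℂ}
    (h : ∀ z ∈ U, IsConformalHarmonicAt f z) : IsConformalMinimalImmersionOn f U where
  smooth z hz := (h z hz).smooth.contDiffWithinAt
  immersion z hz := (h z hz).injective_fderiv
  conformal z hz := ⟨(h z hz).norm_eq, (h z hz).orthogonal⟩
  minimal z hz := (h z hz).meanCurvature_eq

lemma covDeriv_self (f : ℂ → Nil) (z a : ℂ) (k : Fin 3) :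
    covDeriv f z a a k = pd a (pd a f) z k +
      ![pd a f z 1 * (pd a f z 2 + (f z 1 * pd a f z 0 - f z 0 * pd a f z 1) / 2),
        -pd a f z 0 * (pd a f z 2 + (f z 1 * pd a f z 0 - f z 0 * pd a f z 1) / 2),
        -(f z 0 * pd a f z 0 + f z 1 * pd a f z 1) / 2
          * (pd a f z 2 + (f z 1 * pd a f z 0 - f z 0 * pd a f z 1) / 2)] k := by
  rw [covDeriv, sum_christoffel]

/-- Conformal harmonic immersions are preserved by holomorphic changes of parameter: the second
derivative of the change of parameter contributes `df(ψ'' · 1²) + df(ψ'' · i²) = 0` to the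
tension. -/
lemma IsConformalHarmonicAt.comp {f : ℂ → Nil} {ψ : ℂ → ℂ} {Y : ℂ → Nil} {w : ℂ}
    (hf : IsConformalHarmonicAt f (ψ w)) (hψ : AnalyticAt ℂ ψ w) (hψ' : deriv ψ w ≠ 0)
    (hY : Y =ᶠ[nhds w] f ∘ ψ) : IsConformalHarmonicAt Y w := by
  have hψd : ∀ᶠ x in nhds w, HasFDerivAt ψ
      ((ContinuousLinearMap.toSpanSingleton ℂ (deriv ψ x)).restrictScalars ℝ) x := by
    filter_upwards [hψ.eventually_analyticAt] with x hx
    exact (hasDerivAt_iff_hasFDerivAt.1 hx.differentiableAt.hasDerivAt).restrictScalars ℝ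
  have hfd : ∀ᶠ x in nhds w, DifferentiableAt ℝ f (ψ x) := by
    apply hψ.continuousAt.eventually
    filter_upwards [(hf.smooth.of_le (m := 1) (by simp)).eventually (by simp)] with y hy
    exact hy.differentiableAt (by simp)
  have hpd (a : ℂ) : pd a Y =ᶠ[nhds w] fun x => fderiv ℝ f (ψ x) (a * deriv ψ x) := by
    filter_upwards [hY.eventuallyEq_nhds, hψd, hfd] with x h1 h2 h3
    rw [pd, h1.fderiv_eq, (h3.hasFDerivAt.comp x h2).fderiv]
    simp
  have hpdw (a : ℂ) : pd a Y w = pd (a * deriv ψ w) f (ψ w) := (hpd a).self_of_nhds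
  have hYw : Y w = f (ψ w) := hY.self_of_nhds
  have hfd2 : DifferentiableAt ℝ (fderiv ℝ f) (ψ w) :=
    (hf.smooth.fderiv_right (m := 1) (by norm_cast)).differentiableAt (by simp)
  have hpd2 (a : ℂ) : pd a (pd a Y) w =
      fderiv ℝ (fderiv ℝ f) (ψ w) (a * deriv ψ w) (a * deriv ψ w)
        + fderiv ℝ f (ψ w) (a * a * deriv (deriv ψ) w) := by
    have h1 := hfd2.hasFDerivAt.comp w hψd.self_of_nhds
    have h2 := (hasDerivAt_iff_hasFDerivAt.1
      ((hψ.deriv.differentiableAt.hasDerivAt).const_mul a)).restrictScalars ℝ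
    have h3 := h1.clm_apply h2
    rw [pd, (hpd a).fderiv_eq]
    refine (DFunLike.congr_fun h3.fderiv a).trans ?_
    simp [mul_assoc, add_comm]
  have hpd2f (a : ℂ) : pd a (pd a f) (ψ w) = fderiv ℝ (fderiv ℝ f) (ψ w) a a := by
    have h3 := hfd2.hasFDerivAt.clm_apply (hasFDerivAt_const a (ψ w))
    refine (DFunLike.congr_fun h3.fderiv a).trans ?_
    simp
  set m := deriv ψ w
  set H := fderiv ℝ (fderiv ℝ f) (ψ w)
  have hm1 : pd (1 * m) f (ψ w) = m.re • pd 1 f (ψ w) + m.im • pd Complex.I f (ψ w) := by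
    rw [one_mul]; exact fderiv_eq_smul _ m
  have hmI : pd (Complex.I * m) f (ψ w)
      = (-m.im) • pd 1 f (ψ w) + m.re • pd Complex.I f (ψ w) := by
    rw [pd, fderiv_eq_smul]; simp [pd]
  have hH : H m m + H (Complex.I * m) (Complex.I * m)
      = (m.re ^ 2 + m.im ^ 2) • (H 1 1 + H Complex.I Complex.I) := by
    rw [fderiv_eq_smul H m, fderiv_eq_smul H (Complex.I * m)]
    simp only [_root_.add_apply, _root_.smul_apply]
    rw [fderiv_eq_smul (H 1) m, fderiv_eq_smul (H Complex.I) m,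
      fderiv_eq_smul (H 1) (Complex.I * m), fderiv_eq_smul (H Complex.I) (Complex.I * m)]
    ext k
    simp
    ring
  have hE := hf.norm_eq
  have hF := hf.orthogonal
  have hE0 := hf.norm_ne_zero
  have hmpos : 0 < m.re ^ 2 + m.im ^ 2 := by
    have := Complex.normSq_pos.2 hψ'
    rw [Complex.normSq_apply] at this
    nlinarith
  have e11 : firstForm Y w 1 1 = (m.re ^ 2 + m.im ^ 2) * firstForm f (ψ w) 1 1 := by
    have : firstForm Y w 1 1 = m.re ^ 2 * firstForm f (ψ w) 1 1
        + 2 * m.re * m.im * firstForm f (ψ w) 1 Complex.I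
        + m.im ^ 2 * firstForm f (ψ w) Complex.I Complex.I := by
      simp only [firstForm, hpdw, hYw, hm1, nilInner_eq, Pi.add_apply, Pi.smul_apply, smul_eq_mul]
      ring
    rw [this, hF, ← hE]; ring
  have eII : firstForm Y w Complex.I Complex.I
      = (m.re ^ 2 + m.im ^ 2) * firstForm f (ψ w) 1 1 := by
    have : firstForm Y w Complex.I Complex.I = m.im ^ 2 * firstForm f (ψ w) 1 1
        - 2 * m.re * m.im * firstForm f (ψ w) 1 Complex.I
        + m.re ^ 2 * firstForm f (ψ w) Complex.I Complex.I := by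
      simp only [firstForm, hpdw, hYw, hmI, nilInner_eq, Pi.add_apply, Pi.smul_apply, smul_eq_mul]
      ring
    rw [this, hF, ← hE]; ring
  refine ⟨?_, e11.trans eII.symm, ?_, ?_, ?_⟩
  · exact (hf.smooth.comp w (hψ.contDiffAt.restrict_scalars ℝ)).congr_of_eventuallyEq hY
  · have : firstForm Y w 1 Complex.I = m.re * m.im
          * (firstForm f (ψ w) Complex.I Complex.I - firstForm f (ψ w) 1 1)
        + (m.re ^ 2 - m.im ^ 2) * firstForm f (ψ w) 1 Complex.I := by
      simp only [firstForm, hpdw, hYw, hm1, hmI, nilInner_eq, Pi.add_apply, Pi.smul_apply,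
        smul_eq_mul]
      ring
    rw [this, hF, ← hE]; ring
  · rw [e11]; exact mul_ne_zero hmpos.ne' hE0
  · have key : tension Y w = (m.re ^ 2 + m.im ^ 2) • tension f (ψ w) := by
      have hsum : pd 1 (pd 1 Y) w + pd Complex.I (pd Complex.I Y) w
          = (m.re ^ 2 + m.im ^ 2) • (pd 1 (pd 1 f) (ψ w)
            + pd Complex.I (pd Complex.I f) (ψ w)) := by
        rw [hpd2, hpd2, hpd2f, hpd2f, ← hH]
        simp only [one_mul, Complex.I_mul_I, neg_mul, map_neg]
        abel
      ext k
      have hk := congrFun hsum k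
      simp only [Pi.add_apply, Pi.smul_apply, smul_eq_mul] at hk
      simp only [tension, Pi.add_apply, Pi.smul_apply, smul_eq_mul, covDeriv_self, hpdw, hYw, hm1,
        hmI]
      fin_cases k <;> simp at hk ⊢ <;> linear_combination hk
    rw [key, hf.tension_eq, smul_zero]

/-! ### The differential of the immersion -/

section Components

variable (α θ : ℝ) (φ : ℝ → ℝ) (z : ℂ)

/-- The `E₁`-component of `∂X/∂u`. -/
noncomputable def uHor : ℝ :=
  GDeriv α θ φ z.re * Real.sin (φ z.re) * Real.sinh (AFun α θ φ z)
    + Cst α θ * Real.cos (φ z.re) * Real.cosh (AFun α θ φ z)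

/-- The `E₁`-component of `∂X/∂v`. -/
noncomputable def vHor : ℝ :=
  GDeriv α θ φ z.re * Real.cos (φ z.re) * Real.cosh (AFun α θ φ z)
    - Cst α θ * Real.sin (φ z.re) * Real.sinh (AFun α θ φ z)

/-- The `E₃`-component of `∂X/∂u`. -/
noncomputable def uVer : ℝ :=
  GDeriv α θ φ z.re * Real.cos (φ z.re) * Real.sinh (AFun α θ φ z)
    - Cst α θ * Real.sin (φ z.re) * Real.cosh (AFun α θ φ z)

/-- The `E₃`-component of `∂X/∂v`. -/
noncomputable def vVer : ℝ :=
  -(GDeriv α θ φ z.re * Real.sin (φ z.re) * Real.cosh (AFun α θ φ z))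
    - Cst α θ * Real.cos (φ z.re) * Real.sinh (AFun α θ φ z)

/-- The second coordinate `x₂` of the immersion. -/
noncomputable def depth : ℝ := Cst α θ * z.im - GFun α θ φ z.re

/-- The coordinate `y₁ = x₁` of the immersion in the planes `x₂ = c`. -/
noncomputable def sliceX : ℝ := α⁻¹ * uVer α θ φ z

/-- The coordinate `y₃ = x₃ + x₁ x₂ / 2` of the immersion in the planes `x₂ = c`. -/
noncomputable def sliceY : ℝ := α⁻¹ * (Cst α θ * (α⁻¹ * vHor α θ φ z) - uHor α θ φ z)

end Components

lemma catenoidImmersion_eq (α θ : ℝ) (φ : ℝ → ℝ) (z : ℂ) :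
    catenoidImmersion α θ φ z = ![sliceX α θ φ z, depth α θ φ z,
      sliceY α θ φ z - sliceX α θ φ z * depth α θ φ z * (1 / 2)] := by
  ext i
  fin_cases i <;> simp [catenoidImmersion, sliceX, sliceY, depth, uHor, vHor, uVer] <;> ring

lemma sliceCoord_catenoidImmersion (α θ : ℝ) (φ : ℝ → ℝ) (z : ℂ) :
    sliceCoord (catenoidImmersion α θ φ z) = (sliceX α θ φ z, sliceY α θ φ z) := by
  rw [catenoidImmersion_eq]
  simp [sliceCoord]
  ring

lemma HasPD.vec3 {f g k : ℂ → ℝ} {a b a' b' a'' b'' : ℝ} {z : ℂ} (hf : HasPD f a b z)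
    (hg : HasPD g a' b' z) (hk : HasPD k a'' b'' z) :
    HasPD (fun z => (![f z, g z, k z] : Nil)) ![a, a', a''] ![b, b', b''] z := by
  refine HasPD.pi fun i => ?_
  fin_cases i
  · exact hf
  · exact hg
  · exact hk

namespace IsCatenoidDatum

variable {α θ : ℝ} {φ : ℝ → ℝ}

lemma hasPD_AFun (h : IsCatenoidDatum α θ φ) (z : ℂ) :
    HasPD (AFun α θ φ) (Cst α θ * Real.cos (φ z.re) ^ 2) α z := by
  refine (((HasPD.im z).const_mul α).add (HasPD.comp_re (h.hasDerivAt_betaFun z.re))).congr ?_ ?_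
    <;> ring

lemma hasPD_sinh (h : IsCatenoidDatum α θ φ) (z : ℂ) :
    HasPD (fun z => Real.sinh (AFun α θ φ z))
      (Real.cosh (AFun α θ φ z) * (Cst α θ * Real.cos (φ z.re) ^ 2))
      (Real.cosh (AFun α θ φ z) * α) z :=
  (h.hasPD_AFun z).comp_real (Real.hasDerivAt_sinh _)

lemma hasPD_cosh (h : IsCatenoidDatum α θ φ) (z : ℂ) :
    HasPD (fun z => Real.cosh (AFun α θ φ z))
      (Real.sinh (AFun α θ φ z) * (Cst α θ * Real.cos (φ z.re) ^ 2))
      (Real.sinh (AFun α θ φ z) * α) z :=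
  (h.hasPD_AFun z).comp_real (Real.hasDerivAt_cosh _)

lemma hasPD_sin (h : IsCatenoidDatum α θ φ) (z : ℂ) :
    HasPD (fun z => Real.sin (φ z.re)) (Real.cos (φ z.re) * deriv φ z.re) 0 z :=
  HasPD.comp_re (h.hasDerivAt_phase z.re).sin

lemma hasPD_cos (h : IsCatenoidDatum α θ φ) (z : ℂ) :
    HasPD (fun z => Real.cos (φ z.re)) (-Real.sin (φ z.re) * deriv φ z.re) 0 z :=
  HasPD.comp_re (h.hasDerivAt_phase z.re).cos

lemma hasPD_GDeriv (h : IsCatenoidDatum α θ φ) (z : ℂ) :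
    HasPD (fun z => GDeriv α θ φ z.re) (Real.cos (φ z.re) * Real.sin (φ z.re)
      * (GDeriv α θ φ z.re ^ 2 + Cst α θ ^ 2)) 0 z :=
  HasPD.comp_re (h.hasDerivAt_GDeriv z.re)

lemma hasPD_uHor (h : IsCatenoidDatum α θ φ) (z : ℂ) : HasPD (uHor α θ φ)
    (Real.cos (φ z.re) * (GDeriv α θ φ z.re ^ 2 + Cst α θ ^ 2) * Real.sinh (AFun α θ φ z)
      - α * uVer α θ φ z) (-α * vVer α θ φ z) z := by
  have e1 := h.GDeriv_mul_cos_sq z.re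
  have e2 := Real.sin_sq_add_cos_sq (φ z.re)
  refine ((((h.hasPD_GDeriv z).mul (h.hasPD_sin z)).mul (h.hasPD_sinh z)).add
    (((h.hasPD_cos z).const_mul (Cst α θ)).mul (h.hasPD_cosh z))).congr ?_ ?_
  · rw [uVer]
    set p := GDeriv α θ φ z.re
    set s := Real.sin (φ z.re)
    set c := Real.cos (φ z.re)
    set D := deriv φ z.re
    set C := Cst α θ
    set sh := Real.sinh (AFun α θ φ z)
    set ch := Real.cosh (AFun α θ φ z)
    linear_combination (-c * sh * (C ^ 2 + p ^ 2)) * e2 + (c * p * sh - C * s * ch) * e1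
  · rw [vVer]; ring

lemma hasPD_vHor (h : IsCatenoidDatum α θ φ) (z : ℂ) : HasPD (vHor α θ φ)
    (-α * vVer α θ φ z) (α * uVer α θ φ z) z := by
  have e1 := h.GDeriv_mul_cos_sq z.re
  refine ((((h.hasPD_GDeriv z).mul (h.hasPD_cos z)).mul (h.hasPD_cosh z)).sub
    (((h.hasPD_sin z).const_mul (Cst α θ)).mul (h.hasPD_sinh z))).congr ?_ ?_
  · rw [vVer]
    linear_combination (-(GDeriv α θ φ z.re * Real.sin (φ z.re) * Real.cosh (AFun α θ φ z)
      + Cst α θ * Real.cos (φ z.re) * Real.sinh (AFun α θ φ z))) * e1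
  · rw [uVer]; ring

lemma hasPD_uVer (h : IsCatenoidDatum α θ φ) (z : ℂ) : HasPD (uVer α θ φ)
    (α * uHor α θ φ z) (α * vHor α θ φ z) z := by
  have e1 := h.GDeriv_mul_cos_sq z.re
  refine ((((h.hasPD_GDeriv z).mul (h.hasPD_cos z)).mul (h.hasPD_sinh z)).sub
    (((h.hasPD_sin z).const_mul (Cst α θ)).mul (h.hasPD_cosh z))).congr ?_ ?_
  · rw [uHor]
    linear_combination (-(GDeriv α θ φ z.re * Real.sin (φ z.re) * Real.sinh (AFun α θ φ z)
      + Cst α θ * Real.cos (φ z.re) * Real.cosh (AFun α θ φ z))) * e1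
  · rw [vHor]; ring

lemma hasPD_vVer (h : IsCatenoidDatum α θ φ) (z : ℂ) : HasPD (vVer α θ φ)
    (α * vHor α θ φ z - Real.cos (φ z.re) * (GDeriv α θ φ z.re ^ 2 + Cst α θ ^ 2)
      * Real.cosh (AFun α θ φ z)) (-α * uHor α θ φ z) z := by
  have e1 := h.GDeriv_mul_cos_sq z.re
  have e2 := Real.sin_sq_add_cos_sq (φ z.re)
  refine ((((h.hasPD_GDeriv z).mul (h.hasPD_sin z)).mul (h.hasPD_cosh z)).neg.sub
    (((h.hasPD_cos z).const_mul (Cst α θ)).mul (h.hasPD_sinh z))).congr ?_ ?_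
  · rw [vHor]
    set p := GDeriv α θ φ z.re
    set s := Real.sin (φ z.re)
    set c := Real.cos (φ z.re)
    set D := deriv φ z.re
    set C := Cst α θ
    set sh := Real.sinh (AFun α θ φ z)
    set ch := Real.cosh (AFun α θ φ z)
    linear_combination (c * ch * (C ^ 2 + p ^ 2)) * e2 - (c * p * ch - C * s * sh) * e1
  · rw [uHor]; ring

lemma hasPD_depth (h : IsCatenoidDatum α θ φ) (z : ℂ) :
    HasPD (depth α θ φ) (-GDeriv α θ φ z.re) (Cst α θ) z := by
  refine (((HasPD.im z).const_mul (Cst α θ)).sub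
    (HasPD.comp_re (h.hasDerivAt_GFun z.re))).congr ?_ ?_ <;> ring

lemma hasPD_sliceX (h : IsCatenoidDatum α θ φ) (z : ℂ) :
    HasPD (sliceX α θ φ) (uHor α θ φ z) (vHor α θ φ z) z := by
  have := h.alpha_pos.ne'
  refine ((h.hasPD_uVer z).const_mul α⁻¹).congr ?_ ?_ <;> field_simp

lemma hasPD_sliceY (h : IsCatenoidDatum α θ φ) (z : ℂ) :
    HasPD (sliceY α θ φ) (uVer α θ φ z - GDeriv α θ φ z.re * sliceX α θ φ z)
      (vVer α θ φ z + Cst α θ * sliceX α θ φ z) z := by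
  have := h.alpha_pos.ne'
  refine ((((h.hasPD_vHor z).const_mul α⁻¹).const_mul (Cst α θ)).sub
    (h.hasPD_uHor z)).const_mul α⁻¹ |>.congr ?_ ?_
  · rw [sliceX]
    field_simp
    rw [uVer, vVer]
    ring
  · rw [sliceX]
    field_simp
    ring

/-- The partial derivatives of the immersion. -/
lemma hasPD_catenoidImmersion (h : IsCatenoidDatum α θ φ) (z : ℂ) :
    HasPD (catenoidImmersion α θ φ)
      ![uHor α θ φ z, -GDeriv α θ φ z.re, uVer α θ φ z
        - (depth α θ φ z * uHor α θ φ z + GDeriv α θ φ z.re * sliceX α θ φ z) * (1 / 2)]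
      ![vHor α θ φ z, Cst α θ, vVer α θ φ z
        - (depth α θ φ z * vHor α θ φ z - Cst α θ * sliceX α θ φ z) * (1 / 2)] z := by
  rw [funext (catenoidImmersion_eq α θ φ)]
  refine HasPD.pi fun i => ?_
  fin_cases i
  · exact h.hasPD_sliceX z
  · exact h.hasPD_depth z
  · have := ((h.hasPD_sliceX z).mul (h.hasPD_depth z)).mul (HasPD.const (1 / 2) z)
    refine ((h.hasPD_sliceY z).sub this).congr ?_ ?_
    · simp; ring
    · simp; ring

lemma contDiff_catenoidImmersion (h : IsCatenoidDatum α θ φ) :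
    ContDiff ℝ ∞ (catenoidImmersion α θ φ) := by
  have hre : ContDiff ℝ ∞ Complex.re := Complex.reCLM.contDiff
  have him : ContDiff ℝ ∞ Complex.im := Complex.imCLM.contDiff
  have hA : ContDiff ℝ ∞ (AFun α θ φ) :=
    (contDiff_const.mul him).add (h.contDiff_betaFun.comp hre)
  have hs := h.contDiff_sin.comp hre
  have hc := h.contDiff_cos.comp hre
  have hp := h.contDiff_GDeriv.comp hre
  have hG := h.contDiff_GFun.comp hre
  have hsh := Real.contDiff_sinh.comp hA
  have hch := Real.contDiff_cosh.comp hA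
  have hy : ContDiff ℝ ∞ (depth α θ φ) := (contDiff_const.mul him).sub hG
  have huH : ContDiff ℝ ∞ (uHor α θ φ) :=
    ((hp.mul hs).mul hsh).add ((contDiff_const.mul hc).mul hch)
  have hvH : ContDiff ℝ ∞ (vHor α θ φ) :=
    ((hp.mul hc).mul hch).sub ((contDiff_const.mul hs).mul hsh)
  have huV : ContDiff ℝ ∞ (uVer α θ φ) :=
    ((hp.mul hc).mul hsh).sub ((contDiff_const.mul hs).mul hch)
  have hX : ContDiff ℝ ∞ (sliceX α θ φ) := contDiff_const.mul huV
  have hY : ContDiff ℝ ∞ (sliceY α θ φ) :=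
    contDiff_const.mul ((contDiff_const.mul (contDiff_const.mul hvH)).sub huH)
  rw [funext (catenoidImmersion_eq α θ φ), contDiff_pi]
  intro i
  fin_cases i
  · exact hX
  · exact hy
  · exact hY.sub ((hX.mul hy).mul contDiff_const)

lemma frameCoord_u (h : IsCatenoidDatum α θ φ) (z : ℂ) :
    frameCoord (catenoidImmersion α θ φ z) (pd 1 (catenoidImmersion α θ φ) z)
      = ![uHor α θ φ z, -GDeriv α θ φ z.re, uVer α θ φ z] := by
  rw [(h.hasPD_catenoidImmersion z).pd_one, catenoidImmersion_eq]
  ext i; fin_cases i <;> simp [frameCoord]; ring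

lemma frameCoord_v (h : IsCatenoidDatum α θ φ) (z : ℂ) :
    frameCoord (catenoidImmersion α θ φ z) (pd Complex.I (catenoidImmersion α θ φ) z)
      = ![vHor α θ φ z, Cst α θ, vVer α θ φ z] := by
  rw [(h.hasPD_catenoidImmersion z).pd_I, catenoidImmersion_eq]
  ext i; fin_cases i <;> simp [frameCoord]; ring

lemma speed_pos (h : IsCatenoidDatum α θ φ) (u : ℝ) : 0 < GDeriv α θ φ u ^ 2 + Cst α θ ^ 2 := by
  have := h.Cst_pos
  positivity

lemma tension_catenoidImmersion (h : IsCatenoidDatum α θ φ) (z : ℂ) :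
    tension (catenoidImmersion α θ φ) z = 0 := by
  have hX := h.hasPD_catenoidImmersion
  have hu := HasPD.vec3 (h.hasPD_uHor z) (h.hasPD_GDeriv z).neg
    ((h.hasPD_uVer z).sub ((((h.hasPD_depth z).mul (h.hasPD_uHor z)).add
      ((h.hasPD_GDeriv z).mul (h.hasPD_sliceX z))).mul (HasPD.const (1 / 2) z)))
  have hv := HasPD.vec3 (h.hasPD_vHor z) (HasPD.const (Cst α θ) z)
    ((h.hasPD_vVer z).sub ((((h.hasPD_depth z).mul (h.hasPD_vHor z)).sub
      ((h.hasPD_sliceX z).const_mul (Cst α θ))).mul (HasPD.const (1 / 2) z)))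
  rw [← funext fun z => (hX z).pd_one] at hu
  rw [← funext fun z => (hX z).pd_I] at hv
  have hs := Real.sin_sq_add_cos_sq (φ z.re)
  have hch := Real.cosh_sq_sub_sinh_sq (AFun α θ φ z)
  ext k
  simp only [tension, Pi.add_apply, covDeriv_self, (hX z).pd_one, (hX z).pd_I, hu.pd_one, hv.pd_I,
    catenoidImmersion_eq, Pi.zero_apply]
  fin_cases k
  · simp
    rw [uHor, vHor, uVer, vVer]
    ring
  · simp
    rw [uHor, vHor, uVer, vVer]
    linear_combination (Real.cos (φ z.re) * Real.sin (φ z.re)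
      * (GDeriv α θ φ z.re ^ 2 + Cst α θ ^ 2)) * hch
  · simp
    rw [uHor, vHor, uVer, vVer]
    linear_combination (sliceX α θ φ z / 2 * Real.cos (φ z.re) * Real.sin (φ z.re)
      * (GDeriv α θ φ z.re ^ 2 + Cst α θ ^ 2)) * hch

lemma isConformalHarmonicAt (h : IsCatenoidDatum α θ φ) (z : ℂ) :
    IsConformalHarmonicAt (catenoidImmersion α θ φ) z := by
  have hs := Real.sin_sq_add_cos_sq (φ z.re)
  have hch := Real.cosh_sq_sub_sinh_sq (AFun α θ φ z)
  have e11 : firstForm (catenoidImmersion α θ φ) z 1 1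
      = (GDeriv α θ φ z.re ^ 2 + Cst α θ ^ 2) * Real.cosh (AFun α θ φ z) ^ 2 := by
    rw [firstForm, nilInner, h.frameCoord_u]
    simp [dotProduct, Fin.sum_univ_three]
    rw [uHor, uVer]
    linear_combination (GDeriv α θ φ z.re ^ 2 * Real.sinh (AFun α θ φ z) ^ 2
      + Cst α θ ^ 2 * Real.cosh (AFun α θ φ z) ^ 2) * hs - GDeriv α θ φ z.re ^ 2 * hch
  have eII : firstForm (catenoidImmersion α θ φ) z Complex.I Complex.I
      = (GDeriv α θ φ z.re ^ 2 + Cst α θ ^ 2) * Real.cosh (AFun α θ φ z) ^ 2 := by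
    rw [firstForm, nilInner, h.frameCoord_v]
    simp [dotProduct, Fin.sum_univ_three]
    rw [vHor, vVer]
    linear_combination (GDeriv α θ φ z.re ^ 2 * Real.cosh (AFun α θ φ z) ^ 2
      + Cst α θ ^ 2 * Real.sinh (AFun α θ φ z) ^ 2) * hs - Cst α θ ^ 2 * hch
  refine ⟨h.contDiff_catenoidImmersion.contDiffAt, e11.trans eII.symm, ?_, ?_,
    h.tension_catenoidImmersion z⟩
  · rw [firstForm, nilInner, h.frameCoord_u, h.frameCoord_v]
    simp [dotProduct, Fin.sum_univ_three]
    rw [uHor, vHor, uVer, vVer]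
    linear_combination GDeriv α θ φ z.re * Cst α θ
      * ((Real.cosh (AFun α θ φ z) ^ 2 - Real.sinh (AFun α θ φ z) ^ 2) * hs + hch)
  · rw [e11]
    exact (mul_pos (h.speed_pos _) (pow_pos (Real.cosh_pos _) 2)).ne'

end IsCatenoidDatum

/-! ### The Gauss map -/

lemma cos_add_cosh_eq (x y : ℝ) : (Real.cos x : ℂ) + (Real.cosh y : ℂ)
    = 2 * Complex.cos ((x + Complex.I * y) / 2)
      * Complex.cos (conj (((x : ℂ) + Complex.I * y) / 2)) := by
  set t : ℂ := (x + Complex.I * y) / 2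
  have ht : conj t = (x - Complex.I * y) / 2 := by
    simp only [t, map_div₀, map_add, map_mul, Complex.conj_ofReal, Complex.conj_I, map_ofNat]
    ring
  have hx : t + conj t = x := by rw [ht]; simp only [t]; ring
  have hy : t - conj t = y * Complex.I := by rw [ht]; simp only [t]; ring
  push_cast
  rw [← hx, ← Complex.cos_mul_I, ← hy, Complex.cos_add, Complex.cos_sub]
  ring

/-- The complex tangent of a half angle, as the quotient that defines the Gauss map. The formula
also holds, with both sides `0`, where the denominators vanish. -/
lemma tan_half_eq (x y : ℝ) :
    ((Real.sin x : ℂ) + Complex.I * (Real.sinh y : ℂ)) / ((Real.cos x : ℂ) + (Real.cosh y : ℂ))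
      = Complex.tan ((x + Complex.I * y) / 2) := by
  set t : ℂ := (x + Complex.I * y) / 2
  have ht : conj t = (x - Complex.I * y) / 2 := by
    simp only [t, map_div₀, map_add, map_mul, Complex.conj_ofReal, Complex.conj_I, map_ofNat]
    ring
  have hx : t + conj t = x := by rw [ht]; simp only [t]; ring
  have hy : t - conj t = y * Complex.I := by rw [ht]; simp only [t]; ring
  have h1 : (Real.sin x : ℂ) + Complex.I * (Real.sinh y : ℂ)
      = 2 * Complex.sin t * Complex.cos (conj t) := by
    push_cast
    rw [← hx, mul_comm Complex.I, ← Complex.sin_mul_I, ← hy, Complex.sin_add, Complex.sin_sub]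
    ring
  have h2 : (Real.cos x : ℂ) + (Real.cosh y : ℂ)
      = 2 * Complex.cos t * Complex.cos (conj t) := cos_add_cosh_eq x y
  rw [h1, h2, Complex.tan_eq_sin_div_cos]
  rcases eq_or_ne (Complex.cos t) 0 with h0 | h0
  · simp [h0]
  · have : Complex.cos (conj t) ≠ 0 := by
      rw [Complex.cos_conj]
      exact (map_ne_zero _).2 h0
    field_simp

/-- The map `tan (W / 2)` is harmonic for the metric of the sphere with opposite signs on the two
hemispheres as soon as `W` satisfies `sin(Re W) q + cos(Re W) W_uu = 0`, where
`q = W_u² - α²` and `W_v = iα`. -/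
lemma harmonicEquationAt_tan {W a : ℂ → ℂ} {α : ℝ} {a' : ℂ} {z : ℂ} {x : ℝ}
    (hW : ∀ z, HasPD W (a z) (Complex.I * α) z) (ha : HasPD a a' 0 z) (hsm : ContDiff ℝ ∞ W)
    (hcos : Complex.cos (W z / 2) ≠ 0) (hx : W z + conj (W z) = 2 * x)
    (heq : (Real.sin x : ℂ) * (a z ^ 2 - α ^ 2) + Real.cos x * a' = 0) :
    HarmonicEquationAt (fun w => Complex.tan (W w / 2)) z := by
  have hcontW : Continuous W := hsm.continuous
  have hne : ∀ᶠ w in nhds z, Complex.cos (W w / 2) ≠ 0 :=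
    ((Complex.continuous_cos.comp (hcontW.div_const 2)).continuousAt).eventually_ne hcos
  have htan (w : ℂ) (hw : Complex.cos (W w / 2) ≠ 0) :
      HasPD (fun w => Complex.tan (W w / 2)) (1 / (2 * Complex.cos (W w / 2) ^ 2) * a w)
        (1 / (2 * Complex.cos (W w / 2) ^ 2) * (Complex.I * α)) w := by
    have h1 : HasDerivAt (fun x : ℂ => Complex.tan (x / 2)) (1 / (2 * Complex.cos (W w / 2) ^ 2))
        (W w) := by
      have := (Complex.hasDerivAt_tan hw).comp (W w) ((hasDerivAt_id (W w)).div_const 2)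
      refine this.congr_deriv ?_
      field_simp
    exact (hW w).comp_holomorphic h1
  have hg' : HasDerivAt (fun x : ℂ => 1 / (2 * Complex.cos (x / 2) ^ 2))
      (Complex.sin (W z / 2) / (2 * Complex.cos (W z / 2) ^ 3)) (W z) := by
    have h0 : HasDerivAt (fun x : ℂ => Complex.cos (x / 2)) (-Complex.sin (W z / 2) * (1 / 2))
        (W z) := ((hasDerivAt_id (W z)).div_const 2).ccos
    have := ((h0.pow 2).const_mul 2).inv (mul_ne_zero two_ne_zero (pow_ne_zero 2 hcos))
    simp only [one_div]
    refine this.congr_deriv ?_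
    simp only [Pi.pow_apply]
    field_simp
    push_cast
    ring
  have hzbar : dzbar (fun w => Complex.tan (W w / 2)) =ᶠ[nhds z]
      fun w => 1 / (2 * Complex.cos (W w / 2) ^ 2) * ((1 / 2) * (a w - α)) := by
    filter_upwards [hne] with w hw
    rw [(htan w hw).dzbar_eq]
    linear_combination (1 / (2 * Complex.cos (W w / 2) ^ 2) * α / 2) * Complex.I_sq
  have h2 := ((hW z).comp_holomorphic hg').mul
    ((ha.sub (HasPD.const (α : ℂ) z)).const_mul (1 / 2 : ℂ))
  have hdzdz : dz (dzbar fun w => Complex.tan (W w / 2)) z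
      = (1 / 4) * (Complex.sin (W z / 2) / (2 * Complex.cos (W z / 2) ^ 3) * (a z ^ 2 - α ^ 2)
        + 1 / (2 * Complex.cos (W z / 2) ^ 2) * a') := by
    have : dz (dzbar fun w => Complex.tan (W w / 2)) z = dz (fun w =>
        1 / (2 * Complex.cos (W w / 2) ^ 2) * ((1 / 2) * (a w - α))) z := by
      rw [dz, dz, pd, pd, pd, pd, hzbar.fderiv_eq]
    rw [this, h2.dz_eq]
    linear_combination (-(Complex.sin (W z / 2) / (2 * Complex.cos (W z / 2) ^ 3)) / 4 * α
      * (a z - α)) * Complex.I_sq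
  refine ⟨?_, ?_⟩
  · have : ContDiffAt ℂ ∞ (fun x : ℂ => Complex.tan (x / 2)) (W z) :=
      (Complex.contDiffAt_tan.2 hcos).comp (W z) (contDiffAt_id.div_const 2)
    exact (this.restrict_scalars ℝ).comp z hsm.contDiffAt
  · rw [hdzdz, (htan z hcos).dz_eq, (htan z hcos).dzbar_eq, ← Complex.mul_conj']
    simp only [Complex.tan_eq_sin_div_cos]
    set t := W z / 2
    have hxt : (x : ℂ) = t + conj t := by
      have : conj t = conj (W z) / 2 := by simp only [t, map_div₀, map_ofNat]
      rw [this]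
      simp only [t]
      linear_combination -hx / 2
    rw [map_div₀, ← Complex.sin_conj, ← Complex.cos_conj]
    have hcos' : Complex.cos (conj t) ≠ 0 := by
      rw [Complex.cos_conj]; exact (map_ne_zero _).2 hcos
    push_cast at heq
    rw [hxt, Complex.sin_add, Complex.cos_add] at heq
    have hs := Complex.sin_sq_add_cos_sq t
    have hz : 1 / (2 * Complex.cos t ^ 2) * a z
        - Complex.I * (1 / (2 * Complex.cos t ^ 2) * (Complex.I * α))
        = (a z + α) / (2 * Complex.cos t ^ 2) := by
      linear_combination (-(1 / (2 * Complex.cos t ^ 2)) * α) * Complex.I_sq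
    have hzb : 1 / (2 * Complex.cos t ^ 2) * a z
        + Complex.I * (1 / (2 * Complex.cos t ^ 2) * (Complex.I * α))
        = (a z - α) / (2 * Complex.cos t ^ 2) := by
      linear_combination (1 / (2 * Complex.cos t ^ 2) * α) * Complex.I_sq
    have key : (Complex.cos t * Complex.cos (conj t) - Complex.sin t * Complex.sin (conj t))
        * (Complex.sin t * (a z ^ 2 - α ^ 2) + Complex.cos t * a')
        + Complex.sin (conj t) * (a z ^ 2 - α ^ 2) = 0 := by
      linear_combination Complex.cos t * heq - Complex.sin (conj t) * (a z ^ 2 - α ^ 2) * hs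
    rw [hz, hzb]
    have e : ∀ σ κ σ' κ' A B : ℂ, κ ≠ 0 → κ' ≠ 0 →
        (1 - σ / κ * (σ' / κ')) * (1 / 4 * (σ / (2 * κ ^ 3) * (A ^ 2 - α ^ 2) + 1 / (2 * κ ^ 2) * B))
          + 2 * (σ' / κ') * ((A + α) / (2 * κ ^ 2) / 2) * ((A - α) / (2 * κ ^ 2) / 2)
        = ((κ * κ' - σ * σ') * (σ * (A ^ 2 - α ^ 2) + κ * B) + σ' * (A ^ 2 - α ^ 2))
          / (8 * κ ^ 4 * κ') := by
      intro σ κ σ' κ' A B h1 h2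
      field_simp
      ring
    rw [e _ _ _ _ _ _ hcos hcos', key, zero_div]

namespace IsCatenoidDatum

variable {α θ : ℝ} {φ : ℝ → ℝ}

lemma normalVector_eq (h : IsCatenoidDatum α θ φ) (z : ℂ) :
    normalVector (catenoidImmersion α θ φ) z
      = ((GDeriv α θ φ z.re ^ 2 + Cst α θ ^ 2) * Real.cosh (AFun α θ φ z)) •
        ![Real.sin (φ z.re), Real.sinh (AFun α θ φ z), Real.cos (φ z.re)] := by
  have hs := Real.sin_sq_add_cos_sq (φ z.re)
  rw [normalVector, h.frameCoord_u, h.frameCoord_v, cross_apply]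
  ext i
  fin_cases i
  · simp [uVer, vVer]
    ring
  · simp [uVer, vVer, uHor, vHor]
    linear_combination (GDeriv α θ φ z.re ^ 2 + Cst α θ ^ 2) * Real.cosh (AFun α θ φ z)
      * Real.sinh (AFun α θ φ z) * hs
  · simp [uHor, vHor]
    ring

lemma unitNormal_eq (h : IsCatenoidDatum α θ φ) (z : ℂ) :
    unitNormal (catenoidImmersion α θ φ) z = (Real.cosh (AFun α θ φ z))⁻¹ •
        ![Real.sin (φ z.re), Real.sinh (AFun α θ φ z), Real.cos (φ z.re)] := by
  have hs := Real.sin_sq_add_cos_sq (φ z.re)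
  have hch := Real.cosh_sq_sub_sinh_sq (AFun α θ φ z)
  have hc := Real.cosh_pos (AFun α θ φ z)
  have hS := h.speed_pos z.re
  rw [unitNormal, h.normalVector_eq]
  set S := GDeriv α θ φ z.re ^ 2 + Cst α θ ^ 2
  set n : Fin 3 → ℝ := ![Real.sin (φ z.re), Real.sinh (AFun α θ φ z), Real.cos (φ z.re)]
  have hn : n ⬝ᵥ n = Real.cosh (AFun α θ φ z) ^ 2 := by
    simp [n, dotProduct, Fin.sum_univ_three]
    linear_combination hs - hch
  rw [smul_dotProduct, dotProduct_smul, hn, smul_eq_mul, smul_eq_mul,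
    show S * Real.cosh (AFun α θ φ z) * (S * Real.cosh (AFun α θ φ z)
      * Real.cosh (AFun α θ φ z) ^ 2) = (S * Real.cosh (AFun α θ φ z) ^ 2) ^ 2 by ring,
    Real.sqrt_sq (by positivity), smul_smul]
  congr 1
  field_simp

theorem gaussMap_eq (h : IsCatenoidDatum α θ φ) :
    gaussMap (catenoidImmersion α θ φ) = catenoidGauss α θ φ := by
  funext z
  have hc := Real.cosh_pos (AFun α θ φ z)
  rw [gaussMap, catenoidGauss, h.unitNormal_eq]
  have hiff : ((Real.cosh (AFun α θ φ z))⁻¹ • ![Real.sin (φ z.re), Real.sinh (AFun α θ φ z),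
      Real.cos (φ z.re)]) 2 = -1 ↔ Real.cos (φ z.re) + Real.cosh (AFun α θ φ z) = 0 := by
    simp
    rw [inv_mul_eq_iff_eq_mul₀ hc.ne']
    constructor <;> intro h <;> linarith
  simp only [hiff]
  split_ifs with h0
  · rfl
  · congr 1
    have h1 : (Real.cosh (AFun α θ φ z) : ℂ) ≠ 0 := by exact_mod_cast hc.ne'
    have h2 : (Real.cos (φ z.re) : ℂ) + (Real.cosh (AFun α θ φ z) : ℂ) ≠ 0 := by exact_mod_cast h0
    have h3 : 1 + (Real.cosh (AFun α θ φ z) : ℂ)⁻¹ * (Real.cos (φ z.re) : ℂ)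
      = ((Real.cos (φ z.re) : ℂ) + (Real.cosh (AFun α θ φ z) : ℂ))
        / (Real.cosh (AFun α θ φ z) : ℂ) := by field_simp; ring
    simp only [Pi.smul_apply, smul_eq_mul, Matrix.cons_val, Complex.ofReal_mul, Complex.ofReal_inv]
    rw [h3]
    field_simp

/-- The complex angle `W = φ + iA`, for which the Gauss map is `tan (W / 2)`. -/
noncomputable def _root_.NilCatenoid.complexAngle (α θ : ℝ) (φ : ℝ → ℝ) (z : ℂ) : ℂ :=
  φ z.re + Complex.I * AFun α θ φ z

lemma hasPD_complexAngle (h : IsCatenoidDatum α θ φ) (z : ℂ) :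
    HasPD (complexAngle α θ φ)
      (deriv φ z.re + Complex.I * (Cst α θ * Real.cos (φ z.re) ^ 2 : ℝ)) (Complex.I * α) z := by
  have := (HasPD.comp_re (z := z) (h.hasDerivAt_phase z.re)).ofReal.add
    ((h.hasPD_AFun z).ofReal.const_mul Complex.I)
  refine this.congr ?_ ?_ <;> simp

lemma contDiff_complexAngle (h : IsCatenoidDatum α θ φ) :
    ContDiff ℝ ∞ (complexAngle α θ φ) := by
  have hA : ContDiff ℝ ∞ (AFun α θ φ) :=
    (contDiff_const.mul Complex.imCLM.contDiff).add
      (h.contDiff_betaFun.comp Complex.reCLM.contDiff)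
  exact (Complex.ofRealCLM.contDiff.comp (h.contDiff_phase.comp Complex.reCLM.contDiff)).add
    (contDiff_const.mul (Complex.ofRealCLM.contDiff.comp hA))

end IsCatenoidDatum

lemma coordZero_catenoidGauss (α θ : ℝ) (φ : ℝ → ℝ) (z : ℂ) :
    coordZero (catenoidGauss α θ φ z) = Complex.tan (complexAngle α θ φ z / 2) := by
  rw [complexAngle, ← tan_half_eq, catenoidGauss]
  split_ifs with h0
  · have : (Real.cos (φ z.re) : ℂ) + (Real.cosh (AFun α θ φ z) : ℂ) = 0 := by exact_mod_cast h0
    rw [this, div_zero]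
    rfl
  · rfl

lemma coordInfty_catenoidGauss (α θ : ℝ) (φ : ℝ → ℝ) (z : ℂ) :
    coordInfty (catenoidGauss α θ φ z)
      = Complex.tan ((Real.pi - complexAngle α θ φ z) / 2) := by
  have e : Complex.tan ((Real.pi - complexAngle α θ φ z) / 2)
      = (Complex.tan (complexAngle α θ φ z / 2))⁻¹ := by
    rw [sub_div, Complex.tan_eq_sin_div_cos, Complex.tan_eq_sin_div_cos,
      Complex.sin_pi_div_two_sub, Complex.cos_pi_div_two_sub, inv_div]
  rw [e, ← coordZero_catenoidGauss, catenoidGauss]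
  split_ifs with h0
  · exact inv_zero.symm
  · rfl

/-- Both coordinates of the Gauss map are of the form `tan (W / 2)`: the coordinate `1/w` is obtained
by replacing `W` with `π - W`, hence `α` with `-α`. -/
lemma IsCatenoidDatum.isHarmonicGauss {α θ : ℝ} {φ : ℝ → ℝ} (h : IsCatenoidDatum α θ φ) :
    IsHarmonicGauss (catenoidGauss α θ φ) := by
  intro z
  have hre : complexAngle α θ φ z + conj (complexAngle α θ φ z) = 2 * (φ z.re : ℂ) := by
    simp only [complexAngle, map_add, map_mul, Complex.conj_ofReal, Complex.conj_I]
    ring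
  have ha : HasPD (fun w : ℂ => ((deriv φ w.re : ℝ) : ℂ)
      + Complex.I * (Cst α θ * Real.cos (φ w.re) ^ 2 : ℝ))
      ((-(Real.cos (2 * θ) * Real.cos (φ z.re) - 2 * Cst α θ ^ 2 * Real.cos (φ z.re) ^ 3)
        * Real.sin (φ z.re) : ℝ) - Complex.I * (2 * Cst α θ * Real.cos (φ z.re)
        * Real.sin (φ z.re) * deriv φ z.re : ℝ)) 0 z := by
    have := (HasPD.comp_re (z := z) (h.hasDerivAt_deriv z.re)).ofReal.add
      ((((h.hasPD_cos z).mul (h.hasPD_cos z)).const_mul (Cst α θ)).ofReal.const_mul Complex.I)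
    simp only [← pow_two] at this
    refine this.congr ?_ ?_
    · push_cast; ring
    · simp
  have hsq : ((deriv φ z.re : ℝ) : ℂ) ^ 2 = α ^ 2 + Real.cos (2 * θ) * Real.cos (φ z.re) ^ 2
      - Cst α θ ^ 2 * Real.cos (φ z.re) ^ 4 := by
    have := h.deriv_sq z.re
    exact_mod_cast this
  constructor
  · intro hz
    simp only [coordZero_catenoidGauss]
    refine harmonicEquationAt_tan (x := φ z.re) h.hasPD_complexAngle ha h.contDiff_complexAngle
      ?_ hre ?_
    · intro h0
      apply hz
      have : Real.cos (φ z.re) + Real.cosh (AFun α θ φ z) = 0 := by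
        have := cos_add_cosh_eq (φ z.re) (AFun α θ φ z)
        rw [complexAngle] at h0
        rw [h0, mul_zero, zero_mul] at this
        exact_mod_cast this
      rw [catenoidGauss, if_pos this]
    · push_cast
      push_cast at hsq
      linear_combination Complex.sin (φ z.re) * hsq
        + Complex.sin (φ z.re) * Cst α θ ^ 2 * Complex.cos (φ z.re) ^ 4 * Complex.I_sq
  · intro hz
    simp only [coordInfty_catenoidGauss]
    refine harmonicEquationAt_tan (x := Real.pi - φ z.re) (α := -α)
      (fun w => ((HasPD.const (Real.pi : ℂ) w).sub (h.hasPD_complexAngle w)).congr rfl ?_)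
      ((HasPD.const (0 : ℂ) z).sub ha |>.congr rfl ?_)
      (contDiff_const.sub h.contDiff_complexAngle) ?_ ?_ ?_
    · push_cast; ring
    · simp
    · intro h0
      apply hz
      rw [sub_div, Complex.cos_pi_div_two_sub] at h0
      have hcos : Complex.cos (complexAngle α θ φ z / 2) ≠ 0 := by
        intro h1
        have := Complex.sin_sq_add_cos_sq (complexAngle α θ φ z / 2)
        simp [h0, h1] at this
      have hne : Real.cos (φ z.re) + Real.cosh (AFun α θ φ z) ≠ 0 := by
        have := cos_add_cosh_eq (φ z.re) (AFun α θ φ z)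
        intro h1
        rw [← Complex.ofReal_add, h1, Complex.cos_conj] at this
        rw [complexAngle] at hcos
        simp [hcos] at this
      have := coordZero_catenoidGauss α θ φ z
      rw [Complex.tan_eq_sin_div_cos, h0, zero_div] at this
      rw [catenoidGauss, if_neg hne] at this ⊢
      exact congrArg _ this
    · rw [map_sub, Complex.conj_ofReal]
      push_cast
      linear_combination -hre
    · rw [Real.sin_pi_sub, Real.cos_pi_sub]
      push_cast
      push_cast at hsq
      linear_combination Complex.sin (φ z.re) * hsq
        + Complex.sin (φ z.re) * Cst α θ ^ 2 * Complex.cos (φ z.re) ^ 4 * Complex.I_sq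

/-! ### The Weierstrass equations -/

/-- The partial derivatives of the Gauss map, in terms of
`tan' = (1 + cos φ cosh A + i sin φ sinh A) / (cos φ + cosh A)²`. -/
lemma IsCatenoidDatum.hasPD_coordZero_catenoidGauss {α θ : ℝ} {φ : ℝ → ℝ}
    (h : IsCatenoidDatum α θ φ) {z : ℂ}
    (hz : Real.cos (φ z.re) + Real.cosh (AFun α θ φ z) ≠ 0) :
    let m : ℂ := (1 + Real.cos (φ z.re) * Real.cosh (AFun α θ φ z)
      + Complex.I * (Real.sin (φ z.re) * Real.sinh (AFun α θ φ z)))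
        / (Real.cos (φ z.re) + Real.cosh (AFun α θ φ z)) ^ 2
    HasPD (fun w => coordZero (catenoidGauss α θ φ w))
      (m * (deriv φ z.re + Complex.I * (Cst α θ * Real.cos (φ z.re) ^ 2 : ℝ)))
      (m * (Complex.I * α)) z := by
  intro m
  set t := complexAngle α θ φ z / 2 with ht
  have hcc : (Real.cos (φ z.re) : ℂ) + (Real.cosh (AFun α θ φ z) : ℂ)
      = 2 * Complex.cos t * Complex.cos (conj t) := cos_add_cosh_eq _ _
  have hz' : (Real.cos (φ z.re) : ℂ) + (Real.cosh (AFun α θ φ z) : ℂ) ≠ 0 := by exact_mod_cast hz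
  have hcos : Complex.cos t ≠ 0 := by
    intro h0; rw [h0, mul_zero, zero_mul] at hcc; exact hz' hcc
  have hcos' : Complex.cos (conj t) ≠ 0 := by
    intro h0; rw [h0, mul_zero] at hcc; exact hz' hcc
  have h1 : HasDerivAt (fun x : ℂ => Complex.tan (x / 2)) (1 / (2 * Complex.cos t ^ 2))
      (complexAngle α θ φ z) := by
    have := (Complex.hasDerivAt_tan hcos).comp (complexAngle α θ φ z)
      ((hasDerivAt_id (complexAngle α θ φ z)).div_const 2)
    refine this.congr_deriv ?_
    field_simp
  have hm : m = 1 / (2 * Complex.cos t ^ 2) := by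
    have hconj : 2 * conj t = φ z.re - AFun α θ φ z * Complex.I := by
      simp only [ht, complexAngle, map_div₀, map_add, map_mul, Complex.conj_ofReal, Complex.conj_I,
        map_ofNat]
      ring
    have hnum : 1 + (Real.cos (φ z.re) : ℂ) * Real.cosh (AFun α θ φ z)
      + Complex.I * (Real.sin (φ z.re) * Real.sinh (AFun α θ φ z))
        = 2 * Complex.cos (conj t) ^ 2 := by
      have := Complex.cos_two_mul (conj t)
      rw [hconj, Complex.cos_sub, Complex.cos_mul_I, Complex.sin_mul_I] at this
      push_cast
      linear_combination this
    simp only [m]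
    rw [hnum, hcc]
    field_simp
  have := (h.hasPD_complexAngle z).comp_holomorphic h1
  rw [funext (coordZero_catenoidGauss α θ φ), hm]
  exact this

theorem IsCatenoidDatum.weierstrassEquations {α θ : ℝ} {φ : ℝ → ℝ}
    (h : IsCatenoidDatum α θ φ) :
    WeierstrassEquations (catenoidGauss α θ φ) (catenoidImmersion α θ φ) := by
  intro z hz hz1
  have h0 : Real.cos (φ z.re) + Real.cosh (AFun α θ φ z) ≠ 0 := by
    intro h0; exact hz (by rw [catenoidGauss, if_pos h0])
  have hγ := h.hasPD_coordZero_catenoidGauss h0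
  have hX := h.hasPD_catenoidImmersion z
  have hF : HasPD (horProj (catenoidImmersion α θ φ)) _ _ z :=
    (hX.apply 0).ofReal.add ((hX.apply 1).ofReal.const_mul Complex.I)
  have hh : HasPD (height (catenoidImmersion α θ φ)) _ _ z := (hX.apply 2).ofReal
  intro γ F Fbar γbar
  have hFz : F z = sliceX α θ φ z + Complex.I * depth α θ φ z := by
    simp only [F, horProj, catenoidImmersion_eq, Matrix.cons_val]
  have hγz : γ z = ((Real.sin (φ z.re) : ℂ) + Complex.I * (Real.sinh (AFun α θ φ z) : ℂ)) /
      ((Real.cos (φ z.re) : ℂ) + (Real.cosh (AFun α θ φ z) : ℂ)) := by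
    simp only [γ]
    rw [catenoidGauss, if_neg h0]
    rfl
  have h0' : (Real.cos (φ z.re) : ℂ) + (Real.cosh (AFun α θ φ z) : ℂ) ≠ 0 := by exact_mod_cast h0
  have hs : (Real.sin (φ z.re) : ℂ) ^ 2 + (Real.cos (φ z.re) : ℂ) ^ 2 = 1 := by
    exact_mod_cast Real.sin_sq_add_cos_sq (φ z.re)
  have hch : (Real.cosh (AFun α θ φ z) : ℂ) ^ 2 - (Real.sinh (AFun α θ φ z) : ℂ) ^ 2 = 1 := by
    exact_mod_cast Real.cosh_sq_sub_sinh_sq (AFun α θ φ z)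
  have he : (GDeriv α θ φ z.re : ℂ) * (Real.cos (φ z.re) : ℂ) ^ 2
      = α + ((deriv φ z.re : ℝ) : ℂ) := by
    exact_mod_cast h.GDeriv_mul_cos_sq z.re
  have hI := Complex.I_sq
  have hcγ : conj (γ z) = ((Real.sin (φ z.re) : ℂ) - Complex.I * (Real.sinh (AFun α θ φ z) : ℂ)) /
      ((Real.cos (φ z.re) : ℂ) + (Real.cosh (AFun α θ φ z) : ℂ)) := by
    rw [hγz]
    simp only [map_div₀, map_add, map_mul, Complex.conj_ofReal, Complex.conj_I]
    ring
  have hnorm : 1 - (‖γ z‖ : ℂ) ^ 2 = 2 * (Real.cos (φ z.re) : ℂ) /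
      ((Real.cos (φ z.re) : ℂ) + (Real.cosh (AFun α θ φ z) : ℂ)) := by
    rw [← Complex.mul_conj', hcγ, hγz]
    field_simp
    linear_combination -hs + hch + (Real.sinh (AFun α θ φ z) : ℂ) ^ 2 * hI
  have hc : (Real.cos (φ z.re) : ℂ) ≠ 0 := by
    intro hc
    rw [hc, mul_zero, zero_div, sub_eq_zero] at hnorm
    apply hz1
    have : (1 : ℝ) = ‖γ z‖ ^ 2 := by exact_mod_cast hnorm
    nlinarith [norm_nonneg (γ z)]
  have hdγ := hγ.dz_eq
  have hdγbar : dzbar γbar z = conj (dz γ z) := by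
    have h1 : HasPD γbar _ _ z := hγ.conj
    have h2 : HasPD γ _ _ z := hγ
    rw [h1.dzbar_eq, h2.dz_eq]
    simp only [map_div₀, map_sub, map_mul, Complex.conj_I, map_ofNat]
    ring
  have hdFbar : dz Fbar z = conj (dzbar F z) := by
    have h1 : HasPD Fbar _ _ z := hF.conj
    have h2 : HasPD F _ _ z := hF
    rw [h1.dz_eq, h2.dzbar_eq]
    simp only [map_div₀, map_add, map_mul, Complex.conj_I, map_ofNat]
    ring
  have hdF : dz F z = _ := hF.dz_eq
  have hdbF : dzbar F z = _ := hF.dzbar_eq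
  have hdh : dz (height (catenoidImmersion α θ φ)) z = _ := hh.dz_eq
  have hdγ : dz γ z = _ := hγ.dz_eq
  simp only [Matrix.cons_val] at hdF hdbF hdh
  set s : ℂ := (Real.sin (φ z.re) : ℂ)
  set c : ℂ := (Real.cos (φ z.re) : ℂ)
  set sh : ℂ := (Real.sinh (AFun α θ φ z) : ℂ)
  set ch : ℂ := (Real.cosh (AFun α θ φ z) : ℂ)
  set p : ℂ := (GDeriv α θ φ z.re : ℂ)
  set C : ℂ := (Cst α θ : ℂ)
  have hq : dz γ z / (1 - (‖γ z‖ : ℂ) ^ 2) ^ 2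
      = (1 + c * ch + Complex.I * (s * sh)) * (p + Complex.I * C) / 8 := by
    have hD : ((deriv φ z.re : ℝ) : ℂ) = p * c ^ 2 - α := by rw [he]; ring
    have hCc : ((Cst α θ * Real.cos (φ z.re) ^ 2 : ℝ) : ℂ) = C * c ^ 2 := by
      rw [Complex.ofReal_mul, Complex.ofReal_pow]
    have hdγ' : dz γ z = (1 + c * ch + Complex.I * (s * sh)) / (c + ch) ^ 2
        * (c ^ 2 * (p + Complex.I * C)) / 2 := by
      rw [hdγ, hD, hCc]
      linear_combination (-((1 + c * ch + Complex.I * (s * sh)) / (c + ch) ^ 2) * α / 2) * hI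
    rw [hnorm, hdγ']
    field_simp
    norm_num
  have hqbar : dzbar γbar z / (1 - (‖γ z‖ : ℂ) ^ 2) ^ 2
      = (1 + c * ch - Complex.I * (s * sh)) * (p - Complex.I * C) / 8 := by
    have := congrArg conj hq
    simp only [map_div₀, map_add, map_sub, map_mul, map_pow, map_one, Complex.conj_ofReal,
      Complex.conj_I, map_ofNat, s, c, sh, ch, p, C] at this
    rw [hdγbar, this]
    ring
  have hγN : conj (γ z) * (1 + c * ch + Complex.I * (s * sh)) = s * ch - Complex.I * (c * sh) := by
    rw [hcγ, div_mul_eq_mul_div, div_eq_iff h0']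
    linear_combination -s * hch - s * sh ^ 2 * hI + Complex.I * sh * hs
  have hγ2 : γ z ^ 2 * (1 + c * ch - Complex.I * (s * sh)) = 1 - c * ch + Complex.I * (s * sh) := by
    have h1 : (s + Complex.I * sh) * (1 + c * ch - Complex.I * (s * sh))
        = (s * ch + Complex.I * (c * sh)) * (c + ch) := by
      linear_combination -s * hch - s * sh ^ 2 * hI - Complex.I * sh * hs
    have h2 : (s + Complex.I * sh) * (s * ch + Complex.I * (c * sh))
        = (1 - c * ch + Complex.I * (s * sh)) * (c + ch) := by
      linear_combination ch * hs + c * hch + c * sh ^ 2 * hI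
    rw [hγz, div_pow, div_mul_eq_mul_div, div_eq_iff (pow_ne_zero 2 h0')]
    linear_combination (s + Complex.I * sh) * h1 + (c + ch) * h2
  have huH : (uHor α θ φ z : ℂ) = p * s * sh + C * c * ch := by
    simp only [uHor, Complex.ofReal_add, Complex.ofReal_mul]; rfl
  have hvH : (vHor α θ φ z : ℂ) = p * c * ch - C * s * sh := by
    simp only [vHor, Complex.ofReal_sub, Complex.ofReal_mul]; rfl
  have huV : (uVer α θ φ z : ℂ) = p * c * sh - C * s * ch := by
    simp only [uVer, Complex.ofReal_sub, Complex.ofReal_mul]; rfl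
  have hvV : (vVer α θ φ z : ℂ) = -(p * s * ch) - C * c * sh := by
    simp only [vVer, Complex.ofReal_sub, Complex.ofReal_neg, Complex.ofReal_mul]; rfl
  refine ⟨?_, ?_, ?_⟩
  · rw [mul_div_assoc, hq, hdF, huH, hvH, Complex.ofReal_neg]
    linear_combination (1 / 2) * (p * s * sh + C * c * ch + Complex.I * C * s * sh) * hI
  · rw [mul_div_assoc, hqbar, hdbF, huH, hvH, Complex.ofReal_neg]
    linear_combination (1 / 2) * (p * s * sh + C * c * ch - Complex.I * C * s * sh) * hI
      + (Complex.I / 2) * (p - Complex.I * C) * hγ2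
  · rw [mul_div_assoc, hq, hdFbar, hdF, hdbF, hdh, hFz]
    simp only [map_div₀, map_add, map_mul, Complex.conj_ofReal, Complex.conj_I, map_ofNat,
      Complex.ofReal_neg, Complex.ofReal_sub, Complex.ofReal_add, Complex.ofReal_mul, map_neg, C,
      Complex.ofReal_div, Complex.ofReal_one, Complex.ofReal_ofNat]
    rw [huH, hvH, huV, hvV]
    linear_combination ((1 / 2) * (p * c * sh - C * s * ch + Complex.I * C * c * sh)
      - (1 / 4) * (depth α θ φ z * (p * s * sh + C * c * ch) + p * sliceX α θ φ z)
      + (Complex.I / 4) * (depth α θ φ z * (p * c * ch - C * s * sh) - C * sliceX α θ φ z)) * hI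
      - (Complex.I / 2) * (p + Complex.I * C) * hγN

/-! ### Periods and symmetries of the immersion -/

/-- Half of the period of the immersion; the translation by it induces the rotation around the
`x₂`-axis. -/
noncomputable def halfPeriodVector (α θ : ℝ) (φ : ℝ → ℝ) : ℂ :=
  ⟨halfPeriod α θ, -betaFun α θ φ (halfPeriod α θ) / α⟩

namespace IsCatenoidDatum

variable {α θ : ℝ} {φ : ℝ → ℝ}

lemma AFun_add (h : IsCatenoidDatum α θ φ) (z : ℂ) :
    AFun α θ φ (z + halfPeriodVector α θ φ) = AFun α θ φ z := by
  have := h.alpha_pos.ne'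
  simp only [AFun, halfPeriodVector, Complex.add_re, Complex.add_im, h.betaFun_add]
  field_simp
  ring

lemma depth_add (h : IsCatenoidDatum α θ φ) (z : ℂ) :
    depth α θ φ (z + halfPeriodVector α θ φ) = depth α θ φ z := by
  have := h.alpha_pos.ne'
  have hp := h.period_closes
  simp only [depth, halfPeriodVector, Complex.add_re, Complex.add_im, h.GFun_add]
  field_simp
  linear_combination -hp

lemma catenoidImmersion_add (h : IsCatenoidDatum α θ φ) (z : ℂ) :
    catenoidImmersion α θ φ (z + halfPeriodVector α θ φ)
      = rotX2 (catenoidImmersion α θ φ z) := by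
  have hre : (z + halfPeriodVector α θ φ).re = z.re + halfPeriod α θ := rfl
  have h1 : uHor α θ φ (z + halfPeriodVector α θ φ) = -uHor α θ φ z := by
    simp only [uHor, h.AFun_add, hre, h.phase_add, h.GDeriv_add, Real.sin_sub_pi, Real.cos_sub_pi]
    ring
  have h2 : vHor α θ φ (z + halfPeriodVector α θ φ) = -vHor α θ φ z := by
    simp only [vHor, h.AFun_add, hre, h.phase_add, h.GDeriv_add, Real.sin_sub_pi, Real.cos_sub_pi]
    ring
  have h3 : uVer α θ φ (z + halfPeriodVector α θ φ) = -uVer α θ φ z := by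
    simp only [uVer, h.AFun_add, hre, h.phase_add, h.GDeriv_add, Real.sin_sub_pi, Real.cos_sub_pi]
    ring
  rw [catenoidImmersion_eq, catenoidImmersion_eq]
  ext i
  fin_cases i <;> simp [rotX2, sliceX, sliceY, h1, h2, h3, h.depth_add]; ring

lemma catenoidImmersion_neg (h : IsCatenoidDatum α θ φ) (z : ℂ) :
    catenoidImmersion α θ φ (-z) = rotX3 (catenoidImmersion α θ φ z) := by
  have hA : AFun α θ φ (-z) = -AFun α θ φ z := by
    simp only [AFun, Complex.neg_re, Complex.neg_im, h.betaFun_neg]; ring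
  have hd : depth α θ φ (-z) = -depth α θ φ z := by
    simp only [depth, Complex.neg_re, Complex.neg_im, h.GFun_neg]; ring
  have h1 : uHor α θ φ (-z) = uHor α θ φ z := by
    simp only [uHor, hA, Complex.neg_re, h.phase_neg, h.GDeriv_neg, Real.sin_neg, Real.cos_neg,
      Real.sinh_neg, Real.cosh_neg]
    ring
  have h2 : vHor α θ φ (-z) = vHor α θ φ z := by
    simp only [vHor, hA, Complex.neg_re, h.phase_neg, h.GDeriv_neg, Real.sin_neg, Real.cos_neg,
      Real.sinh_neg, Real.cosh_neg]
    ring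
  have h3 : uVer α θ φ (-z) = -uVer α θ φ z := by
    simp only [uVer, hA, Complex.neg_re, h.phase_neg, h.GDeriv_neg, Real.sin_neg, Real.cos_neg,
      Real.sinh_neg, Real.cosh_neg]
    ring
  rw [catenoidImmersion_eq, catenoidImmersion_eq]
  ext i
  fin_cases i <;> simp [rotX3, sliceX, sliceY, h1, h2, h3, hd]

theorem rotX2_image (h : IsCatenoidDatum α θ φ) :
    rotX2 '' horizontalCatenoid α θ φ = horizontalCatenoid α θ φ := by
  rw [horizontalCatenoid, ← Set.range_comp]
  have : rotX2 ∘ catenoidImmersion α θ φ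
      = catenoidImmersion α θ φ ∘ (· + halfPeriodVector α θ φ) :=
    funext fun z => (h.catenoidImmersion_add z).symm
  rw [this, (add_right_surjective _).range_comp]

theorem rotX3_image (h : IsCatenoidDatum α θ φ) :
    rotX3 '' horizontalCatenoid α θ φ = horizontalCatenoid α θ φ := by
  rw [horizontalCatenoid, ← Set.range_comp]
  have : rotX3 ∘ catenoidImmersion α θ φ = catenoidImmersion α θ φ ∘ (- ·) :=
    funext fun z => (h.catenoidImmersion_neg z).symm
  rw [this, neg_surjective.range_comp]

theorem rotX1_image (h : IsCatenoidDatum α θ φ) :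
    rotX1 '' horizontalCatenoid α θ φ = horizontalCatenoid α θ φ := by
  have : rotX1 = rotX2 ∘ rotX3 := by
    funext p; ext i; fin_cases i <;> simp [rotX1, rotX2, rotX3]
  rw [this, Set.image_comp, h.rotX3_image, h.rotX2_image]

/-- The period of the immersion. -/
noncomputable def _root_.NilCatenoid.periodVector (α θ : ℝ) (φ : ℝ → ℝ) : ℂ :=
  2 * halfPeriodVector α θ φ

lemma periodVector_re : (periodVector α θ φ).re = 2 * halfPeriod α θ := by
  simp [periodVector, halfPeriodVector]

lemma periodVector_ne_zero (h : IsCatenoidDatum α θ φ) : periodVector α θ φ ≠ 0 := by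
  intro h0
  have h1 := periodVector_re (α := α) (θ := θ) (φ := φ)
  rw [h0, Complex.zero_re] at h1
  linarith [h.halfPeriod_pos]

lemma periodic_catenoidImmersion (h : IsCatenoidDatum α θ φ) :
    Function.Periodic (catenoidImmersion α θ φ) (periodVector α θ φ) := by
  intro z
  rw [periodVector, two_mul, ← add_assoc, h.catenoidImmersion_add, h.catenoidImmersion_add]
  ext i
  fin_cases i <;> simp [rotX2]

lemma catenoidImmersion_one (z : ℂ) : catenoidImmersion α θ φ z 1 = depth α θ φ z := by
  rw [catenoidImmersion_eq]; rfl

lemma periodic_depth (h : IsCatenoidDatum α θ φ) :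
    Function.Periodic (depth α θ φ) (periodVector α θ φ) := by
  intro z
  rw [periodVector, two_mul, ← add_assoc, h.depth_add, h.depth_add]

/-- Modulo the period, the part of the surface over a strip `|x₂| ≤ R` is parametrized by a
compact set. -/
lemma exists_isCompact_fundamental (h : IsCatenoidDatum α θ φ) (R : ℝ) :
    ∃ K : Set ℂ, IsCompact K ∧
      ∀ z, |depth α θ φ z| ≤ R → ∃ n : ℤ, z + n * periodVector α θ φ ∈ K := by
  have hC := h.Cst_pos
  let f : ℝ × ℝ → ℂ := fun q => q.1 + ((q.2 + GFun α θ φ q.1) / Cst α θ : ℝ) * Complex.I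
  have hf : Continuous f := by
    have := h.contDiff_GFun.continuous
    fun_prop
  refine ⟨f '' (Set.Icc 0 (2 * halfPeriod α θ) ×ˢ Set.Icc (-R) R),
    (isCompact_Icc.prod isCompact_Icc).image hf, fun z hz => ?_⟩
  have hU : 0 < 2 * halfPeriod α θ := by linarith [h.halfPeriod_pos]
  obtain ⟨n, hn, -⟩ := existsUnique_add_zsmul_mem_Ico hU z.re 0
  have hre : (z + n * periodVector α θ φ).re = z.re + n • (2 * halfPeriod α θ) := by
    rw [Complex.add_re, ← zsmul_eq_mul, Complex.smul_re, periodVector_re]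
  have hd : depth α θ φ (z + n * periodVector α θ φ) = depth α θ φ z :=
    h.periodic_depth.int_mul n z
  refine ⟨n, ((z + n * periodVector α θ φ).re, depth α θ φ z), ⟨⟨?_, ?_⟩, abs_le.1 hz⟩, ?_⟩
  · rw [hre]; exact hn.1
  · rw [hre]; linarith [hn.2]
  · simp only [f]
    rw [← hd, depth, sub_add_cancel, mul_div_cancel_left₀ _ hC.ne']
    exact Complex.re_add_im _

lemma exists_bound_of_depth (h : IsCatenoidDatum α θ φ) (R : ℝ) :
    ∃ B, ∀ p ∈ horizontalCatenoid α θ φ, |p 1| ≤ R → ∀ i, |p i| ≤ B := by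
  obtain ⟨K, hK, hz⟩ := h.exists_isCompact_fundamental R
  obtain ⟨B, hB⟩ := (hK.image h.contDiff_catenoidImmersion.continuous).isBounded.exists_norm_le
  refine ⟨B, ?_⟩
  rintro _ ⟨z, rfl⟩ hp i
  rw [catenoidImmersion_one] at hp
  obtain ⟨n, hn⟩ := hz z hp
  have := hB _ (Set.mem_image_of_mem _ hn)
  rw [h.periodic_catenoidImmersion.int_mul n z] at this
  exact (norm_le_pi_norm _ i).trans this

/-! ### The annulus as a closed embedded surface -/

/-- The parametrization of the catenoid by the punctured plane, through the branch of
`z = Z log w / (2πi)` given by the principal logarithm; it does not depend on the branch. -/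
noncomputable def _root_.NilCatenoid.annulus (α θ : ℝ) (φ : ℝ → ℝ) (w : ℂ) : Nil :=
  catenoidImmersion α θ φ (periodVector α θ φ * Complex.log w / (2 * Real.pi * Complex.I))

lemma annulus_exp (h : IsCatenoidDatum α θ φ) (z : ℂ) :
    annulus α θ φ (Complex.exp (2 * Real.pi * Complex.I * z / periodVector α θ φ))
      = catenoidImmersion α θ φ z := by
  have hZ := h.periodVector_ne_zero
  have h2 := Complex.two_pi_I_ne_zero
  set ζ := 2 * Real.pi * Complex.I * z / periodVector α θ φ with hζ
  obtain ⟨n, hn⟩ := Complex.exp_eq_exp_iff_exists_int.1 (Complex.exp_log (Complex.exp_ne_zero ζ))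
  rw [annulus, hn, ← h.periodic_catenoidImmersion.int_mul n z]
  congr 1
  rw [hζ]
  field_simp

lemma exists_exp_eq (h : IsCatenoidDatum α θ φ) {w : ℂ} (hw : w ≠ 0) :
    ∃ z, Complex.exp (2 * Real.pi * Complex.I * z / periodVector α θ φ) = w := by
  have hZ := h.periodVector_ne_zero
  have h2 := Complex.two_pi_I_ne_zero
  refine ⟨periodVector α θ φ * Complex.log w / (2 * Real.pi * Complex.I), ?_⟩
  rw [← Complex.exp_log hw]
  congr 1
  rw [Complex.exp_log hw]
  field_simp

lemma annulus_image (h : IsCatenoidDatum α θ φ) :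
    annulus α θ φ '' {0}ᶜ = horizontalCatenoid α θ φ := by
  apply Set.Subset.antisymm
  · rintro _ ⟨w, -, rfl⟩
    exact ⟨_, rfl⟩
  · rintro _ ⟨z, rfl⟩
    exact ⟨_, Complex.exp_ne_zero _, h.annulus_exp z⟩

lemma isConformalHarmonicAt_annulus (h : IsCatenoidDatum α θ φ) {w : ℂ} (hw : w ≠ 0) :
    IsConformalHarmonicAt (annulus α θ φ) w := by
  have hZ := h.periodVector_ne_zero
  have h2 := Complex.two_pi_I_ne_zero
  obtain ⟨z, hz⟩ := h.exists_exp_eq hw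
  -- the local inverse of `z ↦ exp (2πiz/Z)` that takes the value `z` at `w`
  let ψ : ℂ → ℂ := fun x => z + periodVector α θ φ / (2 * Real.pi * Complex.I) * Complex.log (x / w)
  have hψw : ψ w = z := by simp [ψ, div_self hw]
  have hsl : w / w ∈ Complex.slitPlane := by rw [div_self hw]; exact Complex.one_mem_slitPlane
  have hd : HasDerivAt ψ (periodVector α θ φ / (2 * Real.pi * Complex.I) * (w⁻¹)) w := by
    have := ((((hasDerivAt_id w).div_const w).clog hsl).const_mul
      (periodVector α θ φ / (2 * Real.pi * Complex.I))).const_add z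
    refine this.congr_deriv ?_
    simp only [id]
    field_simp
  have han : AnalyticAt ℂ ψ w := by
    refine analyticAt_const.add (analyticAt_const.mul ?_)
    exact AnalyticAt.clog (analyticAt_id.div analyticAt_const hw) hsl
  refine (h.isConformalHarmonicAt (ψ w)).comp han ?_ ?_
  · rw [hd.deriv]
    exact mul_ne_zero (div_ne_zero hZ h2) (inv_ne_zero hw)
  · filter_upwards [isOpen_ne.mem_nhds hw] with x hx
    rw [Function.comp_apply, ← h.annulus_exp]
    congr 1
    have : 2 * Real.pi * Complex.I * ψ x / periodVector α θ φ
        = 2 * Real.pi * Complex.I * z / periodVector α θ φ + Complex.log (x / w) := by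
      simp only [ψ]; field_simp
    rw [this, Complex.exp_add, hz, Complex.exp_log (div_ne_zero hx hw), mul_div_cancel₀ _ hw]

lemma isClosedEmbedding_annulus (h : IsCatenoidDatum α θ φ)
    (hinj : ∀ z z', catenoidImmersion α θ φ z = catenoidImmersion α θ φ z' →
      ∃ n : ℤ, z = z' + n * periodVector α θ φ) :
    Topology.IsClosedEmbedding (fun w : ({0}ᶜ : Set ℂ) => annulus α θ φ w) := by
  have hZ := h.periodVector_ne_zero
  have hcont : Continuous (fun w : ({0}ᶜ : Set ℂ) => annulus α θ φ w) := by
    rw [continuous_iff_continuousAt]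
    intro w
    exact (h.isConformalHarmonicAt_annulus w.2).smooth.continuousAt.comp
      continuous_subtype_val.continuousAt
  let e : ℂ → ({0}ᶜ : Set ℂ) := fun z =>
    ⟨Complex.exp (2 * Real.pi * Complex.I * z / periodVector α θ φ), Complex.exp_ne_zero _⟩
  have he : Continuous e := by
    refine Continuous.subtype_mk ?_ _
    fun_prop
  have heper (z : ℂ) (n : ℤ) : e (z + n * periodVector α θ φ) = e z := by
    apply Subtype.ext
    simp only [e]
    rw [Complex.exp_eq_exp_iff_exists_int]
    exact ⟨n, by field_simp⟩
  have hesurj (w : ({0}ᶜ : Set ℂ)) : ∃ z, e z = w := by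
    obtain ⟨z, hz⟩ := h.exists_exp_eq w.2
    exact ⟨z, Subtype.ext hz⟩
  have hval (z : ℂ) : annulus α θ φ (e z) = catenoidImmersion α θ φ z := h.annulus_exp z
  have hproper : IsProperMap (fun w : ({0}ᶜ : Set ℂ) => annulus α θ φ w) := by
    rw [isProperMap_iff_isCompact_preimage]
    refine ⟨hcont, fun S hS => ?_⟩
    obtain ⟨R, hR⟩ := hS.isBounded.exists_norm_le
    obtain ⟨K, hK, hKz⟩ := h.exists_isCompact_fundamental R
    refine (hK.image he).of_isClosed_subset (hS.isClosed.preimage hcont) fun w hw => ?_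
    obtain ⟨z, rfl⟩ := hesurj w
    have h1 : ‖annulus α θ φ (e z) 1‖ ≤ R := (norm_le_pi_norm _ 1).trans (hR _ hw)
    rw [hval, catenoidImmersion_one] at h1
    obtain ⟨n, hn⟩ := hKz z h1
    exact ⟨_, hn, heper z n⟩
  refine Topology.IsClosedEmbedding.of_continuous_injective_isClosedMap hcont ?_
    hproper.isClosedMap
  intro w w' hww
  obtain ⟨z, rfl⟩ := hesurj w
  obtain ⟨z', rfl⟩ := hesurj w'
  simp only [hval] at hww
  obtain ⟨n, rfl⟩ := hinj z z' hww
  exact heper z' n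

end IsCatenoidDatum

/-! ### Closed plane curves with monotone tangent angle -/

/-- In finite dimension the convex hull of a compact set is compact: by Carathéodory's theorem it
is the image of a compact set of weights and points. -/
lemma isCompact_convexHull {E : Type*} [NormedAddCommGroup E] [NormedSpace ℝ E]
    [FiniteDimensional ℝ E] {s : Set E} (hs : IsCompact s) : IsCompact (convexHull ℝ s) := by
  rcases s.eq_empty_or_nonempty with rfl | ⟨x₀, hx₀⟩
  · simp
  let N := Module.finrank ℝ E + 1
  let f : (Fin N → ℝ) × (Fin N → E) → E := fun q => ∑ i, q.1 i • q.2 i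
  have hf : Continuous f := by fun_prop
  have hK : IsCompact ((stdSimplex ℝ (Fin N)) ×ˢ (Set.univ.pi fun _ : Fin N => s)) :=
    (isCompact_stdSimplex ℝ (Fin N)).prod (isCompact_univ_pi fun _ => hs)
  convert hK.image hf using 1
  apply Set.Subset.antisymm
  · intro x hx
    obtain ⟨ι, hι, z, w, hz, hind, hw, hw1, hx⟩ := eq_pos_convex_span_of_mem_convexHull hx
    have hcard : Fintype.card ι ≤ N := by
      have := hind.card_le_finrank_succ
      exact this.trans (Nat.succ_le_succ (Submodule.finrank_le _))
    obtain ⟨e⟩ : Nonempty (ι ↪ Fin N) :=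
      Function.Embedding.nonempty_of_card_le (by simpa using hcard)
    have hw' (i : ι) : Function.extend e w 0 (e i) = w i := e.injective.extend_apply _ _ i
    have hz' (i : ι) : Function.extend e z (fun _ => x₀) (e i) = z i :=
      e.injective.extend_apply _ _ i
    have hout (j : Fin N) (hj : j ∉ Set.range e) : Function.extend e w 0 j = 0 :=
      Function.extend_apply' _ _ _ fun ⟨i, hi⟩ => hj ⟨i, hi⟩
    refine ⟨(Function.extend e w 0, Function.extend e z fun _ => x₀), ⟨⟨fun j => ?_, ?_⟩, ?_⟩, ?_⟩
    · change 0 ≤ Function.extend e w 0 j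
      by_cases hj : j ∈ Set.range e
      · obtain ⟨i, rfl⟩ := hj
        rw [hw']; exact (hw i).le
      · rw [hout j hj]
    · rw [← hw1]
      exact (Fintype.sum_of_injective e e.injective _ _ (fun j hj => hout j hj)
        fun i => (hw' i).symm).symm
    · intro j _
      by_cases hj : j ∈ Set.range e
      · obtain ⟨i, rfl⟩ := hj
        simp only [hz']
        exact hz ⟨i, rfl⟩
      · simp only
        rw [Function.extend_apply' _ _ _ fun ⟨i, hi⟩ => hj ⟨i, hi⟩]
        exact hx₀
    · rw [← hx]
      refine (Fintype.sum_of_injective e e.injective _ _ (fun j hj => ?_) fun i => ?_).symm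
      · simp only [hout j hj, zero_smul]
      · simp only [hw', hz']
  · rintro _ ⟨⟨w, z⟩, ⟨hw, hz⟩, rfl⟩
    exact (convex_convexHull ℝ s).sum_mem (fun i _ => hw.1 i) hw.2
      fun i _ => subset_convexHull ℝ s (hz i trivial)

/-- A closed plane curve `γ` whose tangent at the parameter `u` is a positive multiple of
`(cos φ, -sin φ)`, where the angle `φ` decreases from `-∞` to `∞` and by `π` over the half
period `U`. -/
structure IsTurningCurve (γ : ℝ → ℝ × ℝ) (φ : ℝ → ℝ) (U : ℝ) (lam : ℝ → ℝ) : Prop where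
  period_pos : 0 < U
  anti : StrictAnti φ
  surj : Function.Surjective φ
  cont : Continuous φ
  angle_add : ∀ u, φ (u + U) = φ u - Real.pi
  periodic : Function.Periodic γ (2 * U)
  hasDerivAt : ∀ u, HasDerivAt γ (lam u * Real.cos (φ u), -(lam u * Real.sin (φ u))) u
  speed_pos : ∀ u, 0 < lam u

/-- The linear form `⟨·, n⟩` for the inner normal `n = (sin τ, cos τ)` at tangent angle `τ`. -/
noncomputable def normalForm (τ : ℝ) (x : ℝ × ℝ) : ℝ := Real.sin τ * x.1 + Real.cos τ * x.2

lemma normalForm_combo (τ a b : ℝ) (x y : ℝ × ℝ) :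
    normalForm τ (a • x + b • y) = a * normalForm τ x + b * normalForm τ y := by
  simp [normalForm]; ring

namespace IsTurningCurve

variable {γ : ℝ → ℝ × ℝ} {φ lam : ℝ → ℝ} {U : ℝ}

lemma hasDerivAt_normalForm (h : IsTurningCurve γ φ U lam) (τ u : ℝ) :
    HasDerivAt (fun u => normalForm τ (γ u)) (lam u * Real.sin (τ - φ u)) u := by
  have h1 := (hasFDerivAt_fst.comp_hasDerivAt u (h.hasDerivAt u) :
    HasDerivAt (fun u => (γ u).1) _ u)
  have h2 := (hasFDerivAt_snd.comp_hasDerivAt u (h.hasDerivAt u) :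
    HasDerivAt (fun u => (γ u).2) _ u)
  refine ((h1.const_mul (Real.sin τ)).add (h2.const_mul (Real.cos τ))).congr_deriv ?_
  rw [Real.sin_sub]
  simp
  ring

lemma continuous (h : IsTurningCurve γ φ U lam) : Continuous γ :=
  continuous_iff_continuousAt.2 fun u => (h.hasDerivAt u).continuousAt

/-- Along one period starting at `u₀`, the height over the tangent at `u₀` first increases, over
half a period, and then decreases back to its initial value. -/
lemma normalForm_lt (h : IsTurningCurve γ φ U lam) {u₀ u : ℝ}
    (hu : u ∈ Set.Ioo u₀ (u₀ + 2 * U)) :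
    normalForm (φ u₀) (γ u₀) < normalForm (φ u₀) (γ u) := by
  have hU := h.period_pos
  have hd := h.hasDerivAt_normalForm (φ u₀)
  have hcont : Continuous fun u => normalForm (φ u₀) (γ u) :=
    continuous_iff_continuousAt.2 fun u => (hd u).continuousAt
  rcases le_total u (u₀ + U) with hle | hle
  · have hmono : StrictMonoOn (fun u => normalForm (φ u₀) (γ u)) (Set.Icc u₀ (u₀ + U)) := by
      refine strictMonoOn_of_deriv_pos (convex_Icc _ _) hcont.continuousOn fun x hx => ?_
      rw [interior_Icc] at hx
      rw [(hd x).deriv]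
      have h1 := h.anti hx.1
      have h2 := h.anti hx.2
      rw [h.angle_add] at h2
      exact mul_pos (h.speed_pos x) (Real.sin_pos_of_pos_of_lt_pi (by linarith) (by linarith))
    exact hmono ⟨le_rfl, by linarith⟩ ⟨hu.1.le, hle⟩ hu.1
  · have hanti : StrictAntiOn (fun u => normalForm (φ u₀) (γ u))
        (Set.Icc (u₀ + U) (u₀ + 2 * U)) := by
      refine strictAntiOn_of_deriv_neg (convex_Icc _ _) hcont.continuousOn fun x hx => ?_
      rw [interior_Icc] at hx
      rw [(hd x).deriv]
      have h1 := h.anti hx.1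
      have h2 := h.anti hx.2
      rw [h.angle_add] at h1
      rw [two_mul, ← add_assoc, h.angle_add, h.angle_add] at h2
      have h3 : Real.sin (φ u₀ - φ x) < 0 := by
        rw [← neg_pos, ← Real.sin_sub_pi]
        exact Real.sin_pos_of_pos_of_lt_pi (by linarith) (by linarith)
      exact mul_neg_of_pos_of_neg (h.speed_pos x) h3
    have := hanti ⟨hle, hu.2.le⟩ ⟨by linarith, le_rfl⟩ hu.2
    simp only [h.periodic u₀] at this
    exact this

lemma normalForm_lt_or (h : IsTurningCurve γ φ U lam) (u₀ u : ℝ) :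
    normalForm (φ u₀) (γ u₀) < normalForm (φ u₀) (γ u) ∨ ∃ n : ℤ, u = u₀ + n * (2 * U) := by
  have hU : 0 < 2 * U := by linarith [h.period_pos]
  obtain ⟨n, hn, -⟩ := existsUnique_sub_zsmul_mem_Ico hU u u₀
  simp only [zsmul_eq_mul] at hn
  rcases hn.1.eq_or_lt with h1 | h1
  · exact Or.inr ⟨n, by linarith⟩
  · left
    have := h.normalForm_lt ⟨h1, hn.2⟩
    rwa [h.periodic.sub_int_mul_eq n] at this

lemma eq_add_of_eq (h : IsTurningCurve γ φ U lam) {u u' : ℝ} (he : γ u = γ u') :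
    ∃ n : ℤ, u = u' + n * (2 * U) := by
  rcases h.normalForm_lt_or u' u with h1 | h1
  · rw [he] at h1; exact absurd h1 (lt_irrefl _)
  · exact h1

lemma injOn (h : IsTurningCurve γ φ U lam) : Set.InjOn γ (Set.Ico 0 (2 * U)) := by
  intro u hu u' hu' he
  have hU := h.period_pos
  obtain ⟨n, hn⟩ := h.eq_add_of_eq he
  have h1 : (n : ℝ) < 1 := by
    by_contra hc
    push Not at hc
    nlinarith [hu.2, hu'.1]
  have h2 : (-1 : ℝ) < n := by
    by_contra hc
    push Not at hc
    nlinarith [hu.1, hu'.2]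
  have h3 : n = 0 := by
    have : n < 1 := by exact_mod_cast h1
    have : -1 < n := by exact_mod_cast h2
    omega
  simpa [h3] using hn

lemma isCompact_range (h : IsTurningCurve γ φ U lam) : IsCompact (Set.range γ) := by
  have hU : 0 < 2 * U := by linarith [h.period_pos]
  rw [← h.periodic.image_Icc hU 0]
  exact isCompact_Icc.image h.continuous

/-- The points that lie strictly on the inner side of all tangents of `γ`. -/
def inside (γ : ℝ → ℝ × ℝ) (φ : ℝ → ℝ) : Set (ℝ × ℝ) :=
  {x | ∀ u, normalForm (φ u) (γ u) < normalForm (φ u) x}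

lemma isOpen_inside (h : IsTurningCurve γ φ U lam) : IsOpen (inside γ φ) := by
  have hU : 0 < 2 * U := by linarith [h.period_pos]
  have hper (x : ℝ × ℝ) (u : ℝ) (n : ℤ) :
      normalForm (φ (u - n * (2 * U))) x = normalForm (φ u) x := by
    have h1 (u : ℝ) : φ (u + 2 * U) = φ u - 2 * Real.pi := by
      rw [two_mul, ← add_assoc, h.angle_add, h.angle_add]; ring
    have hp : Function.Periodic (fun u => normalForm (φ u) x) (2 * U) := by
      intro u
      simp only [normalForm, h1, Real.sin_sub_two_pi, Real.cos_sub_two_pi]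
    exact hp.sub_int_mul_eq n
  rw [isOpen_iff_mem_nhds]
  intro x hx
  have key : ∀ᶠ y in nhds x, ∀ u ∈ Set.Icc 0 (2 * U),
      normalForm (φ u) (γ u) < normalForm (φ u) y := by
    refine isCompact_Icc.eventually_forall_of_forall_eventually fun u _ => ?_
    have hφ := h.cont
    have hγ := h.continuous
    refine ContinuousAt.eventually_lt (f := fun p : (ℝ × ℝ) × ℝ => normalForm (φ p.2) (γ p.2))
      (g := fun p : (ℝ × ℝ) × ℝ => normalForm (φ p.2) p.1) ?_ ?_ (hx u)
    · unfold normalForm; fun_prop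
    · unfold normalForm; fun_prop
  filter_upwards [key] with y hy u
  obtain ⟨n, hn, -⟩ := existsUnique_sub_zsmul_mem_Ico hU u 0
  simp only [zsmul_eq_mul, zero_add] at hn
  have := hy _ ⟨hn.1, hn.2.le⟩
  rwa [hper, hper, h.periodic.sub_int_mul_eq n] at this

lemma convexHull_range_subset (h : IsTurningCurve γ φ U lam) (u : ℝ) :
    convexHull ℝ (Set.range γ)
      ⊆ {x | x = γ u ∨ normalForm (φ u) (γ u) < normalForm (φ u) x} := by
  refine convexHull_min ?_ ?_
  · rintro _ ⟨u', rfl⟩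
    rcases h.normalForm_lt_or u u' with h1 | ⟨n, rfl⟩
    · exact Or.inr h1
    · exact Or.inl (h.periodic.int_mul n u)
  · intro x hx y hy a b ha hb hab
    have hle : ∀ {z}, (z = γ u ∨ normalForm (φ u) (γ u) < normalForm (φ u) z) →
        normalForm (φ u) (γ u) ≤ normalForm (φ u) z := by
      rintro z (rfl | hz)
      · exact le_rfl
      · exact hz.le
    set m := normalForm (φ u) (γ u) with hm
    have hmm : m = a * m + b * m := by rw [← add_mul, hab, one_mul]
    rcases hx with rfl | hx
    · rcases hy with rfl | hy
      · left; rw [← add_smul, hab, one_smul]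
      · rcases hb.eq_or_lt with rfl | hb
        · left
          rw [add_zero] at hab
          rw [hab, one_smul, zero_smul, add_zero]
        · right
          rw [normalForm_combo, hmm]
          have := mul_lt_mul_of_pos_left hy hb
          linarith
    · rcases ha.eq_or_lt with rfl | ha
      · rw [zero_add] at hab
        rw [hab, one_smul, zero_smul, zero_add]
        exact hy
      · right
        rw [normalForm_combo, hmm]
        have h1 := mul_lt_mul_of_pos_left hx ha
        have h2 := mul_le_mul_of_nonneg_left (hle hy) hb
        linarith

lemma mem_inside (h : IsTurningCurve γ φ U lam) {x : ℝ × ℝ}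
    (hx : x ∈ convexHull ℝ (Set.range γ)) (hx' : x ∉ Set.range γ) : x ∈ inside γ φ :=
  fun u => (h.convexHull_range_subset u hx).resolve_left fun e => hx' ⟨u, e.symm⟩

lemma isClosed_convexHull (h : IsTurningCurve γ φ U lam) :
    IsClosed (convexHull ℝ (Set.range γ)) :=
  (isCompact_convexHull h.isCompact_range).isClosed

/-- Every linear form is a multiple of some `normalForm (φ u)`, so Hahn-Banach applies. -/
lemma inside_subset (h : IsTurningCurve γ φ U lam) :
    inside γ φ ⊆ convexHull ℝ (Set.range γ) := by
  intro x hx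
  by_contra hc
  obtain ⟨f, c, hf, hfx⟩ := geometric_hahn_banach_closed_point (convex_convexHull ℝ _)
    h.isClosed_convexHull hc
  have hfe (y : ℝ × ℝ) : f y = y.1 * f (1, 0) + y.2 * f (0, 1) := by
    conv_lhs => rw [show y = y.1 • ((1 : ℝ), (0 : ℝ)) + y.2 • ((0 : ℝ), (1 : ℝ)) by simp]
    rw [map_add, map_smul, map_smul, smul_eq_mul, smul_eq_mul]
  let w : ℂ := ⟨-f (0, 1), -f (1, 0)⟩
  obtain ⟨u, hu⟩ := h.surj w.arg
  have h1 : -f (0, 1) = ‖w‖ * Real.cos (φ u) := by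
    rw [hu]; exact (Complex.norm_mul_cos_arg w).symm
  have h2 : -f (1, 0) = ‖w‖ * Real.sin (φ u) := by
    rw [hu]; exact (Complex.norm_mul_sin_arg w).symm
  have hfn (y : ℝ × ℝ) : f y = -(‖w‖ * normalForm (φ u) y) := by
    rw [hfe, normalForm]
    linear_combination -y.1 * h2 - y.2 * h1
  have h3 := (hf (γ u) (subset_convexHull ℝ _ ⟨u, rfl⟩)).trans hfx
  rw [hfn, hfn] at h3
  have := mul_le_mul_of_nonneg_left (hx u).le (norm_nonneg w)
  linarith

lemma notMem_interior (h : IsTurningCurve γ φ U lam) (u : ℝ) :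
    γ u ∉ interior (convexHull ℝ (Set.range γ)) := by
  intro hu
  let f : ℝ → ℝ × ℝ := fun t => γ u - t • (Real.sin (φ u), Real.cos (φ u))
  have hf : Continuous f := by fun_prop
  have h0 : f 0 = γ u := by simp [f]
  have hev : ∀ᶠ t in nhds 0, f t ∈ convexHull ℝ (Set.range γ) := by
    apply hf.continuousAt.eventually
    rw [h0]
    exact mem_interior_iff_mem_nhds.1 hu
  obtain ⟨t, ht, htpos⟩ := ((hev.filter_mono nhdsWithin_le_nhds).and
    (self_mem_nhdsWithin (s := Set.Ioi (0 : ℝ)))).exists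
  have hval : normalForm (φ u) (f t) = normalForm (φ u) (γ u) - t := by
    simp only [normalForm, f, Prod.fst_sub, Prod.snd_sub, Prod.smul_fst, Prod.smul_snd, smul_eq_mul]
    linear_combination -t * Real.sin_sq_add_cos_sq (φ u)
  have htpos : 0 < t := htpos
  rcases h.convexHull_range_subset u ht with h1 | h1
  · rw [h1] at hval; linarith
  · rw [hval] at h1; linarith

theorem frontier_convexHull (h : IsTurningCurve γ φ U lam) :
    frontier (convexHull ℝ (Set.range γ)) = Set.range γ := by
  rw [h.isClosed_convexHull.frontier_eq]
  apply Set.Subset.antisymm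
  · rintro x ⟨hx, hx'⟩
    by_contra hc
    exact hx' (interior_maximal h.inside_subset h.isOpen_inside (h.mem_inside hx hc))
  · rintro _ ⟨u, rfl⟩
    exact ⟨subset_convexHull ℝ _ ⟨u, rfl⟩, h.notMem_interior u⟩

/-- A point of the inside is enclosed by the curve: its connected component in the complement
stays inside, since the complement is the disjoint union of the inside and of the outside of
the convex hull. -/
lemma isBounded_component (h : IsTurningCurve γ φ U lam) {x : ℝ × ℝ} (hx : x ∈ inside γ φ) :
    x ∉ Set.range γ ∧ Bornology.IsBounded (connectedComponentIn (Set.range γ)ᶜ x) := by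
  have hxγ : x ∉ Set.range γ := by
    rintro ⟨u, rfl⟩
    exact lt_irrefl _ (hx u)
  refine ⟨hxγ, ?_⟩
  refine ((isCompact_convexHull h.isCompact_range).isBounded.subset h.inside_subset).subset ?_
  refine isPreconnected_connectedComponentIn.subset_left_of_subset_union h.isOpen_inside
    h.isClosed_convexHull.isOpen_compl ?_ ?_ ⟨x, mem_connectedComponentIn hxγ, hx⟩
  · exact Set.disjoint_left.2 fun y hy hy' => hy' (h.inside_subset hy)
  · intro y hy
    by_cases hK : y ∈ convexHull ℝ (Set.range γ)
    · exact Or.inl (h.mem_inside hK (connectedComponentIn_subset _ _ hy))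
    · exact Or.inr hK

lemma isClosedEmbeddedConvexCurve (h : IsTurningCurve γ φ U lam) (hγ : ContDiff ℝ ∞ γ) :
    IsClosedEmbeddedConvexCurve (Set.range γ) := by
  refine ⟨⟨γ, 2 * U, by linarith [h.period_pos], hγ, fun u hu => ?_, h.periodic, h.injOn, rfl⟩,
    h.frontier_convexHull⟩
  rw [(h.hasDerivAt u).deriv, Prod.mk_eq_zero] at hu
  have hl := (h.speed_pos u).ne'
  have h1 := (mul_eq_zero.1 hu.1).resolve_left hl
  have h2 := (mul_eq_zero.1 (neg_eq_zero.1 hu.2)).resolve_left hl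
  have := Real.sin_sq_add_cos_sq (φ u)
  rw [h1, h2] at this
  norm_num at this

end IsTurningCurve

/-! ### The slices of the catenoid -/

/-- The curve cut out by the plane `x₂ = d`, parametrized by `u`: on it `v = (d + G(u)) / C`. -/
noncomputable def sliceParam (α θ : ℝ) (φ : ℝ → ℝ) (d u : ℝ) : ℂ :=
  ⟨u, (d + GFun α θ φ u) / Cst α θ⟩

/-- The slice by the plane `x₂ = d` in the coordinates `(x₁, x₃ + x₁ x₂ / 2)`, parametrized by `u`. -/
noncomputable def sliceCurve (α θ : ℝ) (φ : ℝ → ℝ) (d u : ℝ) : ℝ × ℝ :=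
  (sliceX α θ φ (sliceParam α θ φ d u), sliceY α θ φ (sliceParam α θ φ d u))

namespace IsCatenoidDatum

variable {α θ : ℝ} {φ : ℝ → ℝ}

lemma depth_sliceParam (h : IsCatenoidDatum α θ φ) (d u : ℝ) :
    depth α θ φ (sliceParam α θ φ d u) = d := by
  have := h.Cst_pos.ne'
  simp only [depth, sliceParam]
  field_simp
  ring

lemma sliceParam_depth (h : IsCatenoidDatum α θ φ) (z : ℂ) :
    sliceParam α θ φ (depth α θ φ z) z.re = z := by
  have := h.Cst_pos.ne'
  apply Complex.ext
  · rfl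
  · simp only [depth, sliceParam]
    field_simp
    ring

lemma sliceParam_add (h : IsCatenoidDatum α θ φ) (d u : ℝ) :
    sliceParam α θ φ d (u + 2 * halfPeriod α θ) = sliceParam α θ φ d u + periodVector α θ φ := by
  have h1 := h.depth_sliceParam d u
  have h2 : depth α θ φ (sliceParam α θ φ d u + periodVector α θ φ) = d := by
    rw [h.periodic_depth, h1]
  have h3 : (sliceParam α θ φ d u + periodVector α θ φ).re = u + 2 * halfPeriod α θ := by
    rw [Complex.add_re, periodVector_re]; rfl
  rw [← h.sliceParam_depth (sliceParam α θ φ d u + periodVector α θ φ), h2, h3]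

lemma sliceCurve_eq (d u : ℝ) : sliceCurve α θ φ d u
    = sliceCoord (catenoidImmersion α θ φ (sliceParam α θ φ d u)) := by
  rw [sliceCoord_catenoidImmersion]; rfl

lemma slice_eq_range (h : IsCatenoidDatum α θ φ) (d : ℝ) :
    slice (horizontalCatenoid α θ φ) d = Set.range (sliceCurve α θ φ d) := by
  apply Set.Subset.antisymm
  · rintro _ ⟨_, ⟨⟨z, rfl⟩, hz⟩, rfl⟩
    have hz : catenoidImmersion α θ φ z 1 = d := hz
    rw [catenoidImmersion_one] at hz
    exact ⟨z.re, by rw [sliceCurve_eq, ← hz, h.sliceParam_depth]⟩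
  · rintro _ ⟨u, rfl⟩
    refine ⟨_, ⟨⟨sliceParam α θ φ d u, rfl⟩, ?_⟩, (sliceCurve_eq d u).symm⟩
    change catenoidImmersion α θ φ _ 1 = d
    rw [catenoidImmersion_one, h.depth_sliceParam]

lemma hasDerivAt_comp_sliceParam (h : IsCatenoidDatum α θ φ) {f : ℂ → ℝ} {a b d u : ℝ}
    (hf : HasPD f a b (sliceParam α θ φ d u)) :
    HasDerivAt (fun u => f (sliceParam α θ φ d u)) (a + b * (GDeriv α θ φ u / Cst α θ)) u := by
  have h1 : HasDerivAt (sliceParam α θ φ d) (1 + (GDeriv α θ φ u / Cst α θ : ℝ) * Complex.I) u := by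
    have := (hasDerivAt_id u).ofReal_comp.add
      ((((h.hasDerivAt_GFun u).const_add d).div_const (Cst α θ)).ofReal_comp.mul_const Complex.I)
    have e : sliceParam α θ φ d = fun u => ((id u : ℝ) : ℂ)
        + (((d + GFun α θ φ u) / Cst α θ : ℝ) : ℂ) * Complex.I := by
      funext u; exact (Complex.re_add_im _).symm
    rw [e]
    refine this.congr_deriv ?_
    simp
  have := HasFDerivAt.comp_hasDerivAt u hf h1
  refine this.congr_deriv ?_
  simp
  ring

/-- The slices turn monotonically: their tangent is a positive multiple of `(cos φ, -sin φ)`. -/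
lemma isTurningCurve_sliceCurve (h : IsCatenoidDatum α θ φ) (d : ℝ) :
    IsTurningCurve (sliceCurve α θ φ d) φ (halfPeriod α θ) (fun u =>
      (GDeriv α θ φ u ^ 2 + Cst α θ ^ 2) * Real.cosh (AFun α θ φ (sliceParam α θ φ d u))
        / Cst α θ) where
  period_pos := h.halfPeriod_pos
  anti := h.strictAnti_phase
  surj := h.surjective_phase
  cont := h.continuous_phase
  angle_add := h.phase_add
  periodic u := by
    rw [sliceCurve_eq, sliceCurve_eq, h.sliceParam_add, h.periodic_catenoidImmersion]
  hasDerivAt u := by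
    have hC := h.Cst_pos.ne'
    have h1 := h.hasDerivAt_comp_sliceParam (h.hasPD_sliceX (sliceParam α θ φ d u))
    have h2 := h.hasDerivAt_comp_sliceParam (h.hasPD_sliceY (sliceParam α θ φ d u))
    refine (h1.prodMk h2).congr_deriv ?_
    have hre : (sliceParam α θ φ d u).re = u := rfl
    ext
    · simp only [uHor, vHor, hre]
      field_simp
      ring
    · simp only [uVer, vVer, hre]
      field_simp
      ring
  speed_pos u := div_pos (mul_pos (h.speed_pos u) (Real.cosh_pos _)) h.Cst_pos

lemma contDiff_sliceCurve (h : IsCatenoidDatum α θ φ) (d : ℝ) :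
    ContDiff ℝ ∞ (sliceCurve α θ φ d) := by
  have hG := h.contDiff_GFun
  have h1 : ContDiff ℝ ∞ (sliceParam α θ φ d) := by
    have e : sliceParam α θ φ d = fun u => ((u : ℝ) : ℂ)
        + (((d + GFun α θ φ u) / Cst α θ : ℝ) : ℂ) * Complex.I := by
      funext u; exact (Complex.re_add_im _).symm
    rw [e]
    exact Complex.ofRealCLM.contDiff.add ((Complex.ofRealCLM.contDiff.comp
      ((contDiff_const.add hG).div_const _)).mul contDiff_const)
  have hX := h.contDiff_catenoidImmersion.comp h1
  have hi (i : Fin 3) : ContDiff ℝ ∞ fun u =>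
      catenoidImmersion α θ φ (sliceParam α θ φ d u) i := (contDiff_pi.1 hX) i
  rw [show sliceCurve α θ φ d = fun u => _ from funext fun u => sliceCurve_eq d u]
  exact (hi 0).prodMk ((hi 2).add (((hi 0).mul (hi 1)).div_const 2))

/-- The origin lies on the inner side of all tangents of each slice: its height over the tangent
is `(C/α²) (√P(cos φ) cosh A + C sin φ cos φ sinh A)`, and `P(cos φ) > C² sin² φ cos² φ`. -/
lemma zero_mem_inside (h : IsCatenoidDatum α θ φ) (d : ℝ) :
    ((0 : ℝ), (0 : ℝ)) ∈ IsTurningCurve.inside (sliceCurve α θ φ d) φ := by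
  intro u
  have hα := h.alpha_pos
  have hC := h.Cst_pos
  set z := sliceParam α θ φ d u with hz
  have hre : z.re = u := rfl
  set s := Real.sin (φ u)
  set c := Real.cos (φ u)
  set D := deriv φ u
  set C := Cst α θ
  set sh := Real.sinh (AFun α θ φ z)
  set ch := Real.cosh (AFun α θ φ z)
  have hs : s ^ 2 + c ^ 2 = 1 := Real.sin_sq_add_cos_sq (φ u)
  have hch : ch ^ 2 - sh ^ 2 = 1 := Real.cosh_sq_sub_sinh_sq _
  have hch0 : 0 < ch := Real.cosh_pos _
  have hD := h.deriv_neg u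
  have hD2 := h.deriv_sq u
  have hp := h.GDeriv_mul_cos_sq u
  have hform : normalForm (φ u) (sliceCurve α θ φ d u)
      = C / α ^ 2 * (D * ch - C * s * c * sh) := by
    simp only [normalForm, sliceCurve, sliceX, sliceY, uHor, vHor, uVer, ← hz, hre]
    field_simp
    linear_combination (C * ch) * hp - α * C * ch * hs
  have h0 : normalForm (φ u) ((0 : ℝ), (0 : ℝ)) = 0 := by simp [normalForm]
  rw [hform, h0]
  apply mul_neg_of_pos_of_neg (by positivity)
  -- `P(1) > 0` gives `C² s² c² < D²`
  have hP1 : 0 < α ^ 2 + Real.cos (2 * θ) - C ^ 2 := by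
    have := Pol_pos (x := 1) hα h.sin_sq_lt (by norm_num)
    rw [Pol] at this
    linarith
  have hlt : (C * s * c) ^ 2 < D ^ 2 := by
    have hc1 : c ^ 2 ≤ 1 := Real.cos_sq_le_one _
    have hs2 : s ^ 2 = 1 - c ^ 2 := by linarith
    have : 0 < α ^ 2 * (1 - c ^ 2) + (α ^ 2 + Real.cos (2 * θ) - C ^ 2) * c ^ 2 := by
      rcases hc1.eq_or_lt with h1 | h1
      · rw [h1]; linarith
      · have := mul_pos (pow_pos hα 2) (sub_pos.2 h1)
        have := mul_nonneg hP1.le (sq_nonneg c)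
        linarith
    rw [hD2, mul_pow, mul_pow, hs2]
    linarith
  have h1 : |C * s * c| < -D := abs_lt_of_sq_lt_sq (by rwa [neg_sq]) (by linarith)
  have h2 : |sh| ≤ ch := abs_le_of_sq_le_sq (by linarith) hch0.le
  have h3 : |C * s * c * sh| < -D * ch := by
    rw [abs_mul]
    calc |C * s * c| * |sh| ≤ |C * s * c| * ch := mul_le_mul_of_nonneg_left h2 (abs_nonneg _)
      _ < -D * ch := mul_lt_mul_of_pos_right h1 hch0
  have := (abs_lt.1 h3).1
  linarith

lemma slice_nonempty (h : IsCatenoidDatum α θ φ) (d : ℝ) :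
    (slice (horizontalCatenoid α θ φ) d).Nonempty := by
  rw [h.slice_eq_range]; exact Set.range_nonempty _

lemma isClosedEmbeddedConvexCurve_slice (h : IsCatenoidDatum α θ φ) (d : ℝ) :
    IsClosedEmbeddedConvexCurve (slice (horizontalCatenoid α θ φ) d) := by
  rw [h.slice_eq_range]
  exact (h.isTurningCurve_sliceCurve d).isClosedEmbeddedConvexCurve (h.contDiff_sliceCurve d)

lemma axis_mem_enclosedRegion (h : IsCatenoidDatum α θ φ) (d : ℝ) :
    ![0, d, 0] ∈ enclosedRegion (horizontalCatenoid α θ φ) := by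
  have h0 : sliceCoord ![0, d, 0] = (0, 0) := by simp [sliceCoord]
  have h1 : (![0, d, 0] : Nil) 1 = d := rfl
  rw [enclosedRegion, Set.mem_ofPred_eq, h0, h1, h.slice_eq_range]
  exact (h.isTurningCurve_sliceCurve d).isBounded_component (h.zero_mem_inside d)

/-- The immersion is injective modulo its period, because the slices are simple curves. -/
lemma eq_add_of_catenoidImmersion_eq (h : IsCatenoidDatum α θ φ) (z z' : ℂ)
    (he : catenoidImmersion α θ φ z = catenoidImmersion α θ φ z') :
    ∃ n : ℤ, z = z' + n * periodVector α θ φ := by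
  have hd : depth α θ φ z = depth α θ φ z' := by
    rw [← catenoidImmersion_one, he, catenoidImmersion_one]
  have h1 : sliceCurve α θ φ (depth α θ φ z') z.re
      = sliceCurve α θ φ (depth α θ φ z') z'.re := by
    rw [sliceCurve_eq, sliceCurve_eq, h.sliceParam_depth, ← hd, h.sliceParam_depth, he]
  obtain ⟨n, hn⟩ := (h.isTurningCurve_sliceCurve _).eq_add_of_eq h1
  refine ⟨n, ?_⟩
  have h2 : depth α θ φ (z' + n * periodVector α θ φ) = depth α θ φ z :=
    (h.periodic_depth.int_mul n z').trans hd.symm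
  have h3 : (z' + n * periodVector α θ φ).re = z.re := by
    rw [hn, Complex.add_re, ← zsmul_eq_mul, Complex.smul_re, periodVector_re, zsmul_eq_mul]
  rw [← h.sliceParam_depth z, ← h.sliceParam_depth (z' + n * periodVector α θ φ), h2, h3]

end IsCatenoidDatum

/-! ### Derivatives along the left-invariant frame -/

/-- The left-invariant orthonormal frame `(E₁, E₂, E₃)` of `Nil₃`, with indices `0, 1, 2`. -/
noncomputable def frameField (k : Fin 3) (p : Nil) : Nil :=
  ![![1, 0, -p 1 / 2], ![0, 1, p 0 / 2], ![0, 0, 1]] k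

/-- The derivative of a function along `frameField k`. -/
noncomputable def frameDeriv (k : Fin 3) (f : Nil → ℝ) (p : Nil) : ℝ :=
  fderiv ℝ f p (frameField k p)

lemma frameCoord_frameField (k : Fin 3) (p : Nil) :
    frameCoord p (frameField k p) = Pi.single k 1 := by
  ext i; fin_cases k <;> fin_cases i <;> simp [frameCoord, frameField] <;> ring

lemma nilInner_frameField (j l : Fin 3) (p : Nil) :
    nilInner p (frameField j p) (frameField l p) = if j = l then 1 else 0 := by
  rw [nilInner, frameCoord_frameField, frameCoord_frameField]
  simp [Pi.single_apply, eq_comm]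

lemma eq_sum_frameField (p v : Nil) : v = ∑ k, frameCoord p v k • frameField k p := by
  ext i; fin_cases i <;> simp [Fin.sum_univ_three, frameCoord, frameField]; ring

lemma contDiff_frameField (k : Fin 3) : ContDiff ℝ ∞ (frameField k) := by
  rw [contDiff_pi]
  intro i
  fin_cases k <;> fin_cases i <;> simp [frameField] <;> fun_prop

lemma contDiff_frameDeriv {f : Nil → ℝ} (hf : ContDiff ℝ ∞ f) (k : Fin 3) :
    ContDiff ℝ ∞ (frameDeriv k f) :=
  (hf.fderiv_right (m := ∞) (by norm_cast)).clm_apply (contDiff_frameField k)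

lemma differentiableAt_of_contDiff {f : Nil → ℝ} (hf : ContDiff ℝ ∞ f) (p : Nil) :
    DifferentiableAt ℝ f p := hf.differentiable (by simp) p

lemma frameDeriv_const (k : Fin 3) (c : ℝ) (p : Nil) : frameDeriv k (fun _ => c) p = 0 := by
  simp [frameDeriv]

lemma frameDeriv_add {f g : Nil → ℝ} (hf : ContDiff ℝ ∞ f) (hg : ContDiff ℝ ∞ g) (k : Fin 3)
    (p : Nil) : frameDeriv k (fun q => f q + g q) p = frameDeriv k f p + frameDeriv k g p := by
  rw [frameDeriv, fderiv_fun_add (differentiableAt_of_contDiff hf p)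
    (differentiableAt_of_contDiff hg p)]
  rfl

lemma frameDeriv_mul {f g : Nil → ℝ} (hf : ContDiff ℝ ∞ f) (hg : ContDiff ℝ ∞ g) (k : Fin 3)
    (p : Nil) : frameDeriv k (fun q => f q * g q) p
      = frameDeriv k f p * g p + f p * frameDeriv k g p := by
  rw [frameDeriv, fderiv_fun_mul (differentiableAt_of_contDiff hf p)
    (differentiableAt_of_contDiff hg p)]
  simp [frameDeriv]
  ring

lemma frameDeriv_const_mul {f : Nil → ℝ} (hf : ContDiff ℝ ∞ f) (c : ℝ) (k : Fin 3)
    (p : Nil) : frameDeriv k (fun q => c * f q) p = c * frameDeriv k f p := by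
  rw [frameDeriv_mul contDiff_const hf, frameDeriv_const, zero_mul, zero_add]

/-- A function whose derivatives along the frame vanish is constant. -/
lemma eq_of_frameDeriv_eq_zero {f : Nil → ℝ} (hf : ContDiff ℝ ∞ f)
    (h : ∀ k p, frameDeriv k f p = 0) (p q : Nil) : f p = f q := by
  refine is_const_of_fderiv_eq_zero (𝕜 := ℝ) (hf.differentiable (by simp)) (fun p => ?_) p q
  ext1 v
  rw [eq_sum_frameField p v, map_sum]
  simp only [map_smul]
  exact Finset.sum_eq_zero fun k _ => by rw [show fderiv ℝ f p (frameField k p) = 0 from h k p,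
    smul_zero]

lemma frameDeriv_frameDeriv {f : Nil → ℝ} (hf : ContDiff ℝ ∞ f) (j k : Fin 3) (p : Nil) :
    frameDeriv j (frameDeriv k f) p
      = fderiv ℝ (fderiv ℝ f) p (frameField j p) (frameField k p)
        + fderiv ℝ f p (fderiv ℝ (frameField k) p (frameField j p)) := by
  have h1 : DifferentiableAt ℝ (fderiv ℝ f) p :=
    (hf.fderiv_right (m := 1) (by norm_cast)).differentiable (by simp) p
  have h2 : DifferentiableAt ℝ (frameField k) p :=
    (contDiff_frameField k).differentiable (by simp) p
  have := (h1.hasFDerivAt.clm_apply h2.hasFDerivAt).fderiv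
  rw [frameDeriv]
  refine (DFunLike.congr_fun this _).trans ?_
  simp [add_comm]

lemma fderiv_frameField (k : Fin 3) (p v : Nil) : fderiv ℝ (frameField k) p v
    = ![![0, 0, -v 1 / 2], ![0, 0, v 0 / 2], ![0, 0, 0]] k := by
  have hp (i : Fin 3) : HasFDerivAt (fun q : Nil => q i)
      (ContinuousLinearMap.proj (R := ℝ) (φ := fun _ : Fin 3 => ℝ) i) p :=
    (ContinuousLinearMap.proj (R := ℝ) (φ := fun _ : Fin 3 => ℝ) i).hasFDerivAt
  ext i
  have hk : DifferentiableAt ℝ (frameField k) p :=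
    (contDiff_frameField k).differentiable (by simp) p
  refine (DFunLike.congr_fun (fderiv_apply hk i) v).symm.trans ?_
  have h0 : (fun q : Nil => -q 1 / 2) = fun q => q 1 * (-(1 / 2)) := by funext q; ring
  have h1 : (fun q : Nil => q 0 / 2) = fun q => q 0 * (1 / 2) := by funext q; ring
  fin_cases k <;> fin_cases i <;> simp [frameField]
  · rw [h0, ((hp 1).mul_const _).fderiv]; simp; ring
  · rw [h1, ((hp 0).mul_const _).fderiv]; simp; ring

/-- `[E₁, E₂] = E₃`. -/
lemma frameDeriv_bracket_zero_one {f : Nil → ℝ} (hf : ContDiff ℝ ∞ f) (p : Nil) :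
    frameDeriv 0 (frameDeriv 1 f) p - frameDeriv 1 (frameDeriv 0 f) p = frameDeriv 2 f p := by
  have hs : IsSymmSndFDerivAt ℝ f p := hf.contDiffAt.isSymmSndFDerivAt (by
    rw [minSmoothness_of_isRCLikeNormedField]
    exact WithTop.coe_le_coe.2 (le_top (a := (2 : ℕ∞))))
  rw [frameDeriv_frameDeriv hf, frameDeriv_frameDeriv hf, hs.eq, add_sub_add_left_eq_sub,
    ← map_sub, fderiv_frameField, fderiv_frameField, frameDeriv]
  congr 1
  ext i; fin_cases i <;> simp [frameField]; norm_num

/-- `[E₁, E₃] = [E₂, E₃] = 0`. -/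
lemma frameDeriv_bracket_two {f : Nil → ℝ} (hf : ContDiff ℝ ∞ f) (k : Fin 3) (p : Nil) :
    frameDeriv k (frameDeriv 2 f) p = frameDeriv 2 (frameDeriv k f) p := by
  have hs : IsSymmSndFDerivAt ℝ f p := hf.contDiffAt.isSymmSndFDerivAt (by
    rw [minSmoothness_of_isRCLikeNormedField]
    exact WithTop.coe_le_coe.2 (le_top (a := (2 : ℕ∞))))
  rw [frameDeriv_frameDeriv hf, frameDeriv_frameDeriv hf, hs.eq, fderiv_frameField,
    fderiv_frameField]
  congr 2
  ext i; fin_cases k <;> fin_cases i <;> simp [frameField]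

/-! ### Isometries of `Nil₃` -/

/-- The matrix of the differential of `S` at `p` in the frames at `p` and `S p`. -/
noncomputable def frameMatrix (S : Nil → Nil) (p : Nil) : Matrix (Fin 3) (Fin 3) ℝ :=
  Matrix.of fun i j => frameCoord (S p) (fderiv ℝ S p (frameField j p)) i

lemma frameDeriv_coord {S : Nil → Nil} (hS : ContDiff ℝ ∞ S) (i k : Fin 3) (p : Nil) :
    frameDeriv k (fun q => S q i) p = fderiv ℝ S p (frameField k p) i := by
  rw [frameDeriv, fderiv_apply (hS.differentiable (by simp) p)]; rfl

lemma contDiff_coord {S : Nil → Nil} (hS : ContDiff ℝ ∞ S) (i : Fin 3) :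
    ContDiff ℝ ∞ fun q => S q i := contDiff_pi.1 hS i

lemma frameMatrix_zero {S : Nil → Nil} (hS : ContDiff ℝ ∞ S) (p : Nil) (j : Fin 3) :
    frameMatrix S p 0 j = frameDeriv j (fun q => S q 0) p := by
  rw [frameDeriv_coord hS]; simp [frameMatrix, frameCoord]

lemma frameMatrix_one {S : Nil → Nil} (hS : ContDiff ℝ ∞ S) (p : Nil) (j : Fin 3) :
    frameMatrix S p 1 j = frameDeriv j (fun q => S q 1) p := by
  rw [frameDeriv_coord hS]; simp [frameMatrix, frameCoord]

lemma frameMatrix_two {S : Nil → Nil} (hS : ContDiff ℝ ∞ S) (p : Nil) (j : Fin 3) :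
    frameMatrix S p 2 j = frameDeriv j (fun q => S q 2) p
      + 1 / 2 * (S p 1 * frameMatrix S p 0 j) + -1 / 2 * (S p 0 * frameMatrix S p 1 j) := by
  rw [frameDeriv_coord hS]; simp [frameMatrix, frameCoord]; ring

lemma contDiff_frameMatrix {S : Nil → Nil} (hS : ContDiff ℝ ∞ S) (i j : Fin 3) :
    ContDiff ℝ ∞ fun p => frameMatrix S p i j := by
  have h0 : ContDiff ℝ ∞ fun p => frameMatrix S p 0 j := by
    simp only [frameMatrix_zero hS]; exact contDiff_frameDeriv (contDiff_coord hS 0) j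
  have h1 : ContDiff ℝ ∞ fun p => frameMatrix S p 1 j := by
    simp only [frameMatrix_one hS]; exact contDiff_frameDeriv (contDiff_coord hS 1) j
  have c := contDiff_coord hS
  fin_cases i
  · exact h0
  · exact h1
  · simp only [Fin.reduceFinMk, frameMatrix_two hS]
    have h2 := contDiff_frameDeriv (c 2) j
    exact (h2.add (contDiff_const.mul ((c 1).mul h0))).add
      (contDiff_const.mul ((c 0).mul h1))

lemma frameMatrix_comp {S T : Nil → Nil} (hS : ContDiff ℝ ∞ S) (hT : ContDiff ℝ ∞ T) (p : Nil) :
    frameMatrix (S ∘ T) p = frameMatrix S (T p) * frameMatrix T p := by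
  ext i j
  have key (q : Nil) (L : Nil →L[ℝ] Nil) (c : Fin 3 → ℝ) (V : Fin 3 → Nil) :
      frameCoord q (L (∑ k, c k • V k)) i = ∑ k, frameCoord q (L (V k)) i * c k := by
    simp only [Fin.sum_univ_three, map_add, map_smul]
    fin_cases i <;> simp [frameCoord] <;> ring
  have h1 := congrArg (fun v => frameCoord (S (T p)) (fderiv ℝ S (T p) v) i)
    (eq_sum_frameField (T p) (fderiv ℝ T p (frameField j p)))
  rw [frameMatrix, Matrix.of_apply, fderiv_comp p (hS.differentiable (by simp) _)
    (hT.differentiable (by simp) _), ContinuousLinearMap.comp_apply, Matrix.mul_apply]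
  exact h1.trans (key _ _ _ _)

/-- The derivative of the matrix function `frameMatrix S` along the frame. -/
noncomputable def frameMatrixDeriv (S : Nil → Nil) (k : Fin 3) (p : Nil) :
    Matrix (Fin 3) (Fin 3) ℝ :=
  Matrix.of fun i j => frameDeriv k (fun q => frameMatrix S q i j) p

/-- The matrix `aᵀ Dₖ a`, where `a` is the frame matrix of `S` and `Dₖ` the derivative along
`frameField k`. -/
noncomputable def frameConnection (S : Nil → Nil) (k : Fin 3) (p : Nil) :
    Matrix (Fin 3) (Fin 3) ℝ :=
  (frameMatrix S p)ᵀ * frameMatrixDeriv S k p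

namespace IsNilIsometry

variable {S : Nil → Nil}

lemma transpose_mul_frameMatrix (h : IsNilIsometry S) (p : Nil) :
    (frameMatrix S p)ᵀ * frameMatrix S p = 1 := by
  ext j l
  have := h.2.2 p (frameField j p) (frameField l p)
  rw [nilInner_frameField] at this
  rw [Matrix.one_apply, ← this, nilInner]
  rfl

lemma mul_frameMatrix_transpose (h : IsNilIsometry S) (p : Nil) :
    frameMatrix S p * (frameMatrix S p)ᵀ = 1 :=
  mul_eq_one_comm.1 (h.transpose_mul_frameMatrix p)

lemma det_frameMatrix (h : IsNilIsometry S) :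
    (∀ p, (frameMatrix S p).det = 1) ∨ ∀ p, (frameMatrix S p).det = -1 := by
  have hc : Continuous fun p => (frameMatrix S p).det := by
    refine Continuous.matrix_det ?_
    exact continuous_matrix fun i j => (contDiff_frameMatrix h.2.1 i j).continuous
  have := isPreconnected_univ.eq_one_or_eq_neg_one_of_sq_eq hc.continuousOn (fun p _ => by
    have := congrArg Matrix.det (h.transpose_mul_frameMatrix p)
    rw [Matrix.det_mul, Matrix.det_transpose, Matrix.det_one] at this
    simp only [Pi.pow_apply, Pi.one_apply]
    rw [sq, this])
  exact this.imp (fun h p => h (Set.mem_univ p)) (fun h p => h (Set.mem_univ p))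

lemma det_frameMatrix_comp_self (h : IsNilIsometry S) (p : Nil) :
    (frameMatrix (S ∘ S) p).det = 1 := by
  rw [frameMatrix_comp h.2.1 h.2.1, Matrix.det_mul]
  rcases h.det_frameMatrix with h1 | h1 <;> rw [h1, h1] <;> norm_num

lemma frameConnection_antisymm (h : IsNilIsometry S) (k : Fin 3) (p : Nil) (j l : Fin 3) :
    frameConnection S k p j l = -frameConnection S k p l j := by
  have c := contDiff_frameMatrix h.2.1
  have h1 : (fun q => frameMatrix S q 0 j * frameMatrix S q 0 l
      + frameMatrix S q 1 j * frameMatrix S q 1 l + frameMatrix S q 2 j * frameMatrix S q 2 l)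
      = fun _ => (1 : Matrix (Fin 3) (Fin 3) ℝ) j l := by
    funext q
    rw [← h.transpose_mul_frameMatrix q]
    simp [Matrix.mul_apply, Fin.sum_univ_three]
  have h2 := congrArg (fun f => frameDeriv k f p) h1
  simp only [frameDeriv_const] at h2
  rw [frameDeriv_add (((c 0 j).mul (c 0 l)).add ((c 1 j).mul (c 1 l))) ((c 2 j).mul (c 2 l)),
    frameDeriv_add ((c 0 j).mul (c 0 l)) ((c 1 j).mul (c 1 l)),
    frameDeriv_mul (c 0 j) (c 0 l), frameDeriv_mul (c 1 j) (c 1 l),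
    frameDeriv_mul (c 2 j) (c 2 l)] at h2
  simp only [frameConnection, Matrix.mul_apply, Matrix.transpose_apply, Fin.sum_univ_three,
    frameMatrixDeriv,
    Matrix.of_apply]
  linear_combination h2

end IsNilIsometry

/-- The first two rows of `frameMatrix S` are the differentials of functions. -/
lemma frameMatrixDeriv_hor {S : Nil → Nil} (hS : ContDiff ℝ ∞ S) (p : Nil) (i : Fin 3)
    (hi : i ≠ 2) :
    frameMatrixDeriv S 0 p i 1 - frameMatrixDeriv S 1 p i 0 = frameMatrix S p i 2 ∧
    frameMatrixDeriv S 0 p i 2 - frameMatrixDeriv S 2 p i 0 = 0 ∧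
    frameMatrixDeriv S 1 p i 2 - frameMatrixDeriv S 2 p i 1 = 0 := by
  have e : ∀ q j, frameMatrix S q i j = frameDeriv j (fun q => S q i) q := by
    intro q j
    fin_cases i
    · exact frameMatrix_zero hS q j
    · exact frameMatrix_one hS q j
    · exact absurd rfl hi
  have hc := contDiff_coord hS i
  simp only [frameMatrixDeriv, Matrix.of_apply, e]
  exact ⟨frameDeriv_bracket_zero_one hc p, sub_eq_zero.2 (frameDeriv_bracket_two hc 0 p),
    sub_eq_zero.2 (frameDeriv_bracket_two hc 1 p)⟩

/-- The last row of `frameMatrix S` is the pull-back of the contact form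
`dx₃ + (x₂ dx₁ - x₁ dx₂) / 2`, whose differential is `-dx₁ ∧ dx₂`. -/
lemma frameMatrixDeriv_ver {S : Nil → Nil} (hS : ContDiff ℝ ∞ S) (p : Nil) :
    frameMatrixDeriv S 0 p 2 1 - frameMatrixDeriv S 1 p 2 0 = frameMatrix S p 2 2
      - (frameMatrix S p 0 0 * frameMatrix S p 1 1 - frameMatrix S p 0 1 * frameMatrix S p 1 0) ∧
    frameMatrixDeriv S 0 p 2 2 - frameMatrixDeriv S 2 p 2 0
      = -(frameMatrix S p 0 0 * frameMatrix S p 1 2 - frameMatrix S p 0 2 * frameMatrix S p 1 0) ∧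
    frameMatrixDeriv S 1 p 2 2 - frameMatrixDeriv S 2 p 2 1
      = -(frameMatrix S p 0 1 * frameMatrix S p 1 2
        - frameMatrix S p 0 2 * frameMatrix S p 1 1) := by
  have c := contDiff_coord hS
  have m := contDiff_frameMatrix hS
  have e (k j : Fin 3) : frameMatrixDeriv S k p 2 j = frameDeriv k (frameDeriv j fun q => S q 2) p
      + 1 / 2 * (frameMatrix S p 1 k * frameMatrix S p 0 j
          + S p 1 * frameMatrixDeriv S k p 0 j)
      + -1 / 2 * (frameMatrix S p 0 k * frameMatrix S p 1 j
          + S p 0 * frameMatrixDeriv S k p 1 j) := by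
    simp only [frameMatrixDeriv, Matrix.of_apply]
    have h2 : (fun q => frameMatrix S q 2 j) = fun q => (frameDeriv j (fun q => S q 2) q
      + 1 / 2 * (S q 1 * frameMatrix S q 0 j)) + -1 / 2 * (S q 0 * frameMatrix S q 1 j) := by
      funext q; exact frameMatrix_two hS q j
    have d := contDiff_frameDeriv (c 2) j
    rw [h2, frameDeriv_add (d.add (contDiff_const.mul ((c 1).mul (m 0 j))))
      (contDiff_const.mul ((c 0).mul (m 1 j))),
      frameDeriv_add d (contDiff_const.mul ((c 1).mul (m 0 j))),
      frameDeriv_const_mul ((c 1).mul (m 0 j)), frameDeriv_const_mul ((c 0).mul (m 1 j)),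
      frameDeriv_mul (c 1) (m 0 j), frameDeriv_mul (c 0) (m 1 j), ← frameMatrix_zero hS,
      ← frameMatrix_one hS]
  obtain ⟨x1, x2, x3⟩ := frameMatrixDeriv_hor hS p 0 (by decide)
  obtain ⟨y1, y2, y3⟩ := frameMatrixDeriv_hor hS p 1 (by decide)
  have b1 := frameDeriv_bracket_zero_one (c 2) p
  have b2 := frameDeriv_bracket_two (c 2) 0 p
  have b3 := frameDeriv_bracket_two (c 2) 1 p
  have e2 := frameMatrix_two hS p 2
  rw [e, e, e, e, e, e]
  refine ⟨?_, ?_, ?_⟩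
  · linear_combination b1 + 1 / 2 * S p 1 * x1 - 1 / 2 * S p 0 * y1 - e2
  · linear_combination b2 + 1 / 2 * S p 1 * x2 - 1 / 2 * S p 0 * y2
  · linear_combination b3 + 1 / 2 * S p 1 * x3 - 1 / 2 * S p 0 * y3

namespace IsNilIsometry

variable {S : Nil → Nil}

/-- The minors of the first two rows of an orthogonal matrix of determinant `1`. -/
lemma minors (h : IsNilIsometry S) {p : Nil} (hdet : (frameMatrix S p).det = 1) :
    frameMatrix S p 0 0 * frameMatrix S p 1 1 - frameMatrix S p 0 1 * frameMatrix S p 1 0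
      = frameMatrix S p 2 2 ∧
    frameMatrix S p 0 0 * frameMatrix S p 1 2 - frameMatrix S p 0 2 * frameMatrix S p 1 0
      = -frameMatrix S p 2 1 ∧
    frameMatrix S p 0 1 * frameMatrix S p 1 2 - frameMatrix S p 0 2 * frameMatrix S p 1 1
      = frameMatrix S p 2 0 := by
  have h1 : (frameMatrix S p).adjugate = (frameMatrix S p)ᵀ := by
    have := Matrix.mul_adjugate (frameMatrix S p)
    rw [hdet, one_smul] at this
    rw [← Matrix.one_mul (frameMatrix S p).adjugate, ← h.transpose_mul_frameMatrix p,
      Matrix.mul_assoc, this, Matrix.mul_one]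
  have e (i j : Fin 3) := congrFun (congrFun h1 i) j
  have e0 := e 0 2
  have e1 := e 1 2
  have e2 := e 2 2
  simp [Matrix.adjugate_fin_three] at e0 e1 e2
  refine ⟨?_, ?_, ?_⟩ <;> linarith

/-- The equations for the exterior derivatives of the rows and the antisymmetry of `aᵀ Dₖ a`
determine the derivative of the frame matrix, as the Levi-Civita connection is determined by the
torsion and the metric. -/
lemma frameConnection_eq (h : IsNilIsometry S) {p : Nil} (hdet : (frameMatrix S p).det = 1) :
    let a := frameMatrix S p
    let w := frameConnection S
    (w 0 p 0 1 = -a 2 0 * a 2 2 ∧ w 1 p 0 1 = -a 2 1 * a 2 2 ∧ w 2 p 0 1 = a 2 0 ^ 2 + a 2 1 ^ 2) ∧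
    (w 0 p 0 2 = a 2 0 * a 2 1 ∧ w 1 p 0 2 = a 2 1 ^ 2 ∧ w 2 p 0 2 = a 2 1 * a 2 2) ∧
    (w 0 p 1 2 = -a 2 0 ^ 2 ∧ w 1 p 1 2 = -a 2 0 * a 2 1 ∧ w 2 p 1 2 = -a 2 0 * a 2 2) := by
  obtain ⟨n1, n2, n3⟩ := h.minors hdet
  obtain ⟨x1, x2, x3⟩ := frameMatrixDeriv_hor h.2.1 p 0 (by decide)
  obtain ⟨y1, y2, y3⟩ := frameMatrixDeriv_hor h.2.1 p 1 (by decide)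
  obtain ⟨z1, z2, z3⟩ := frameMatrixDeriv_ver h.2.1 p
  rw [n1] at z1
  rw [n2] at z2
  rw [n3] at z3
  have hs (k : Fin 3) := h.frameConnection_antisymm k p
  have hr := congrFun (congrFun (h.mul_frameMatrix_transpose p) 2) 2
  have ho (j : Fin 3) := congrFun (congrFun (h.transpose_mul_frameMatrix p) j) 2
  have ho0 := ho 0
  have ho1 := ho 1
  have ho2 := ho 2
  simp only [Matrix.mul_apply, Fin.sum_univ_three, Matrix.transpose_apply] at hr ho0 ho1 ho2
  simp only [Matrix.one_apply, Fin.reduceEq, ↓reduceIte] at hr ho0 ho1 ho2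
  set a := frameMatrix S p
  set d := fun k => frameMatrixDeriv S k p with hd
  set w := frameConnection S
  have hw (k i j : Fin 3) : w k p i j = a 0 i * d k 0 j + a 1 i * d k 1 j
      + a 2 i * d k 2 j := by
    simp [w, frameConnection, a, d, Matrix.mul_apply, Fin.sum_univ_three]
  change d 0 0 1 - d 1 0 0 = _ at x1
  change d 0 0 2 - d 2 0 0 = _ at x2
  change d 1 0 2 - d 2 0 1 = _ at x3
  change d 0 1 1 - d 1 1 0 = _ at y1
  change d 0 1 2 - d 2 1 0 = _ at y2
  change d 1 1 2 - d 2 1 1 = _ at y3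
  change d 0 2 1 - d 1 2 0 = _ at z1
  change d 0 2 2 - d 2 2 0 = _ at z2
  change d 1 2 2 - d 2 2 1 = _ at z3
  have f01 (i : Fin 3) : w 0 p i 1 - w 1 p i 0
      = a 0 i * a 0 2 + a 1 i * a 1 2 := by
    rw [hw, hw]; linear_combination a 0 i * x1 + a 1 i * y1 + a 2 i * z1
  have f02 (i : Fin 3) : w 0 p i 2 - w 2 p i 0 = a 2 i * a 2 1 := by
    rw [hw, hw]; linear_combination a 0 i * x2 + a 1 i * y2 + a 2 i * z2
  have f12 (i : Fin 3) : w 1 p i 2 - w 2 p i 1 = -a 2 i * a 2 0 := by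
    rw [hw, hw]; linear_combination a 0 i * x3 + a 1 i * y3 + a 2 i * z3
  have hz (k i : Fin 3) : w k p i i = 0 := by linarith [hs k i i]
  have f010 := f01 0
  have f011 := f01 1
  have f012 := f01 2
  have f020 := f02 0
  have f021 := f02 1
  have f022 := f02 2
  have f120 := f12 0
  have f121 := f12 1
  have f122 := f12 2
  rw [hz] at f010 f020 f011 f022 f121 f122
  rw [hs _ 1 0] at f011 f021
  rw [hs _ 2 0] at f022 f012
  rw [hs _ 2 1] at f012 f122
  refine ⟨⟨?_, ?_, ?_⟩, ⟨?_, ?_, ?_⟩, ⟨?_, ?_, ?_⟩⟩ <;> linarith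

lemma frameMatrixDeriv_eq (h : IsNilIsometry S) (k : Fin 3) (p : Nil) :
    frameMatrixDeriv S k p
      = frameMatrix S p * frameConnection S k p := by
  rw [frameConnection, ← Matrix.mul_assoc, h.mul_frameMatrix_transpose, Matrix.one_mul]

/-- The last row of the frame matrix is `(0, 0, ±1)`: its first two entries do not change along
`E₁` and `E₂`, hence not along `[E₁, E₂] = E₃` either, but they rotate into each other along
`E₃`. -/
lemma frameMatrix_two_eq_zero (h : IsNilIsometry S) (hdet : ∀ p, (frameMatrix S p).det = 1)
    (p : Nil) : frameMatrix S p 2 0 = 0 ∧ frameMatrix S p 2 1 = 0 := by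
  have key (p : Nil) : (frameDeriv 0 (fun q => frameMatrix S q 2 0) p = 0 ∧
      frameDeriv 1 (fun q => frameMatrix S q 2 0) p = 0 ∧
      frameDeriv 2 (fun q => frameMatrix S q 2 0) p = -frameMatrix S p 2 1) ∧
      (frameDeriv 0 (fun q => frameMatrix S q 2 1) p = 0 ∧
      frameDeriv 1 (fun q => frameMatrix S q 2 1) p = 0 ∧
      frameDeriv 2 (fun q => frameMatrix S q 2 1) p = frameMatrix S p 2 0) := by
    obtain ⟨⟨x0, x1, x2⟩, ⟨y0, y1, y2⟩, z0, z1, z2⟩ := h.frameConnection_eq (hdet p)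
    have hs (k : Fin 3) := h.frameConnection_antisymm k p
    have e (k j : Fin 3) : frameDeriv k (fun q => frameMatrix S q 2 j) p = _ :=
      (congrFun (congrFun (h.frameMatrixDeriv_eq k p) 2) j)
    have hr := congrFun (congrFun (h.mul_frameMatrix_transpose p) 2) 2
    simp only [Matrix.mul_apply (M := frameMatrix S p), Fin.sum_univ_three,
      Matrix.transpose_apply, Matrix.one_apply, ↓reduceIte] at hr e
    have hz (k i : Fin 3) : frameConnection S k p i i = 0 := by
      linarith [hs k i i]
    refine ⟨⟨?_, ?_, ?_⟩, ?_, ?_, ?_⟩ <;> rw [e, hz]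
    · rw [hs 0 1 0, hs 0 2 0, x0, y0]; ring
    · rw [hs 1 1 0, hs 1 2 0, x1, y1]; ring
    · rw [hs 2 1 0, hs 2 2 0, x2, y2]; linear_combination -frameMatrix S p 2 1 * hr
    · rw [hs 0 2 1, x0, z0]; ring
    · rw [hs 1 2 1, x1, z1]; ring
    · rw [hs 2 2 1, x2, z2]; linear_combination frameMatrix S p 2 0 * hr
  have c := contDiff_frameMatrix h.2.1 2
  have b0 := frameDeriv_bracket_zero_one (c 0) p
  have b1 := frameDeriv_bracket_zero_one (c 1) p
  rw [funext fun q => (key q).1.1, funext fun q => (key q).1.2.1, frameDeriv_const,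
    frameDeriv_const, (key p).1.2.2] at b0
  rw [funext fun q => (key q).2.1, funext fun q => (key q).2.2.1, frameDeriv_const,
    frameDeriv_const, (key p).2.2.2] at b1
  exact ⟨by linarith, by linarith⟩

/-- The frame matrix of an isometry of determinant `1` is constant. -/
lemma frameMatrix_const (h : IsNilIsometry S) (hdet : ∀ p, (frameMatrix S p).det = 1)
    (p q : Nil) : frameMatrix S p = frameMatrix S q := by
  ext i j
  refine eq_of_frameDeriv_eq_zero (contDiff_frameMatrix h.2.1 i j) (fun k p => ?_) p q
  obtain ⟨h0, h1⟩ := h.frameMatrix_two_eq_zero hdet p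
  obtain ⟨⟨x0, x1, x2⟩, ⟨y0, y1, y2⟩, z0, z1, z2⟩ := h.frameConnection_eq (hdet p)
  simp only [h0, h1, neg_zero, zero_mul, zero_pow two_ne_zero, add_zero] at x0 x1 x2 y0 y1 y2
  simp only [h0, h1, neg_zero, zero_mul, zero_pow two_ne_zero] at z0 z1 z2
  have hs := h.frameConnection_antisymm k p
  have hw : frameConnection S k p = 0 := by
    have hz (i : Fin 3) : frameConnection S k p i i = 0 := by
      linarith [hs i i]
    have w01 : frameConnection S k p 0 1 = 0 := by
      fin_cases k <;> assumption
    have w02 : frameConnection S k p 0 2 = 0 := by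
      fin_cases k <;> assumption
    have w12 : frameConnection S k p 1 2 = 0 := by
      fin_cases k <;> assumption
    ext i j
    rw [Matrix.zero_apply]
    fin_cases i <;> fin_cases j
    · exact hz 0
    · exact w01
    · exact w02
    · exact (hs 1 0).trans (by rw [w01, neg_zero])
    · exact hz 1
    · exact w12
    · exact (hs 2 0).trans (by rw [w02, neg_zero])
    · exact (hs 2 1).trans (by rw [w12, neg_zero])
    · exact hz 2
  have := congrFun (congrFun (h.frameMatrixDeriv_eq k p) i) j
  rw [hw, Matrix.mul_zero] at this
  exact this

lemma comp {T : Nil → Nil} (h : IsNilIsometry S) (hT : IsNilIsometry T) :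
    IsNilIsometry (S ∘ T) := by
  refine ⟨h.1.comp hT.1, h.2.1.comp hT.2.1, fun p v w => ?_⟩
  rw [fderiv_comp p (h.2.1.differentiable (by simp) _) (hT.2.1.differentiable (by simp) _)]
  exact (h.2.2 _ _ _).trans (hT.2.2 _ _ _)

/-- The fourth power of an isometry induces a direct rigid motion of the `(x₁, x₂)`-plane, and its
differential has the block form of a rotation around the `x₃`-direction. -/
lemma exists_rotation (h : IsNilIsometry S) :
    ∃ c s : ℝ, c ^ 2 + s ^ 2 = 1 ∧ ∀ p, frameMatrix ((S ∘ S) ∘ (S ∘ S)) p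
      = !![c, -s, 0; s, c, 0; 0, 0, 1] := by
  have h2 := h.comp h
  have hdet := h.det_frameMatrix_comp_self
  set a := frameMatrix (S ∘ S) 0 with ha
  obtain ⟨h20, h21⟩ := h2.frameMatrix_two_eq_zero hdet 0
  rw [← ha] at h20 h21
  have hr (i j : Fin 3) := congrFun (congrFun (h2.mul_frameMatrix_transpose 0) i) j
  have hc (i j : Fin 3) := congrFun (congrFun (h2.transpose_mul_frameMatrix 0) i) j
  rw [← ha] at hr hc
  simp only [Matrix.mul_apply, Fin.sum_univ_three, Matrix.transpose_apply] at hr hc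
  have r00 := hr 0 0
  have r01 := hr 0 1
  have r02 := hr 0 2
  have r12 := hr 1 2
  have r11 := hr 1 1
  have r22 := hr 2 2
  have c01 := hc 0 1
  have c11 := hc 1 1
  have c00 := hc 0 0
  simp [h20, h21] at r00 r01 r02 r12 r11 r22 c01 c11 c00
  have h22 : a 2 2 ≠ 0 := fun h0 => by rw [h0] at r22; norm_num at r22
  have h02 : a 0 2 = 0 := r02.resolve_right h22
  have h12 : a 1 2 = 0 := r12.resolve_right h22
  rw [h02, h12] at r01
  rw [h02] at r00
  rw [h12] at r11
  -- `M²` is a rotation for every orthogonal `2 × 2` matrix `M`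
  have hsq : a 0 0 * a 0 0 = a 1 1 * a 1 1 := by linear_combination r00 - c11
  have hns : (a 0 1 + a 1 0) * (a 0 0 + a 1 1) = 0 := by linear_combination r01 + c01
  refine ⟨a 0 0 * a 0 0 + a 0 1 * a 1 0, a 1 0 * (a 0 0 + a 1 1), ?_, fun p => ?_⟩
  · linear_combination (a 0 0 * a 0 0 + a 0 1 * a 1 0) * hsq + a 1 0 * (a 0 0 + a 1 1) * hns
      + (a 1 0 ^ 2 + a 1 1 ^ 2) * r00 + r11 - (a 0 0 * a 1 0 + a 0 1 * a 1 1) * r01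
  · rw [frameMatrix_comp h2.2.1 h2.2.1, h2.frameMatrix_const hdet _ 0,
      h2.frameMatrix_const hdet p 0, ← ha]
    ext i j
    fin_cases i <;> fin_cases j <;>
      simp [Matrix.mul_apply, Fin.sum_univ_three, h20, h21, h02, h12]
    · linear_combination hns
    · ring
    · linear_combination -hsq
    · exact r22

end IsNilIsometry

/-! ### Rigid motions of the base and the absence of continuous symmetries -/

/-- `T` covers the direct rigid motion of the `(x₁, x₂)`-plane with rotation part `(c, s)` and
translation part `(b₀, b₁)`; if this motion is the identity, then `T` is a vertical
translation. -/
structure CoversRigidMotion (T : Nil → Nil) (c s b₀ b₁ : ℝ) : Prop where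
  sq_add_sq : c ^ 2 + s ^ 2 = 1
  zero : ∀ p, T p 0 = c * p 0 - s * p 1 + b₀
  one : ∀ p, T p 1 = s * p 0 + c * p 1 + b₁
  two : c = 1 → b₀ = 0 → b₁ = 0 → ∃ k, ∀ p, T p 2 = p 2 + k

lemma frameDeriv_proj (i k : Fin 3) (p : Nil) :
    frameDeriv k (fun q => q i) p = frameField k p i := by
  rw [frameDeriv]
  exact congrArg (fun L : Nil →L[ℝ] ℝ => L (frameField k p))
    (ContinuousLinearMap.proj (R := ℝ) (φ := fun _ : Fin 3 => ℝ) i).hasFDerivAt.fderiv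

lemma eq_affine_of_frameDeriv {f : Nil → ℝ} (hf : ContDiff ℝ ∞ f) {m : Fin 3 → ℝ}
    (h : ∀ k p, frameDeriv k f p = ∑ i, m i * frameField k p i) :
    ∃ b, ∀ p, f p = m 0 * p 0 + m 1 * p 1 + m 2 * p 2 + b := by
  have c (i : Fin 3) : ContDiff ℝ ∞ fun q : Nil => -m i * q i :=
    contDiff_const.mul (contDiff_apply ℝ ℝ i)
  refine ⟨f 0, fun p => ?_⟩
  have := eq_of_frameDeriv_eq_zero (((hf.add (c 0)).add (c 1)).add (c 2)) (fun k p => ?_) p 0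
  · simp at this
    linarith
  · rw [frameDeriv_add ((hf.add (c 0)).add (c 1)) (c 2), frameDeriv_add (hf.add (c 0)) (c 1),
      frameDeriv_add hf (c 0), h, frameDeriv_const_mul (contDiff_apply ℝ ℝ 0),
      frameDeriv_const_mul (contDiff_apply ℝ ℝ 1), frameDeriv_const_mul (contDiff_apply ℝ ℝ 2),
      frameDeriv_proj, frameDeriv_proj, frameDeriv_proj, Fin.sum_univ_three]
    ring

lemma IsNilIsometry.exists_coversRigidMotion {S : Nil → Nil} (h : IsNilIsometry S) :
    ∃ c s b₀ b₁, CoversRigidMotion ((S ∘ S) ∘ (S ∘ S)) c s b₀ b₁ := by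
  obtain ⟨c, s, hcs, hM⟩ := h.exists_rotation
  have hT := ((h.comp h).comp (h.comp h)).2.1
  set T := (S ∘ S) ∘ (S ∘ S)
  have hc := contDiff_coord hT
  obtain ⟨b₀, hb₀⟩ := eq_affine_of_frameDeriv (hc 0) (m := ![c, -s, 0]) fun k p => by
    rw [← frameMatrix_zero hT, hM]
    fin_cases k <;> simp [Fin.sum_univ_three, frameField]
  obtain ⟨b₁, hb₁⟩ := eq_affine_of_frameDeriv (hc 1) (m := ![s, c, 0]) fun k p => by
    rw [← frameMatrix_one hT, hM]
    fin_cases k <;> simp [Fin.sum_univ_three, frameField]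
  refine ⟨c, s, b₀, b₁, hcs, fun p => ?_, fun p => ?_, fun h1 h2 h3 => ?_⟩
  · rw [hb₀]; simp; ring
  · rw [hb₁]; simp
  · subst h1 h2 h3
    have hs : s = 0 := by nlinarith
    subst hs
    obtain ⟨b₂, hb₂⟩ := eq_affine_of_frameDeriv (hc 2) (m := ![0, 0, 1]) fun k p => by
      have := frameMatrix_two hT p k
      rw [hM, hb₀, hb₁] at this
      fin_cases k <;> simp [Fin.sum_univ_three, frameField] at this ⊢ <;> linarith
    exact ⟨b₂, fun p => by rw [hb₂]; simp⟩

lemma eq_zero_of_forall_abs_le {x b B : ℝ} (h : ∀ n : ℤ, |x + n * b| ≤ B) : b = 0 := by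
  by_contra hb
  obtain ⟨n, hn⟩ := exists_nat_gt ((B + |x|) / |b|)
  have h1 : 0 < |b| := abs_pos.2 hb
  rw [div_lt_iff₀ h1] at hn
  have h2 := h n
  have h3 : |(n : ℝ) * b| = n * |b| := by rw [abs_mul, Nat.abs_cast]
  have h4 := abs_sub_abs_le_abs_sub ((n : ℝ) * b) (-x)
  rw [h3, abs_neg, sub_neg_eq_add, add_comm _ x] at h4
  push_cast at h2
  linarith

/-- Integer iterates of a map that leaves a set invariant and acts on it as a translation,
measured by a function `f`. -/
lemma exists_iterate {X E : Type*} [AddCommGroup E] {K : Set X} {T : X → X} (hK : T '' K = K)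
    {f : X → E} {b : E} (hT : ∀ p, f (T p) = f p + b) {p : X} (hp : p ∈ K) (n : ℤ) :
    ∃ q ∈ K, f q = f p + n • b := by
  induction n using Int.induction_on with
  | zero => exact ⟨p, hp, by simp⟩
  | succ n ih =>
    obtain ⟨q, hq, hqn⟩ := ih
    refine ⟨T q, hK ▸ Set.mem_image_of_mem T hq, ?_⟩
    rw [hT, hqn, add_smul, one_smul, add_assoc]
  | pred n ih =>
    obtain ⟨q, hq, hqn⟩ := ih
    rw [← hK] at hq
    obtain ⟨r, hr, rfl⟩ := hq
    refine ⟨r, hr, ?_⟩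
    rw [hT] at hqn
    rw [sub_smul, one_smul, ← add_sub_assoc, ← hqn, add_sub_cancel_right]

namespace IsCatenoidDatum

variable {α θ : ℝ} {φ : ℝ → ℝ}

/-- The coordinate `x₁` is unbounded on the catenoid: it is `±(C/α) cosh A` where
`cos φ = 0`. -/
lemma exists_lt_abs_zero (h : IsCatenoidDatum α θ φ) (B : ℝ) :
    ∃ p ∈ horizontalCatenoid α θ φ, B < |p 0| := by
  have hα := h.alpha_pos
  have hC := h.Cst_pos
  obtain ⟨u, hu⟩ := h.surjective_phase (Real.pi / 2)
  set N := |B| * α / Cst α θ + 1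
  refine ⟨_, ⟨⟨u, (N - betaFun α θ φ u) / α⟩, rfl⟩, ?_⟩
  have hA : AFun α θ φ ⟨u, (N - betaFun α θ φ u) / α⟩ = N := by
    simp only [AFun]; field_simp; ring
  have hN : 0 ≤ N := by positivity
  have h1 : N < Real.cosh N := (Real.self_le_sinh_iff.2 hN).trans_lt (Real.sinh_lt_cosh N)
  simp only [catenoidImmersion, hA, hu, Real.cos_pi_div_two, Real.sin_pi_div_two, mul_zero,
    zero_mul, mul_one, zero_sub, Matrix.cons_val_zero, abs_neg]
  rw [abs_of_pos (mul_pos (div_pos hC hα) (Real.cosh_pos _))]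
  have h2 : Cst α θ / α * N = |B| + Cst α θ / α := by
    simp only [N]; field_simp
  have h3 := mul_lt_mul_of_pos_left h1 (div_pos hC hα)
  have h4 := div_pos hC hα
  linarith [le_abs_self B]

lemma exists_mem_one_eq (h : IsCatenoidDatum α θ φ) (d : ℝ) :
    ∃ p ∈ horizontalCatenoid α θ φ, p 1 = d := by
  obtain ⟨_, p, ⟨hp, hd⟩, -⟩ := h.slice_nonempty d
  exact ⟨p, hp, hd⟩

/-- The catenoid is not invariant under a translation of the base: a translation with a component
along the `x₂`-axis would, by the symmetry `x₁ ↦ -x₁`, bound `x₁` on the whole catenoid by its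
bound over a strip, and other translations would leave a compact slice invariant. -/
lemma eq_id_of_image_eq (h : IsCatenoidDatum α θ φ) {T : Nil → Nil} {s b₀ b₁ : ℝ}
    (hT : CoversRigidMotion T 1 s b₀ b₁)
    (hK : T '' horizontalCatenoid α θ φ = horizontalCatenoid α θ φ) : T = id := by
  have hs : s = 0 := by nlinarith [hT.sq_add_sq]
  have hiter : ∀ p ∈ horizontalCatenoid α θ φ, ∀ n : ℤ, ∃ q ∈ horizontalCatenoid α θ φ,
      q 0 = p 0 + n * b₀ ∧ q 1 = p 1 + n * b₁ := by
    intro p hp n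
    obtain ⟨q, hq, he⟩ := exists_iterate hK (f := fun p : Nil => (p 0, p 1)) (b := (b₀, b₁))
      (fun p => by simp [hT.zero, hT.one, hs]) hp n
    rw [Prod.ext_iff] at he
    exact ⟨q, hq, by simpa using he.1, by simpa using he.2⟩
  have hb₁ : b₁ = 0 := by
    by_contra hb
    obtain ⟨B, hB⟩ := h.exists_bound_of_depth |b₁|
    obtain ⟨p, hp, hpB⟩ := h.exists_lt_abs_zero B
    obtain ⟨n, hn⟩ : ∃ n : ℤ, |p 1 + n * b₁| ≤ |b₁| := by
      refine ⟨-⌊p 1 / b₁⌋, ?_⟩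
      have e : p 1 + ((-⌊p 1 / b₁⌋ : ℤ) : ℝ) * b₁ = Int.fract (p 1 / b₁) * b₁ := by
        rw [Int.fract]; push_cast; field_simp; ring
      rw [e, abs_mul, abs_of_nonneg (Int.fract_nonneg _)]
      exact mul_le_of_le_one_left (abs_nonneg _) (Int.fract_lt_one _).le
    have hp' : rotX2 p ∈ horizontalCatenoid α θ φ := h.rotX2_image ▸ Set.mem_image_of_mem _ hp
    obtain ⟨q, hq, hq0, hq1⟩ := hiter p hp n
    obtain ⟨q', hq', hq0', hq1'⟩ := hiter _ hp' n
    have e0 : rotX2 p 0 = -p 0 := rfl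
    have e1 : rotX2 p 1 = p 1 := rfl
    have k1 := hB q hq (by rwa [hq1]) 0
    have k2 := hB q' hq' (by rwa [hq1', e1]) 0
    rw [hq0] at k1
    rw [hq0', e0] at k2
    rw [abs_le] at k1 k2
    exact absurd hpB (not_lt.2 (abs_le.2 ⟨by linarith, by linarith⟩))
  subst hb₁
  obtain ⟨p, hp, hp1⟩ := h.exists_mem_one_eq 0
  obtain ⟨B, hB⟩ := h.exists_bound_of_depth 0
  have hb₀ : b₀ = 0 := eq_zero_of_forall_abs_le (x := p 0) (B := B) fun n => by
    obtain ⟨q, hq, hq0, hq1⟩ := hiter p hp n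
    rw [← hq0]
    exact hB q hq (by simp [hq1, hp1]) 0
  subst hb₀
  obtain ⟨k, hk⟩ := hT.two rfl rfl rfl
  have hTk (p : Nil) : T p = p + ![0, 0, k] := by
    ext i
    fin_cases i <;> simp [hT.zero, hT.one, hk, hs]
  have hk0 : k = 0 := eq_zero_of_forall_abs_le (x := p 2) (B := B) fun n => by
    obtain ⟨q, hq, he⟩ := exists_iterate hK (f := id) hTk hp n
    have h2 : q 2 = p 2 + n * k := by simpa using congrFun he 2
    have h1 : q 1 = p 1 := by simpa using congrFun he 1
    rw [← h2]
    exact hB q hq (by simp [h1, hp1]) 2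
  funext p
  rw [hTk, hk0]
  ext i
  fin_cases i <;> simp

/-- A one-parameter group of isometries that leaves the catenoid invariant would act on the base
by rotations around a point `(q₀, q₁)`. Some rotation of angle at least a quarter turn then
moves points of the catenoid with `x₂` large across the plane `x₂ = q₁`, which they meet far
away from the origin, whereas the slice by this plane is bounded. -/
theorem not_invariant (h : IsCatenoidDatum α θ φ) {Φ : ℝ → Nil → Nil}
    (hΦ : IsOneParameterGroup Φ) :
    ¬ ∀ t, Φ t '' horizontalCatenoid α θ φ = horizontalCatenoid α θ φ := by
  intro hK
  have hex (t : ℝ) : ∃ c s b₀ b₁, CoversRigidMotion (Φ t) c s b₀ b₁ := by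
    have := (hΦ.isometry (t / 4)).exists_coversRigidMotion
    rwa [← hΦ.map_add, ← hΦ.map_add, show t / 4 + t / 4 + (t / 4 + t / 4) = t by ring] at this
  choose c s b₀ b₁ hM using hex
  obtain ⟨t₀, ht₀⟩ : ∃ t, c t ≠ 1 := by
    by_contra! hc
    obtain ⟨t, ht⟩ := hΦ.nontrivial
    have := hM t
    rw [hc t] at this
    exact ht (h.eq_id_of_image_eq this (hK t))
  have hle (t : ℝ) : c t ≤ 1 := by nlinarith [(hM t).sq_add_sq, sq_nonneg (s t)]
  have hΔ : 0 < (c t₀ - 1) ^ 2 + s t₀ ^ 2 := by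
    have := sq_pos_of_ne_zero (sub_ne_zero.2 ht₀)
    positivity
  -- the fixed point of the motion covered by `Φ t₀`
  obtain ⟨q₀, q₁, hq0, hq1⟩ : ∃ q₀ q₁, c t₀ * q₀ - s t₀ * q₁ + b₀ t₀ = q₀ ∧
      s t₀ * q₀ + c t₀ * q₁ + b₁ t₀ = q₁ := by
    refine ⟨(-(c t₀ - 1) * b₀ t₀ - s t₀ * b₁ t₀) / ((c t₀ - 1) ^ 2 + s t₀ ^ 2),
      (s t₀ * b₀ t₀ - (c t₀ - 1) * b₁ t₀) / ((c t₀ - 1) ^ 2 + s t₀ ^ 2), ?_, ?_⟩ <;>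
    · field_simp
      ring
  -- the motions commute, hence have the same fixed point
  have hfix (t : ℝ) : c t * q₀ - s t * q₁ + b₀ t = q₀ ∧ s t * q₀ + c t * q₁ + b₁ t = q₁ := by
    have hcomm : Φ t₀ (Φ t ![q₀, q₁, 0]) = Φ t (Φ t₀ ![q₀, q₁, 0]) := by
      have h1 := congrFun (hΦ.map_add t₀ t) ![q₀, q₁, 0]
      have h2 := congrFun (hΦ.map_add t t₀) ![q₀, q₁, 0]
      rw [add_comm] at h1
      exact h1.symm.trans h2
    have e0 := congrFun hcomm 0
    have e1 := congrFun hcomm 1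
    rw [(hM t₀).zero, (hM t).zero, (hM t).zero, (hM t).one, (hM t₀).zero, (hM t₀).one] at e0
    rw [(hM t₀).one, (hM t).zero, (hM t).one, (hM t).one, (hM t₀).zero, (hM t₀).one] at e1
    simp only [Matrix.cons_val_zero, Matrix.cons_val_one, hq0, hq1] at e0 e1
    set x := c t * q₀ - s t * q₁ + b₀ t
    set y := s t * q₀ + c t * q₁ + b₁ t
    have f0 : (c t₀ - 1) * (x - q₀) - s t₀ * (y - q₁) = 0 := by linear_combination e0 - hq0
    have f1 : s t₀ * (x - q₀) + (c t₀ - 1) * (y - q₁) = 0 := by linear_combination e1 - hq1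
    have g0 : ((c t₀ - 1) ^ 2 + s t₀ ^ 2) * (x - q₀) = 0 := by
      linear_combination (c t₀ - 1) * f0 + s t₀ * f1
    have g1 : ((c t₀ - 1) ^ 2 + s t₀ ^ 2) * (y - q₁) = 0 := by
      linear_combination (c t₀ - 1) * f1 - s t₀ * f0
    exact ⟨sub_eq_zero.1 ((mul_eq_zero.1 g0).resolve_left hΔ.ne'),
      sub_eq_zero.1 ((mul_eq_zero.1 g1).resolve_left hΔ.ne')⟩
  have hrot0 (t : ℝ) (p : Nil) : Φ t p 0 - q₀ = c t * (p 0 - q₀) - s t * (p 1 - q₁) := by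
    rw [(hM t).zero]; linear_combination (hfix t).1
  have hrot1 (t : ℝ) (p : Nil) : Φ t p 1 - q₁ = s t * (p 0 - q₀) + c t * (p 1 - q₁) := by
    rw [(hM t).one]; linear_combination (hfix t).2
  have hadd (t t' : ℝ) : c (t + t') = c t * c t' - s t * s t' := by
    have h1 := hrot0 (t + t') ![q₀ + 1, q₁, 0]
    rw [hΦ.map_add, Function.comp_apply, hrot0, hrot0, hrot1] at h1
    simp at h1
    linarith
  have hneg (t : ℝ) : c (-t) = c t ∧ s (-t) = -s t := by
    have h1 := hadd (-t) t
    have h0 : c 0 = 1 := by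
      have h1 := hrot0 0 ![q₀ + 1, q₁, 0]
      rw [hΦ.map_zero] at h1
      simpa using h1.symm
    rw [neg_add_cancel, h0] at h1
    have e1 := (hM t).sq_add_sq
    have e2 := (hM (-t)).sq_add_sq
    have e3 : (c (-t) - c t) ^ 2 + (s (-t) + s t) ^ 2 = 0 := by linear_combination e1 + e2 + 2 * h1
    have e4 : (c (-t) - c t) ^ 2 = 0 := by
      linarith [sq_nonneg (c (-t) - c t), sq_nonneg (s (-t) + s t)]
    have e5 : (s (-t) + s t) ^ 2 = 0 := by
      linarith [sq_nonneg (c (-t) - c t), sq_nonneg (s (-t) + s t)]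
    exact ⟨sub_eq_zero.1 (pow_eq_zero_iff two_ne_zero |>.1 e4),
      eq_neg_of_add_eq_zero_left (pow_eq_zero_iff two_ne_zero |>.1 e5)⟩
  -- as long as `c > 0`, doubling the time at least doubles `1 - c`
  obtain ⟨t₁, ht₁⟩ : ∃ t, c t ≤ 0 := by
    by_contra! hpos
    have hpow (n : ℕ) : 2 ^ n * (1 - c t₀) ≤ 1 - c (2 ^ n * t₀) := by
      induction n with
      | zero => simp
      | succ n ih =>
        have h1 := hadd (2 ^ n * t₀) (2 ^ n * t₀)
        rw [show 2 ^ n * t₀ + 2 ^ n * t₀ = 2 ^ (n + 1) * t₀ by ring] at h1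
        have h2 := (hM (2 ^ n * t₀)).sq_add_sq
        have h3 := hpos (2 ^ n * t₀)
        have h4 := hle (2 ^ n * t₀)
        have h5 : 1 - c (2 ^ (n + 1) * t₀) = 2 * (1 - c (2 ^ n * t₀))
            + 2 * c (2 ^ n * t₀) * (1 - c (2 ^ n * t₀)) := by
          linear_combination -h1 + h2
        have h6 := mul_nonneg (mul_nonneg zero_le_two h3.le) (sub_nonneg.2 h4)
        have h7 : (2 : ℝ) ^ (n + 1) * (1 - c t₀) = 2 * (2 ^ n * (1 - c t₀)) := by ring
        linarith
    have hd : 0 < 1 - c t₀ := sub_pos.2 (lt_of_le_of_ne (hle t₀) ht₀)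
    obtain ⟨n, hn⟩ := pow_unbounded_of_one_lt (1 / (1 - c t₀)) (one_lt_two (α := ℝ))
    rw [div_lt_iff₀ hd] at hn
    linarith [hpow n, hpos (2 ^ n * t₀)]
  obtain ⟨B, hB⟩ := h.exists_bound_of_depth |q₁|
  set R := |B| + |q₀| + 1 with hR
  have hR0 : 0 < R := by positivity
  obtain ⟨p, hp, hp1⟩ := h.exists_mem_one_eq (q₁ + R)
  have hf : Continuous fun t => Φ t p 1 := (continuous_apply 1).comp (hΦ.continuous p)
  obtain ⟨t, ht⟩ : q₁ ∈ Set.range fun t => Φ t p 1 := by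
    refine mem_range_of_exists_le_of_exists_ge hf ?_ ⟨0, ?_⟩
    · by_contra! hc
      have h1 := hrot1 t₁ p
      have h2 := hrot1 (-t₁) p
      rw [(hneg t₁).1, (hneg t₁).2] at h2
      have h3 : c t₁ * (p 1 - q₁) ≤ 0 :=
        mul_nonpos_of_nonpos_of_nonneg ht₁ (by rw [hp1]; linarith)
      linarith [hc t₁, hc (-t₁)]
    · simp only [hΦ.map_zero, id]
      linarith
  simp only at ht
  have hq : Φ t p ∈ horizontalCatenoid α θ φ := hK t ▸ Set.mem_image_of_mem _ hp
  have h0 := hB _ hq (by rw [ht]) 0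
  have h1 := hrot0 t p
  have h2 := hrot1 t p
  rw [ht, sub_self] at h2
  have h3 : (Φ t p 0 - q₀) ^ 2 = (p 0 - q₀) ^ 2 + (p 1 - q₁) ^ 2 := by
    rw [h1]
    linear_combination (((p 0 - q₀) ^ 2 + (p 1 - q₁) ^ 2)) * (hM t).sq_add_sq
      + (s t * (p 0 - q₀) + c t * (p 1 - q₁)) * h2
  rw [hp1, add_sub_cancel_left] at h3
  have h4 : R ≤ |Φ t p 0 - q₀| := by
    rw [← abs_of_pos hR0]
    exact sq_le_sq.1 (by rw [h3]; linarith [sq_nonneg (p 0 - q₀)])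
  have h5 := abs_sub (Φ t p 0) q₀
  linarith [le_abs_self B]

end IsCatenoidDatum

end NilCatenoid

theorem theorem5p6 (α : ℝ) (hα : 0 < α) :
    -- the catenoid is well defined: the angle and the phase exist and are unique
    (∃! θ : ℝ, NilCatenoid.IsCatenoidAngle α θ) ∧
    ∀ θ : ℝ, NilCatenoid.IsCatenoidAngle α θ →
      (∃! φ : ℝ → ℝ, NilCatenoid.IsPhase α θ φ) ∧
      ∀ φ : ℝ → ℝ, NilCatenoid.IsPhase α θ φ →
        -- it comes from a harmonic map through the Weierstrass representation
        NilCatenoid.IsHarmonicGauss (NilCatenoid.catenoidGauss α θ φ) ∧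
        NilCatenoid.IsConformalMinimalImmersionOn
          (NilCatenoid.catenoidImmersion α θ φ) Set.univ ∧
        NilCatenoid.gaussMap (NilCatenoid.catenoidImmersion α θ φ)
          = NilCatenoid.catenoidGauss α θ φ ∧
        NilCatenoid.WeierstrassEquations (NilCatenoid.catenoidGauss α θ φ)
          (NilCatenoid.catenoidImmersion α θ φ) ∧
        -- it is a properly embedded minimal annulus, conformal to the punctured plane
        (∃ (Y : ℂ → NilCatenoid.Nil) (Z : ℂ), Z ≠ 0 ∧
          (∀ z : ℂ, NilCatenoid.catenoidImmersion α θ φ z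
            = Y (Complex.exp (2 * Real.pi * Complex.I * z / Z))) ∧
          NilCatenoid.IsConformalMinimalImmersionOn Y {0}ᶜ ∧
          Topology.IsClosedEmbedding (fun w : ({0}ᶜ : Set ℂ) => Y w) ∧
          Y '' {0}ᶜ = NilCatenoid.horizontalCatenoid α θ φ) ∧
        -- every plane `x₂ = c` meets it in a non-empty closed embedded convex curve
        (∀ c : ℝ, (NilCatenoid.slice (NilCatenoid.horizontalCatenoid α θ φ) c).Nonempty ∧
          NilCatenoid.IsClosedEmbeddedConvexCurve
            (NilCatenoid.slice (NilCatenoid.horizontalCatenoid α θ φ) c)) ∧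
        -- symmetries
        NilCatenoid.rotX1 '' NilCatenoid.horizontalCatenoid α θ φ
          = NilCatenoid.horizontalCatenoid α θ φ ∧
        NilCatenoid.rotX2 '' NilCatenoid.horizontalCatenoid α θ φ
          = NilCatenoid.horizontalCatenoid α θ φ ∧
        NilCatenoid.rotX3 '' NilCatenoid.horizontalCatenoid α θ φ
          = NilCatenoid.horizontalCatenoid α θ φ ∧
        -- the `x₂`-axis is in the interior
        (∀ c : ℝ, ![0, c, 0] ∈ NilCatenoid.enclosedRegion
          (NilCatenoid.horizontalCatenoid α θ φ)) ∧
        -- no invariance under a one-parameter group of isometries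
        (∀ Φ : ℝ → NilCatenoid.Nil → NilCatenoid.Nil, NilCatenoid.IsOneParameterGroup Φ →
          ¬ ∀ t : ℝ, Φ t '' NilCatenoid.horizontalCatenoid α θ φ
            = NilCatenoid.horizontalCatenoid α θ φ) := by
  refine ⟨NilCatenoid.existsUnique_isCatenoidAngle hα, fun θ hθ => ?_⟩
  obtain ⟨h0, h1, h2⟩ := (NilCatenoid.mem_angle_interval_iff hα).1 hθ.1
  refine ⟨NilCatenoid.existsUnique_isPhase hα h2, fun φ hφ => ?_⟩
  have h : NilCatenoid.IsCatenoidDatum α θ φ := ⟨hα, h0, h1, h2, hθ.2, hφ⟩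
  exact ⟨h.isHarmonicGauss,
    NilCatenoid.isConformalMinimalImmersionOn_of fun z _ => h.isConformalHarmonicAt z,
    h.gaussMap_eq, h.weierstrassEquations,
    ⟨NilCatenoid.annulus α θ φ, NilCatenoid.periodVector α θ φ, h.periodVector_ne_zero,
      fun z => (h.annulus_exp z).symm,
      NilCatenoid.isConformalMinimalImmersionOn_of fun _ hw => h.isConformalHarmonicAt_annulus hw,
      h.isClosedEmbedding_annulus h.eq_add_of_catenoidImmersion_eq, h.annulus_image⟩,
    fun c => ⟨h.slice_nonempty c, h.isClosedEmbeddedConvexCurve_slice c⟩,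
    h.rotX1_image, h.rotX2_image, h.rotX3_image, h.axis_mem_enclosedRegion,
    fun _ hΦ => h.not_invariant hΦ⟩
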